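/- All functions are real-valued, $\mathbb{I}=[-1,1]$, $L_p=L_p(\mathbb{I})$ with norm $\|\cdot\|_p$. For an interval $[a,b]$ and $n\ge 1$, $L_2^n[a,b]$ is the set of functions on $[a,b]$ whose derivative of order $n-1$ exists and is absolutely continuous on $[a,b]$ and whose $n$-th derivative belongs to $L_2[a,b]$. Let $W_2^r=\{f\in L_2^r(\mathbb{I}):\|f^{(r)}\|_2\le 1\}$. For $N>0$ put $$E_N(D^k;W_2^r)=\inf_{\|S\|\le N}U(D^k;S;W_2^r),\qquad U(D^k;S;W_2^r)=\sup_{f\in W_2^r}\|f^{(k)}-Sf\|_\infty ,$$ the infimum being over bounded linear operators $S:L_2\to L_\infty$, and, for $t\in\mathbb{I}$, let $$E_N(D^k_t;W_2^r)=\inf_{\|S\|\le N}\ \sup_{f\in W_2^r}|f^{(k)}(t)-Sf|,$$ the infimum being over bounded linear functionals $S:L_2\to\mathbb{R}$. Let $M$ and $M_t$ be the smallest constants such that $\|Q^{(k)}\|_\infty\le M\|Q\|_2$ and $|Q^{(k)}(t)|\le M_t\|Q\|_2$, respectively, for all polynomials $Q$ of degree at most $r-1$. For $0\le k\le r-1$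 and $\lambda\ge0$, let $u_\lambda\in L_2^{2r}(\mathbb{I})$ be the solution of $$(-1)^ru^{(2r)}+\lambda u=0\ \text{ on }(-1,1),\qquad u^{(s)}(-1)=(-1)^{k-1}\delta_{r-k-1,s},\quad u^{(s)}(1)=0,\qquad s=0,\dots,r-1 .$$ For $t\in(-1,1)$, let $u_{\lambda,t}$ be the solution, belonging to $L_2^{2r}$ on either side of $t$, of $$(-1)^ru^{(2r)}+\lambda u=0\ \text{ on }(-1,t)\cup(t,1),\qquad u^{(s)}(-1)=u^{(s)}(1)=0,\quad s=0,\dots,r-1,$$ $$u^{(s)}(t+0)-u^{(s)}(t-0)=(-1)^{k-1}\delta_{r-k-1,s},\qquad s=0,\dots,2r-1 ;$$ put $u_{\lambda,-1}=u_\lambda$ and $u_{\lambda,1}(x)=(-1)^{r-k}u_\lambda(-x)$. **Theorem.** Let either $r=1$ and $k=0$, or $r=2$ and $k\in\{0,1\}$. Then $M=M_{-1}$. 1. For $N\in(0,M)$, $E_N(D^k;W_2^r)=+\infty$. 2. Let $N\ge M$. For every $t\in\mathbb{I}$ there is a unique $\lambda_{N,t}\ge0$ with $\|u^{(r)}_{\lambda_{N,t},t}\|_2=N$;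 write $\lambda_N=\lambda_{N,-1}$. The formula $$S_Nf(t)=S_{N,t}f=\int_{-1}^1u^{(r)}_{\lambda_{N,t},t}(x)f(x)\,dx,\qquad f\in L_2,$$ defines a bounded linear operator $S_N:L_2\to L_\infty$ with $\|S_N\|\le N$, and $$E_N(D^k;W_2^r)=U(D^k;S_N;W_2^r)=\|u_{\lambda_N}\|_2=E_N(D^k_{-1};W_2^r).$$ -/

import Mathlib

open MeasureTheory Set
open scoped ENNReal NNReal

namespace Stechkin

/-- Lebesgue measure on the interval `[-1, 1]`. -/
noncomputable abbrev muI : Measure ℝ := volume.restrict (Icc (-1 : ℝ) 1)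

/-- The real Banach space `L_2` on `[-1, 1]`. -/
noncomputable abbrev L2 := Lp ℝ 2 muI

/-- The real Banach space `L_∞` on `[-1, 1]`. -/
noncomputable abbrev Linf := Lp ℝ ∞ muI

/-- `L_2^n` on `[a, b]` (for `n ≥ 1`, `a < b`): the derivative of order `n - 1` exists and is
absolutely continuous on `[a, b]`, and the (almost everywhere defined) derivative of order `n` is
square integrable. At the end points derivatives are one-sided. Only the values of `f` on `[a, b]`
matter. -/
structure InL2n (n : ℕ) (a b : ℝ) (f : ℝ → ℝ) : Prop where
  contDiffOn : ContDiffOn ℝ ((n - 1 : ℕ) : WithTop ℕ∞) f (Icc a b)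
  absCont : AbsolutelyContinuousOnInterval (iteratedDerivWithin (n - 1) f (Icc a b)) a b
  memLp : MemLp (iteratedDerivWithin n f (Icc a b)) 2 (volume.restrict (Icc a b))

/-- The derivative of order `j` of a function on `[-1, 1]` (one-sided at the end points). -/
noncomputable abbrev dI (j : ℕ) (f : ℝ → ℝ) : ℝ → ℝ := iteratedDerivWithin j f (Icc (-1 : ℝ) 1)

/-- The class `W_2^r`: functions `f` in `L_2^r` on `[-1, 1]` with `‖f^(r)‖_2 ≤ 1`. -/
structure InW (r : ℕ) (f : ℝ → ℝ) : Prop where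
  inL2n : InL2n r (-1) 1 f
  norm_le : eLpNorm (dI r f) 2 muI ≤ 1

theorem InW.memLp_two {r : ℕ} {f : ℝ → ℝ} (hf : InW r f) : MemLp f 2 muI := by
  have hc := hf.inL2n.contDiffOn.continuousOn
  obtain ⟨C, hC⟩ := isCompact_Icc.exists_bound_of_continuousOn hc
  exact MemLp.of_bound (hc.aestronglyMeasurable measurableSet_Icc) C
    (ae_restrict_of_forall_mem measurableSet_Icc hC)

/-- The element of `L_2` defined by a function of the class `W_2^r`. -/
noncomputable def InW.toL2 {r : ℕ} {f : ℝ → ℝ} (hf : InW r f) : L2 := hf.memLp_two.toLp f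

/-- `U(D^k; S; W_2^r)`: the supremum over `f` in `W_2^r` of `‖f^(k) - S f‖_∞`. -/
noncomputable def errU (r k : ℕ) (S : L2 →L[ℝ] Linf) : ℝ≥0∞ :=
  ⨆ (f : ℝ → ℝ) (hf : InW r f), eLpNorm (fun t => dI k f t - S hf.toL2 t) ∞ muI

/-- `E_N(D^k; W_2^r)`: the best approximation of `D^k : L_2 → L_∞` on `W_2^r` by linear operators
of norm at most `N`. -/
noncomputable def errE (r k : ℕ) (N : ℝ≥0) : ℝ≥0∞ :=
  ⨅ (S : L2 →L[ℝ] Linf) (_ : ‖S‖ ≤ N), errU r k S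

/-- `U(D^k_t; S; W_2^r)`: the supremum over `f` in `W_2^r` of `|f^(k)(t) - S f|`. -/
noncomputable def errUAt (r k : ℕ) (t : ℝ) (S : L2 →L[ℝ] ℝ) : ℝ≥0∞ :=
  ⨆ (f : ℝ → ℝ) (hf : InW r f), ‖dI k f t - S hf.toL2‖ₑ

/-- `E_N(D^k_t; W_2^r)`: the best approximation of the functional `f ↦ f^(k)(t)` on `W_2^r` by
linear functionals on `L_2` of norm at most `N`. -/
noncomputable def errEAt (r k : ℕ) (t : ℝ) (N : ℝ≥0) : ℝ≥0∞ :=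
  ⨅ (S : L2 →L[ℝ] ℝ) (_ : ‖S‖ ≤ N), errUAt r k t S

/-- The sharp constant `M` in `‖Q^(k)‖_∞ ≤ M ‖Q‖_2` for polynomials `Q` of degree at most
`r - 1`. -/
noncomputable def markovConst (r k : ℕ) : ℝ≥0∞ :=
  sInf {C : ℝ≥0∞ | ∀ Q ∈ Polynomial.degreeLT ℝ r,
    eLpNorm (fun x => (Polynomial.derivative^[k] Q).eval x) ∞ muI
      ≤ C * eLpNorm (fun x => Q.eval x) 2 muI}

/-- The sharp constant `M_t` in `|Q^(k)(t)| ≤ M_t ‖Q‖_2` for polynomials `Q` of degree at most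
`r - 1`. -/
noncomputable def markovConstAt (r k : ℕ) (t : ℝ) : ℝ≥0∞ :=
  sInf {C : ℝ≥0∞ | ∀ Q ∈ Polynomial.degreeLT ℝ r,
    ‖(Polynomial.derivative^[k] Q).eval t‖ₑ ≤ C * eLpNorm (fun x => Q.eval x) 2 muI}

/-- The prescribed value `(-1)^(k-1) δ_{r-k-1,s}` (the parity of `k + 1` is that of `k - 1`). -/
noncomputable def datum (r k s : ℕ) : ℝ := if s + k + 1 = r then (-1) ^ (k + 1) else 0

/-- `(-1)^r u^(2r) + l u = 0` on `(a, b)`, for a function `u` in `L_2^{2r}` on `[a, b]`. -/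
structure SolvesODE (r : ℕ) (l a b : ℝ) (u : ℝ → ℝ) : Prop where
  inL2n : InL2n (2 * r) a b u
  eqn : ∀ x ∈ Ioo a b, (-1) ^ r * iteratedDerivWithin (2 * r) u (Icc a b) x + l * u x = 0

/-- `u` is the solution `u_l` of the boundary value problem that belongs to the point `-1`. -/
structure IsLeftSol (r k : ℕ) (l : ℝ) (u : ℝ → ℝ) : Prop where
  ode : SolvesODE r l (-1) 1 u
  left : ∀ s < r, dI s u (-1) = datum r k s
  right : ∀ s < r, dI s u 1 = 0

/-- `u` is the solution `u_{l,t}` of the boundary value problem that belongs to a point `t` of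
`(-1, 1)`. The functions `v`, `w` are the extensions of `u` from `(-1, t)` to `[-1, t]` and from
`(t, 1)` to `[t, 1]`, whose derivatives at `t` are the one-sided limits of those of `u`. -/
def IsInnerSol (r k : ℕ) (l t : ℝ) (u : ℝ → ℝ) : Prop :=
  ∃ v w : ℝ → ℝ, EqOn u v (Ioo (-1) t) ∧ EqOn u w (Ioo t 1) ∧
    SolvesODE r l (-1) t v ∧ SolvesODE r l t 1 w ∧
    (∀ s < r, iteratedDerivWithin s v (Icc (-1) t) (-1) = 0) ∧
    (∀ s < r, iteratedDerivWithin s w (Icc t 1) 1 = 0) ∧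
    ∀ s < 2 * r, iteratedDerivWithin s w (Icc t 1) t - iteratedDerivWithin s v (Icc (-1) t) t
      = datum r k s

/-- `u` is the function `u_{l,t}` of the point `t` of `[-1, 1]`: `u_l` for `t = -1`, the reflected
function `(-1)^(r-k) u_l(-x)` for `t = 1`, and the solution of the problem with prescribed jumps at
`t` otherwise. -/
def IsSol (r k : ℕ) (l t : ℝ) (u : ℝ → ℝ) : Prop :=
  (t = -1 ∧ IsLeftSol r k l u) ∨
  (t = 1 ∧ ∃ v, IsLeftSol r k l v ∧ u = fun x => (-1) ^ (r - k) * v (-x)) ∨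
  (t ∈ Ioo (-1 : ℝ) 1 ∧ IsInnerSol r k l t u)

/-- `l` is a parameter `λ_{N,t}` and `u` is the corresponding function `u_{λ_{N,t},t}`:
`l ≥ 0` and `‖u^(r)‖_2 = N`. -/
structure IsOptimal (r k : ℕ) (N : ℝ≥0) (t l : ℝ) (u : ℝ → ℝ) : Prop where
  nonneg : 0 ≤ l
  sol : IsSol r k l t u
  norm_eq : eLpNorm (iteratedDeriv r u) 2 muI = N

end Stechkin

open Stechkin

namespace Stechkin

/-! An identity f^(k)(t) = ⟨g, f⟩ + ⟨w, f^(r)⟩, valid for all f, makes ⟨g, ·⟩ an approximation of f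
↦ f^(k)(t) with error at most ‖w‖ on the class. Integrating the jump problem by parts gives such an
identity with g = u^(r) and w = -(-1)^r u, where u = u_{λ,t}; the differential equation then says
g^(r) = λ w (`JumpSol.extremal`). This relation is the optimality condition for minimising the
energy ‖g‖² + λ‖w‖² over all representations of the same functional (`Extremal.le_of_represents`).
Most of the argument needs nothing else and takes place in an abstract Hilbert space.

The error is bounded below, for functionals and operators alike, by testing with normalised
multiples of u_{ν,t}^(r), ν > λ, and letting ν decrease to λ (`ofReal_norm_le`). The norm of
u_{λ,t}^(r) is continuous, strictly increasing and unbounded in λ, and at λ = 0 it is at most M,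
since u_{0,t}^(r) is a polynomial Q with Q^(k)(t) = ‖Q‖². So each N ≥ M belongs to exactly one λ
(`existsUnique_isOptimal`). Joint continuity in (λ, t) makes t ↦ u_{λ_{N,t},t}^(r) continuous into
L_2 (`continuousOn_fnMap`), so that S_N does map into L_∞.

The crux is that the error at t never exceeds that at -1 (`norm_le_norm_left`). It follows from a
comparison of minimal energies at equal λ (`energy_le`). For k = 0 the two pieces of the interval on
either side of t are stretched to the full interval. For r = 2, k = 1 the solutions are written out,
and the claim becomes a trigonometric-hyperbolic inequality (`end_point_inequality`), proved by
repeated differentiation.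

For N < M some polynomial of degree less than r violates the bound with constant N, and all its
multiples lie in the class, so the error is infinite. -/

/-! ### Primitives and chains of weak derivatives. -/

/-- `P` is a primitive of the integrable function `p` on `[a, b]`. -/
def IsPrim (a b : ℝ) (p P : ℝ → ℝ) : Prop :=
  IntervalIntegrable p volume a b ∧ ∀ x ∈ Icc a b, P x = P a + ∫ y in a..x, p y

namespace IsPrim

variable {a b : ℝ} {p P q Q : ℝ → ℝ}

theorem mono_integrable (h : IsPrim a b p P) {c d : ℝ} (hc : c ∈ Icc a b) (hd : d ∈ Icc a b) :
    IntervalIntegrable p volume c d := by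
  refine h.1.mono_set ?_
  rw [uIcc_of_le (hc.1.trans hc.2)]
  exact uIcc_subset_Icc hc hd

theorem integral_eq (h : IsPrim a b p P) {c d : ℝ} (hc : c ∈ Icc a b) (hd : d ∈ Icc a b) :
    ∫ y in c..d, p y = P d - P c := by
  have ha : a ∈ Icc a b := left_mem_Icc.2 (hc.1.trans hc.2)
  rw [h.2 c hc, h.2 d hd, ← intervalIntegral.integral_interval_sub_left
    (h.mono_integrable ha hd) (h.mono_integrable ha hc)]
  ring

theorem mono (h : IsPrim a b p P) {c d : ℝ} (hc : c ∈ Icc a b) (hd : d ∈ Icc a b) :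
    IsPrim c d p P := by
  refine ⟨h.mono_integrable hc hd, fun x hx => ?_⟩
  rw [h.integral_eq hc ⟨hc.1.trans hx.1, hx.2.trans hd.2⟩]
  ring

theorem congr (h : IsPrim a b p P) (hab : a ≤ b) (hp : p =ᵐ[volume.restrict (Icc a b)] q)
    (hP : EqOn P Q (Icc a b)) : IsPrim a b q Q := by
  have hp' : p =ᵐ[volume.restrict (uIoc a b)] q := by
    rw [uIoc_of_le hab]
    exact ae_restrict_of_ae_restrict_of_subset Ioc_subset_Icc_self hp
  refine ⟨h.1.congr_ae hp', fun x hx => ?_⟩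
  rw [← hP hx, ← hP (left_mem_Icc.2 hab), h.2 x hx]
  congr 1
  refine intervalIntegral.integral_congr_ae ?_
  rw [uIoc_of_le hx.1]
  exact (ae_restrict_iff' measurableSet_Ioc).1 (ae_restrict_of_ae_restrict_of_subset
    ((Ioc_subset_Ioc_right hx.2).trans Ioc_subset_Icc_self) hp)

theorem absolutelyContinuous_aux (h : IsPrim a b p P) :
    AbsolutelyContinuousOnInterval (fun x => P a + ∫ y in a..x, p y) a b := by
  have h1 := h.1.absolutelyContinuousOnInterval_intervalIntegral (c := a) left_mem_uIcc
  have h2 : AbsolutelyContinuousOnInterval (fun _ : ℝ => P a) a b :=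
    (LipschitzWith.const (P a)).lipschitzOnWith.absolutelyContinuousOnInterval
  exact h2.add h1

theorem absolutelyContinuous (h : IsPrim a b p P) (hab : a ≤ b) :
    AbsolutelyContinuousOnInterval P a b := by
  have h1 := h.absolutelyContinuous_aux
  rw [absolutelyContinuousOnInterval_iff] at h1 ⊢
  intro ε hε
  obtain ⟨δ, hδ, H⟩ := h1 ε hε
  refine ⟨δ, hδ, fun E hE hlt => ?_⟩
  have := H E hE hlt
  refine lt_of_eq_of_lt (Finset.sum_congr rfl fun i hi => ?_) this
  have h3 := hE.1 i hi
  rw [uIcc_of_le hab] at h3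
  rw [← h.2 _ h3.1, ← h.2 _ h3.2]

theorem continuousOn (h : IsPrim a b p P) (hab : a ≤ b) : ContinuousOn P (Icc a b) := by
  have := (h.absolutelyContinuous hab).continuousOn
  rwa [uIcc_of_le hab] at this

theorem hasDerivWithinAt (h : IsPrim a b p P) (hp : ContinuousOn p (Icc a b)) {x : ℝ}
    (hx : x ∈ Icc a b) : HasDerivWithinAt P (p x) (Icc a b) x := by
  have hab := hx.1.trans hx.2
  have : Fact (x ∈ Icc a b) := ⟨hx⟩
  have h1 : HasDerivWithinAt (fun u => ∫ y in a..u, p y) (p x) (Icc a b) x := by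
    refine intervalIntegral.integral_hasDerivWithinAt_right
      (h.mono_integrable (left_mem_Icc.2 hab) hx) ?_ (hp x hx)
    exact ⟨Icc a b, self_mem_nhdsWithin, hp.aestronglyMeasurable measurableSet_Icc⟩
  exact (h1.const_add (P a)).congr (fun y hy => h.2 y hy) (h.2 x hx)

theorem ae_hasDerivAt (h : IsPrim a b p P) :
    ∀ᵐ x ∂volume.restrict (Icc a b), HasDerivAt P (p x) x := by
  rcases le_or_gt a b with hab | hab
  · rw [← restrict_Ioo_eq_restrict_Icc, ae_restrict_iff' measurableSet_Ioo]
    filter_upwards [h.1.ae_hasDerivAt_integral] with x hx hx'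
    have h1 := (hx (by rw [uIcc_of_le hab]; exact Ioo_subset_Icc_self hx') a
      left_mem_uIcc).const_add (P a)
    refine h1.congr_of_eventuallyEq ?_
    filter_upwards [Ioo_mem_nhds hx'.1 hx'.2] with y hy
    exact h.2 y (Ioo_subset_Icc_self hy)
  · simp [Icc_eq_empty (not_le.2 hab)]

theorem integral_mul_add (hp : IsPrim a b p P) (hq : IsPrim a b q Q) (hab : a ≤ b) :
    (∫ x in a..b, p x * Q x) + ∫ x in a..b, P x * q x = P b * Q b - P a * Q a := by
  have e : uIcc a b = Icc a b := uIcc_of_le hab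
  have hP := hp.absolutelyContinuous hab
  have hQ := hq.absolutelyContinuous hab
  rw [← hP.integral_deriv_mul_eq_sub hQ, ← intervalIntegral.integral_add]
  · refine intervalIntegral.integral_congr_ae ?_
    rw [uIoc_of_le hab]
    refine (ae_restrict_iff' measurableSet_Ioc).1 (ae_restrict_of_ae_restrict_of_subset
      Ioc_subset_Icc_self ?_)
    filter_upwards [hp.ae_hasDerivAt, hq.ae_hasDerivAt] with x h1 h2
    rw [h1.deriv, h2.deriv]
  · exact hp.1.mul_continuousOn hQ.continuousOn
  · exact hq.1.continuousOn_mul hP.continuousOn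

theorem of_absolutelyContinuous (hab : a ≤ b) (h : AbsolutelyContinuousOnInterval P a b) :
    IsPrim a b (derivWithin P (Icc a b)) P := by
  have hd : IsPrim a b (deriv P) P := by
    refine ⟨h.intervalIntegrable_deriv, fun x hx => ?_⟩
    have := (h.mono (c := a) (d := x) (by
      rw [uIcc_of_le hab, uIcc_of_le hx.1]; exact Icc_subset_Icc_right hx.2)).integral_deriv_eq_sub
    rw [this]; ring
  refine hd.congr hab ?_ (fun _ _ => rfl)
  rw [← restrict_Ioo_eq_restrict_Icc]
  filter_upwards [ae_restrict_mem measurableSet_Ioo] with x hx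
  exact (derivWithin_of_mem_nhds (Icc_mem_nhds hx.1 hx.2)).symm

theorem of_hasDerivAt (hab : a ≤ b) (hP : ContinuousOn P (Icc a b))
    (hd : ∀ x ∈ Ioo a b, HasDerivAt P (p x) x) (hp : ContinuousOn p (Icc a b)) :
    IsPrim a b p P := by
  have hi : IntervalIntegrable p volume a b := by
    refine ContinuousOn.intervalIntegrable ?_
    rwa [uIcc_of_le hab]
  refine ⟨hi, fun x hx => ?_⟩
  rw [intervalIntegral.integral_eq_sub_of_hasDerivAt_of_le hx.1
    (hP.mono (Icc_subset_Icc_right hx.2)) (fun y hy => hd y ⟨hy.1, hy.2.trans_le hx.2⟩)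
    (hi.mono_set (by rw [uIcc_of_le hab, uIcc_of_le hx.1]; exact Icc_subset_Icc_right hx.2))]
  ring

theorem add (hp : IsPrim a b p P) (hq : IsPrim a b q Q) : IsPrim a b (p + q) (P + Q) := by
  refine ⟨hp.1.add hq.1, fun x hx => ?_⟩
  have ha : a ∈ Icc a b := left_mem_Icc.2 (hx.1.trans hx.2)
  simp only [Pi.add_apply]
  rw [intervalIntegral.integral_add (hp.mono_integrable ha hx) (hq.mono_integrable ha hx),
    hp.2 x hx, hq.2 x hx]
  ring

theorem const_mul (hp : IsPrim a b p P) (c : ℝ) :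
    IsPrim a b (fun x => c * p x) (fun x => c * P x) := by
  refine ⟨hp.1.const_mul c, fun x hx => ?_⟩
  simp only
  rw [intervalIntegral.integral_const_mul, hp.2 x hx]
  ring

theorem glue {t : ℝ} (ht : t ∈ Icc a b) (hp : IsPrim a t p P) (hq : IsPrim t b q Q)
    (h : P t = Q t) : IsPrim a b (fun x => if x ≤ t then p x else q x)
      (fun x => if x ≤ t then P x else Q x) := by
  have h1 : IntervalIntegrable (fun x => if x ≤ t then p x else q x) volume a t := by
    refine hp.1.congr fun x hx => ?_
    rw [uIoc_of_le ht.1] at hx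
    simp [hx.2]
  have h2 : ∀ x ∈ Icc t b, IntervalIntegrable (fun x => if x ≤ t then p x else q x) volume t x := by
    intro x hx
    refine (hq.mono_integrable (left_mem_Icc.2 ht.2) hx).congr fun y hy => ?_
    rw [uIoc_of_le hx.1] at hy
    simp [hy.1]
  refine ⟨h1.trans (h2 b (right_mem_Icc.2 ht.2)), fun x hx => ?_⟩
  have e1 : ∀ x ∈ Icc a t, ∫ y in a..x, (if y ≤ t then p y else q y) = ∫ y in a..x, p y := by
    intro x hx
    refine intervalIntegral.integral_congr fun y hy => ?_
    rw [uIcc_of_le hx.1] at hy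
    simp [hy.2.trans hx.2]
  simp only [ht.1, if_true]
  split_ifs with hxt
  · rw [e1 x ⟨hx.1, hxt⟩, hp.2 x ⟨hx.1, hxt⟩]
  · have hx' : x ∈ Icc t b := ⟨(not_le.1 hxt).le, hx.2⟩
    rw [← intervalIntegral.integral_add_adjacent_intervals h1 (h2 x hx'),
      e1 t (right_mem_Icc.2 ht.1), ← add_assoc, ← hp.2 t (right_mem_Icc.2 ht.1), hq.2 x hx', h]
    congr 1
    refine intervalIntegral.integral_congr_ae (Filter.Eventually.of_forall fun y hy => ?_)
    rw [uIoc_of_le hx'.1] at hy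
    simp [hy.1]

/-- An affine change of variables. -/
theorem comp_affine (hp : IsPrim a b p P) {c d α β : ℝ} (hc : c ≠ 0)
    (hα : c * α + d ∈ Icc a b) (hβ : c * β + d ∈ Icc a b) :
    IsPrim α β (fun x => c * p (c * x + d)) (fun x => P (c * x + d)) := by
  refine ⟨?_, fun x hx => ?_⟩
  · have h1 := hp.mono_integrable hα hβ
    have h2 := (h1.comp_add_right d).comp_mul_left (c := c)
    simp only [add_sub_cancel_right, mul_div_cancel_left₀ _ hc] at h2
    exact h2.const_mul c
  · have hx' : c * x + d ∈ Icc a b := by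
      have : (Icc a b).OrdConnected := ordConnected_Icc
      rcases le_total 0 c with h | h
      · exact this.out hα hβ ⟨by nlinarith [hx.1], by nlinarith [hx.2]⟩
      · exact this.out hβ hα ⟨by nlinarith [hx.2], by nlinarith [hx.1]⟩
    rw [intervalIntegral.integral_const_mul, intervalIntegral.mul_integral_comp_mul_add,
      hp.integral_eq hα hx']
    ring

end IsPrim

/-- `F 0, F 1, …, F n` are consecutive (weak) derivatives on `[a, b]`. -/
def IsChain (n : ℕ) (a b : ℝ) (F : ℕ → ℝ → ℝ) : Prop :=
  ∀ j < n, IsPrim a b (F (j + 1)) (F j)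

variable {n : ℕ} {a b : ℝ} {f : ℝ → ℝ} {F : ℕ → ℝ → ℝ}

theorem InL2n.isChain (hab : a < b) (hn : 1 ≤ n) (hf : InL2n n a b f) :
    IsChain n a b (fun j => iteratedDerivWithin j f (Icc a b)) := by
  have hu := uniqueDiffOn_Icc hab
  intro j hj
  have e : iteratedDerivWithin (j + 1) f (Icc a b)
      = derivWithin (iteratedDerivWithin j f (Icc a b)) (Icc a b) := by
    ext x; rw [iteratedDerivWithin_succ]
  rcases Nat.lt_or_ge (j + 1) n with h | h
  · have hd : DifferentiableOn ℝ (iteratedDerivWithin j f (Icc a b)) (Icc a b) :=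
      hf.contDiffOn.differentiableOn_iteratedDerivWithin (by exact_mod_cast (by omega : j < n - 1)) hu
    refine IsPrim.of_hasDerivAt hab.le hd.continuousOn (fun x hx => ?_)
      (hf.contDiffOn.continuousOn_iteratedDerivWithin
        (by exact_mod_cast (by omega : j + 1 ≤ n - 1)) hu)
    simp only [e]
    exact ((hd x (Ioo_subset_Icc_self hx)).hasDerivWithinAt).hasDerivAt (Icc_mem_nhds hx.1 hx.2)
  · obtain rfl : n = j + 1 := by omega
    simp only [e]
    exact IsPrim.of_absolutelyContinuous hab.le hf.absCont

namespace IsChain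

theorem continuousOn (h : IsChain n a b F) (hab : a ≤ b) {j : ℕ} (hj : j < n) :
    ContinuousOn (F j) (Icc a b) :=
  (h j hj).continuousOn hab

theorem iteratedDerivWithin_eqOn (h : IsChain n a b F) (hab : a < b) :
    ∀ j < n, EqOn (iteratedDerivWithin j (F 0) (Icc a b)) (F j) (Icc a b) := by
  intro j
  induction j with
  | zero => intro _ x _; simp
  | succ j ih =>
    intro hj x hx
    rw [iteratedDerivWithin_succ, derivWithin_congr (ih (by omega)) (ih (by omega) hx)]
    exact ((h j (by omega)).hasDerivWithinAt (h.continuousOn hab.le hj) hx).derivWithin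
      (uniqueDiffOn_Icc hab x hx)

theorem iteratedDerivWithin_ae_eq (h : IsChain n a b F) (hab : a < b) (hn : 1 ≤ n) :
    iteratedDerivWithin n (F 0) (Icc a b) =ᵐ[volume.restrict (Icc a b)] F n := by
  obtain ⟨m, rfl⟩ : ∃ m, n = m + 1 := ⟨n - 1, by omega⟩
  have h2 := (h m (by omega)).ae_hasDerivAt
  rw [← restrict_Ioo_eq_restrict_Icc] at h2 ⊢
  filter_upwards [ae_restrict_mem measurableSet_Ioo, h2] with x hx hx2
  have h1 := h.iteratedDerivWithin_eqOn hab m (by omega)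
  rw [iteratedDerivWithin_succ, derivWithin_congr h1 (h1 (Ioo_subset_Icc_self hx)),
    derivWithin_of_mem_nhds (Icc_mem_nhds hx.1 hx.2), hx2.deriv]

theorem inL2n (h : IsChain n a b F) (hab : a < b) (hn : 1 ≤ n)
    (hF : MemLp (F n) 2 (volume.restrict (Icc a b))) : InL2n n a b (F 0) := by
  have h1 := h.iteratedDerivWithin_eqOn hab
  refine ⟨?_, ?_, hF.ae_eq (h.iteratedDerivWithin_ae_eq hab hn).symm⟩
  · have := (contDiffOn_iff_continuousOn_differentiableOn_deriv (𝕜 := ℝ) (n := ((n - 1 : ℕ) : ℕ∞))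
      (f := F 0) (uniqueDiffOn_Icc hab)).2 ⟨fun m hm => ?_, fun m hm => ?_⟩
    · exact_mod_cast this
    · have hm : m < n := by have : m ≤ n - 1 := by exact_mod_cast hm
                            omega
      exact (h.continuousOn hab.le hm).congr (h1 m hm)
    · have hm : m + 1 < n := by have : m < n - 1 := by exact_mod_cast hm
                                omega
      refine DifferentiableOn.congr (fun x hx => ?_) (h1 m (by omega))
      exact ((h m (by omega)).hasDerivWithinAt (h.continuousOn hab.le hm) hx).differentiableWithinAt
  · have h2 : IsPrim a b (F n) (F (n - 1)) := by
      have := h (n - 1) (by omega)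
      rwa [Nat.sub_add_cancel hn] at this
    refine (h2.congr hab.le Filter.EventuallyEq.rfl (h1 (n - 1) (by omega)).symm).absolutelyContinuous hab.le

theorem mono (h : IsChain n a b F) {c d : ℝ} (hc : c ∈ Icc a b) (hd : d ∈ Icc a b) :
    IsChain n c d F :=
  fun j hj => (h j hj).mono hc hd

theorem of_le (h : IsChain n a b F) {m : ℕ} (hm : m ≤ n) : IsChain m a b F :=
  fun j hj => h j (hj.trans_le hm)

theorem shift {m : ℕ} (h : IsChain (m + n) a b F) : IsChain n a b (fun j => F (m + j)) :=
  fun j hj => h (m + j) (by omega)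

theorem glue {t : ℝ} {G : ℕ → ℝ → ℝ} (ht : t ∈ Icc a b) (hF : IsChain n a t F)
    (hG : IsChain n t b G) (h : ∀ j < n, F j t = G j t) :
    IsChain n a b (fun j x => if x ≤ t then F j x else G j x) :=
  fun j hj => (hF j hj).glue ht (hG j hj) (h j hj)

theorem comp_affine (h : IsChain n a b F) {c d α β : ℝ} (hc : c ≠ 0)
    (hα : c * α + d ∈ Icc a b) (hβ : c * β + d ∈ Icc a b) :
    IsChain n α β (fun j x => c ^ j * F j (c * x + d)) := by
  intro j hj
  have := ((h j hj).comp_affine hc hα hβ).const_mul (c ^ j)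
  convert this using 2
  ring

/-- A sequence of global derivatives is a chain. -/
theorem of_hasDerivAt (hab : a ≤ b) (h : ∀ j < n, ∀ x, HasDerivAt (F j) (F (j + 1) x) x)
    (hc : Continuous (F n)) : IsChain n a b F := by
  have hc' : ∀ j ≤ n, Continuous (F j) := fun j hj => by
    rcases hj.lt_or_eq with hj | rfl
    · exact continuous_iff_continuousAt.2 fun x => (h j hj x).continuousAt
    · exact hc
  exact fun j hj => IsPrim.of_hasDerivAt hab (hc' j hj.le).continuousOn (fun x _ => h j hj x)
    (hc' (j + 1) hj).continuousOn

/-- Integration by parts, m times: the order on `U` goes down from n while that on `F` goes up from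
0. With m = n = r this is the Green formula behind both the representation and the uniqueness of
solutions. -/
theorem integral_mul_eq {m : ℕ} {U : ℕ → ℝ → ℝ} (hab : a ≤ b) (hU : IsChain n a b U)
    (hF : IsChain m a b F) (hmn : m ≤ n) :
    ∫ x in a..b, U n x * F 0 x =
      (∑ j ∈ Finset.range m, (-1) ^ j * (U (n - 1 - j) b * F j b - U (n - 1 - j) a * F j a))
        + (-1) ^ m * ∫ x in a..b, U (n - m) x * F m x := by
  induction m with
  | zero => simp
  | succ m ih =>
    rw [ih (hF.of_le (by omega)) (by omega), Finset.sum_range_succ]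
    have h1 := hU (n - 1 - m) (by omega)
    have e : n - 1 - m + 1 = n - m := by omega
    rw [e] at h1
    have := h1.integral_mul_add (hF m (by omega)) hab
    rw [show n - (m + 1) = n - 1 - m by omega, eq_sub_of_add_eq this]
    ring

end IsChain

open scoped RealInnerProductSpace Topology
open Filter

/-! ### Extremal representations of a functional in a Hilbert space. -/

section Abstract

variable {H X : Type*} [NormedAddCommGroup H] [InnerProductSpace ℝ H] [AddCommGroup X] [Module ℝ X]

/-- The functional `ℓ` is represented by the pair `(g, w)`. -/
def Represents (a b : X →ₗ[ℝ] H) (ℓ : X →ₗ[ℝ] ℝ) (g w : H) : Prop :=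
  ∀ x, ℓ x = ⟪g, a x⟫ + ⟪w, b x⟫

/-- The functional `ℓ` is represented by `(a x, w)`, and this pair belongs to the parameter `l`. -/
structure Extremal (a b : X →ₗ[ℝ] H) (ℓ : X →ₗ[ℝ] ℝ) (l : ℝ) (x : X) (w : H) : Prop where
  rep : Represents a b ℓ (a x) w
  eqn : b x = l • w

/-- Two functionals are close with respect to the graph norm. -/
def CloseBy (a b : X →ₗ[ℝ] H) (ℓ ℓ' : X →ₗ[ℝ] ℝ) (η : ℝ) : Prop :=
  ∀ y, |ℓ y - ℓ' y| ≤ η * (‖a y‖ + ‖b y‖)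

variable {a b : X →ₗ[ℝ] H} {ℓ ℓ' : X →ₗ[ℝ] ℝ} {l l' C η : ℝ} {x x' : X} {w w' g g' : H}

theorem CloseBy.refl (a b : X →ₗ[ℝ] H) (ℓ : X →ₗ[ℝ] ℝ) : CloseBy a b ℓ ℓ 0 := by
  intro y; simp

theorem Represents.abs_le (h : Represents a b ℓ g w) (y : X) :
    |ℓ y| ≤ ‖g‖ * ‖a y‖ + ‖w‖ * ‖b y‖ := by
  rw [h y]
  exact (abs_add_le _ _).trans (add_le_add (abs_real_inner_le_norm _ _)
    (abs_real_inner_le_norm _ _))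

/-- Cauchy–Schwarz in the weighted product norm: the energy of any representation bounds the square
of the functional. `Extremal.le_of_sq_le` is the converse, so the energy of the extremal pair is the
best constant. -/
theorem Represents.sq_le (h : Represents a b ℓ g w) (hl : 0 < l) (y : X) :
    l * ℓ y ^ 2 ≤ (‖g‖ ^ 2 + l * ‖w‖ ^ 2) * (‖b y‖ ^ 2 + l * ‖a y‖ ^ 2) := by
  have h1 := pow_le_pow_left₀ (abs_nonneg _) (h.abs_le y) 2
  rw [sq_abs] at h1
  have h2 := mul_le_mul_of_nonneg_left h1 hl.le
  nlinarith [sq_nonneg (‖g‖ * ‖b y‖ - l * (‖w‖ * ‖a y‖))]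

namespace Extremal

/-- The energy is a value of the functional. For the jump problem this makes it a single derivative
of the solution at t. -/
theorem apply_self (h : Extremal a b ℓ l x w) : ℓ x = ‖a x‖ ^ 2 + l * ‖w‖ ^ 2 := by
  rw [h.rep x, h.eqn, inner_smul_right, real_inner_self_eq_norm_sq, real_inner_self_eq_norm_sq]

/-- Evaluating `ℓ x` through both representations gives the energy as an inner product of the two
pairs; Cauchy–Schwarz finishes. -/
theorem le_of_represents (h : Extremal a b ℓ l x w) (hl : 0 ≤ l)
    (h' : Represents a b ℓ g w') :
    ‖a x‖ ^ 2 + l * ‖w‖ ^ 2 ≤ ‖g‖ ^ 2 + l * ‖w'‖ ^ 2 := by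
  have h1 := h.apply_self
  rw [h' x, h.eqn, inner_smul_right] at h1
  have h2 := real_inner_le_norm g (a x)
  have h3 := mul_le_mul_of_nonneg_left (real_inner_le_norm w' w) hl
  nlinarith [sq_nonneg (‖g‖ - ‖a x‖), mul_nonneg hl (sq_nonneg (‖w'‖ - ‖w‖))]

/-- With m the energy, `ℓ x = m` and `‖b x‖² + l‖a x‖² = l m`, so the hypothesis at x reads l m² ≤ K
l m. -/
theorem le_of_sq_le (h : Extremal a b ℓ l x w) (hl : 0 < l) {K : ℝ}
    (hK0 : 0 ≤ K) (hK : l * ℓ x ^ 2 ≤ K * (‖b x‖ ^ 2 + l * ‖a x‖ ^ 2)) :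
    ‖a x‖ ^ 2 + l * ‖w‖ ^ 2 ≤ K := by
  rw [h.apply_self, h.eqn, norm_smul, Real.norm_of_nonneg hl.le] at hK
  set m := ‖a x‖ ^ 2 + l * ‖w‖ ^ 2 with hm
  have e : (l * ‖w‖) ^ 2 + l * ‖a x‖ ^ 2 = l * m := by rw [hm]; ring
  rw [e] at hK
  have hm0 : 0 ≤ m := by positivity
  rcases hm0.eq_or_lt with h0 | h0
  · rwa [← h0]
  · have : l * m * m ≤ l * m * K := by nlinarith
    exact le_of_mul_le_mul_left this (by positivity)

/-- Both representations are tested on a y with `b y = w - w'`, which isolates `‖w - w'‖²`. Thus the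
second component is controlled by the first and by the distance of the functionals. -/
theorem norm_sub_le (hC0 : 0 ≤ C) (hC : ∀ v : H, ∃ y, b y = v ∧ ‖a y‖ ≤ C * ‖v‖)
    (h : Represents a b ℓ g w) (h' : Represents a b ℓ' g' w') (hc : CloseBy a b ℓ ℓ' η)
    (hη : 0 ≤ η) : ‖w - w'‖ ≤ C * (‖g - g'‖ + η) + η := by
  obtain ⟨y, hy, hy'⟩ := hC (w - w')
  have h1 := hc y
  rw [h y, h' y, hy] at h1
  have h2 : ⟪g, a y⟫ + ⟪w, w - w'⟫ - (⟪g', a y⟫ + ⟪w', w - w'⟫)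
      = ⟪g - g', a y⟫ + ‖w - w'‖ ^ 2 := by
    rw [← real_inner_self_eq_norm_sq (w - w'), inner_sub_left w w' (w - w'), inner_sub_left g g']
    ring
  rw [h2] at h1
  have h3 := (abs_le.1 h1).2
  have h4 := (abs_le.1 (abs_real_inner_le_norm (g - g') (a y))).1
  have h5 : ‖g - g'‖ * ‖a y‖ ≤ ‖g - g'‖ * (C * ‖w - w'‖) := by gcongr
  have h6 : η * (‖a y‖ + ‖w - w'‖) ≤ η * (C * ‖w - w'‖ + ‖w - w'‖) := by gcongr
  rcases (norm_nonneg (w - w')).eq_or_lt with h0 | h0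
  · rw [← h0]; positivity
  · nlinarith

/-- Both representations are tested on x - x'. Monotonicity, uniqueness and continuity of the
extremal pairs all come from this identity. -/
theorem inner_identity (h : Extremal a b ℓ l x w) (h' : Extremal a b ℓ' l' x' w') :
    ‖a x - a x'‖ ^ 2 + l * ‖w - w'‖ ^ 2
      = ℓ (x - x') - ℓ' (x - x') + (l' - l) * ⟪w - w', w'⟫ := by
  have e : b (x - x') = l • (w - w') + (l - l') • w' := by
    rw [map_sub, h.eqn, h'.eqn]; module
  rw [h.rep, h'.rep, e, map_sub]
  simp only [inner_add_right, inner_smul_right, inner_sub_left, inner_sub_right,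
    ← real_inner_self_eq_norm_sq]
  ring

theorem inner_nonneg (h : Extremal a b ℓ l x w) (h' : Extremal a b ℓ l' x' w') (hl : 0 ≤ l)
    (hll : l < l') : 0 ≤ ⟪w - w', w'⟫ := by
  have h1 := h.inner_identity h'
  rw [sub_self, zero_add] at h1
  have : 0 ≤ (l' - l) * ⟪w - w', w'⟫ := by rw [← h1]; positivity
  exact nonneg_of_mul_nonneg_right this (sub_pos.2 hll)

theorem inner_nonneg' (h : Extremal a b ℓ l x w) (h' : Extremal a b ℓ l' x' w') (hl : 0 ≤ l)
    (hll : l < l') : 0 ≤ ⟪w - w', w⟫ := by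
  have h1 := h'.inner_identity h
  rw [sub_self, zero_add, ← neg_sub l' l, ← neg_sub w w', inner_neg_left, neg_mul_neg] at h1
  have : 0 ≤ (l' - l) * ⟪w - w', w⟫ := by
    rw [← h1]; have := hl.trans hll.le; positivity
  exact nonneg_of_mul_nonneg_right this (sub_pos.2 hll)

/-- Each of `ℓ x` and `ℓ x'` is computed through both representations; the mixed term `⟪a x, a x'⟫`
cancels. By `inner_nonneg` and `inner_nonneg'` the right-hand side is nonnegative when l < l'. -/
theorem sq_norm_sub_sq_norm (h : Extremal a b ℓ l x w) (h' : Extremal a b ℓ l' x' w') :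
    ‖a x'‖ ^ 2 - ‖a x‖ ^ 2 = l' * ⟪w - w', w'⟫ + l * ⟪w - w', w⟫ := by
  have h1 := h.apply_self
  have h2 := h'.apply_self
  rw [h'.rep, h.eqn, inner_smul_right] at h1
  rw [h.rep, h'.eqn, inner_smul_right, real_inner_comm] at h2
  rw [inner_sub_left, inner_sub_left, real_inner_self_eq_norm_sq, real_inner_self_eq_norm_sq]
  linear_combination h1 - h2

theorem norm_le_norm (h : Extremal a b ℓ l x w) (h' : Extremal a b ℓ l' x' w') (hl : 0 ≤ l)
    (hll : l < l') : ‖a x‖ ≤ ‖a x'‖ := by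
  have h1 := h.sq_norm_sub_sq_norm h'
  have h2 := mul_nonneg (hl.trans hll.le) (h.inner_nonneg h' hl hll)
  have h3 := mul_nonneg hl (h.inner_nonneg' h' hl hll)
  exact le_of_sq_le_sq (by linarith) (norm_nonneg _)

theorem right_unique (hC0 : 0 ≤ C) (hC : ∀ v : H, ∃ y, b y = v ∧ ‖a y‖ ≤ C * ‖v‖)
    (h : Represents a b ℓ g w) (h' : Represents a b ℓ g w') : w = w' := by
  have := norm_sub_le hC0 hC h h' (CloseBy.refl a b ℓ) le_rfl
  rw [sub_self, norm_zero] at this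
  exact sub_eq_zero.1 (norm_le_zero_iff.1 (this.trans (by simp)))

theorem unique (hC0 : 0 ≤ C) (hC : ∀ v : H, ∃ y, b y = v ∧ ‖a y‖ ≤ C * ‖v‖)
    (h : Extremal a b ℓ l x w) (h' : Extremal a b ℓ l x' w') (hl : 0 ≤ l) :
    a x = a x' ∧ w = w' := by
  have h1 := h.inner_identity h'
  rw [sub_self, sub_self, zero_mul, zero_add] at h1
  have e : a x = a x' := by
    have h2 : ‖a x - a x'‖ ^ 2 ≤ 0 := by
      have : 0 ≤ l * ‖w - w'‖ ^ 2 := by positivity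
      linarith
    have h3 : ‖a x - a x'‖ = 0 := by
      have := norm_nonneg (a x - a x')
      nlinarith
    exact sub_eq_zero.1 (norm_eq_zero.1 h3)
  refine ⟨e, ?_⟩
  have h' := h'.rep
  rw [← e] at h'
  exact right_unique hC0 hC h.rep h'

/-- Equality would force a x = a x', then w = w', then b x = b x', that is l w = l' w and w = 0. The
functional would then be bounded by `‖a ·‖` alone, which `hunb` excludes. -/
theorem norm_lt_norm (hC0 : 0 ≤ C) (hC : ∀ v : H, ∃ y, b y = v ∧ ‖a y‖ ≤ C * ‖v‖)
    (hab : ∀ y, a y = 0 → b y = 0) (hunb : ∀ B : ℝ, ∃ y, ℓ y = 1 ∧ B * ‖a y‖ ≤ 1 / 2)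
    (h : Extremal a b ℓ l x w) (h' : Extremal a b ℓ l' x' w') (hl : 0 ≤ l)
    (hll : l < l') : ‖a x‖ < ‖a x'‖ := by
  refine lt_of_le_of_ne (h.norm_le_norm h' hl hll) fun heq => ?_
  have h1 := h.sq_norm_sub_sq_norm h'
  rw [heq, sub_self] at h1
  have h2 := h.inner_nonneg h' hl hll
  have h3 := mul_nonneg hl (h.inner_nonneg' h' hl hll)
  have h4 : ⟪w - w', w'⟫ = 0 := by
    have : 0 ≤ l' * ⟪w - w', w'⟫ := mul_nonneg (hl.trans hll.le) h2
    have : l' * ⟪w - w', w'⟫ = 0 := by linarith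
    exact (mul_eq_zero.1 this).resolve_left (by linarith)
  have h5 := h.inner_identity h'
  rw [h4, sub_self, mul_zero, add_zero] at h5
  have e : a x = a x' := by
    have h2 : ‖a x - a x'‖ ^ 2 ≤ 0 := by
      have : 0 ≤ l * ‖w - w'‖ ^ 2 := by positivity
      linarith
    have h3 : ‖a x - a x'‖ = 0 := by
      have := norm_nonneg (a x - a x')
      nlinarith
    exact sub_eq_zero.1 (norm_eq_zero.1 h3)
  have h6 := h'.rep
  rw [← e] at h6
  have e2 := right_unique hC0 hC h.rep h6
  have h7 := hab (x - x') (by rw [map_sub, e, sub_self])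
  rw [map_sub, h.eqn, h'.eqn, ← e2, ← sub_smul, smul_eq_zero] at h7
  have hw : w = 0 := h7.resolve_left (by linarith)
  obtain ⟨y, hy, hy'⟩ := hunb ‖a x‖
  have h8 := h.rep.abs_le y
  rw [hw, hy] at h8
  simp at h8
  linarith

/-- If `‖a x‖ ≤ B` for arbitrarily large l, then `hunb` keeps `‖w‖` above a fixed c > 0. The energy,
which is at least l‖w‖², then outgrows the bound (c / 2) l‖w‖ + K‖a x‖ supplied by `hint`. -/
theorem exists_lt_norm (hunb : ∀ B : ℝ, ∃ y, ℓ y = 1 ∧ B * ‖a y‖ ≤ 1 / 2)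
    (hint : ∀ η > 0, ∃ K, ∀ y, |ℓ y| ≤ η * ‖b y‖ + K * ‖a y‖)
    (B : ℝ) :
    ∃ l ≥ 0, ∀ x w, Extremal a b ℓ l x w → B < ‖a x‖ := by
  by_contra! hcon
  have hB : 0 ≤ B := by
    obtain ⟨x, w, -, h⟩ := hcon 0 le_rfl
    exact (norm_nonneg _).trans h
  obtain ⟨y, hy, hy'⟩ := hunb B
  set c := 1 / (2 * (‖b y‖ + 1)) with hc
  have hc0 : 0 < c := by positivity
  obtain ⟨K, hK⟩ := hint (c / 2) (by positivity)
  obtain ⟨l, hl, hlK⟩ : ∃ l : ℝ, 0 ≤ l ∧ |K| * B < l * c ^ 2 / 2 := by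
    refine ⟨(|K| * B + 1) * 2 / c ^ 2, by positivity, ?_⟩
    field_simp
    linarith
  obtain ⟨x, w, h, hx⟩ := hcon l hl
  have h1 := h.rep.abs_le y
  rw [hy, abs_one] at h1
  have hw : c ≤ ‖w‖ := by
    have h2 : ‖a x‖ * ‖a y‖ ≤ B * ‖a y‖ := by gcongr
    have h3 : 1 / 2 ≤ ‖w‖ * (‖b y‖ + 1) := by
      have := norm_nonneg w
      nlinarith
    rw [hc, div_le_iff₀ (by positivity)]
    linarith
  have h2 := (le_abs_self _).trans (hK x)
  rw [h.apply_self, h.eqn, norm_smul, Real.norm_of_nonneg hl] at h2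
  have h3 : K * ‖a x‖ ≤ |K| * B := by
    have := le_abs_self K
    have := abs_nonneg K
    have := norm_nonneg (a x)
    nlinarith
  have h4 : l * c ^ 2 / 2 ≤ l * ‖w‖ ^ 2 - c / 2 * (l * ‖w‖) := by
    have : 0 ≤ l * ((‖w‖ - c) * (‖w‖ + c / 2)) :=
      mul_nonneg hl (mul_nonneg (by linarith) (by positivity))
    nlinarith
  nlinarith [sq_nonneg ‖a x‖]

theorem tendsto {ι : Type*} {𝓕 : Filter ι} {L : ι → X →ₗ[ℝ] ℝ} {ls ηs : ι → ℝ} {xs : ι → X}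
    {ws : ι → H} (hC0 : 0 ≤ C) (hC : ∀ v : H, ∃ y, b y = v ∧ ‖a y‖ ≤ C * ‖v‖)
    (h : ∀ᶠ i in 𝓕, Extremal a b (L i) (ls i) (xs i) (ws i)) (h0 : ∀ᶠ i in 𝓕, 0 ≤ ls i)
    (h' : Extremal a b ℓ l x w) (hls : Tendsto ls 𝓕 (𝓝 l)) (hηs : Tendsto ηs 𝓕 (𝓝 0))
    (hc : ∀ᶠ i in 𝓕, 0 ≤ ηs i ∧ CloseBy a b (L i) ℓ (ηs i)) :
    Tendsto (fun i => a (xs i)) 𝓕 (𝓝 (a x)) ∧ Tendsto ws 𝓕 (𝓝 w) := by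
  set δ : ι → ℝ := fun i => |ls i - l| with hδ
  have hδ0 : Tendsto δ 𝓕 (𝓝 0) := by
    have := (hls.sub_const l).abs
    simpa using this
  set p : ι → ℝ := fun i => ηs i + (ηs i * ls i + δ i * ‖w‖) * C with hp
  set q : ι → ℝ := fun i => ηs i * (δ i * ‖w‖) + (ηs i * ls i + δ i * ‖w‖) * ((C + 1) * ηs i)
    with hq
  have hr : Tendsto (fun i => ηs i * ls i + δ i * ‖w‖) 𝓕 (𝓝 0) := by
    simpa using (hηs.mul hls).add (hδ0.mul_const ‖w‖)
  have hp0 : Tendsto p 𝓕 (𝓝 0) := by simpa using hηs.add (hr.mul_const C)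
  have hq0 : Tendsto q 𝓕 (𝓝 0) := by
    simpa using (hηs.mul (hδ0.mul_const ‖w‖)).add (hr.mul (hηs.const_mul (C + 1)))
  have key : ∀ᶠ i in 𝓕, ‖a (xs i) - a x‖ ^ 2 ≤ p i ^ 2 + 2 * q i ∧
      ‖ws i - w‖ ≤ C * (‖a (xs i) - a x‖ + ηs i) + ηs i := by
    filter_upwards [h, h0, hc] with i hi hi0 ⟨hη, hci⟩
    have h1 := norm_sub_le hC0 hC hi.rep h'.rep hci hη
    refine ⟨?_, h1⟩
    have h2 := hi.inner_identity h'
    have h3 := (abs_le.1 (hci (xs i - x))).2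
    have e : b (xs i - x) = ls i • (ws i - w) + (ls i - l) • w := by
      rw [map_sub, hi.eqn, h'.eqn]; module
    have h4 : ‖b (xs i - x)‖ ≤ ls i * ‖ws i - w‖ + δ i * ‖w‖ := by
      rw [e]
      refine (norm_add_le _ _).trans ?_
      rw [norm_smul, norm_smul, Real.norm_of_nonneg hi0, Real.norm_eq_abs]
    have h5 : (l - ls i) * ⟪ws i - w, w⟫ ≤ δ i * (‖ws i - w‖ * ‖w‖) := by
      refine (le_abs_self _).trans ?_
      rw [abs_mul, abs_sub_comm]
      exact mul_le_mul_of_nonneg_left (abs_real_inner_le_norm _ _) (abs_nonneg _)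
    rw [map_sub a] at h3
    set d := ‖a (xs i) - a x‖
    set e := ‖ws i - w‖
    have hd : 0 ≤ d := norm_nonneg _
    have he : 0 ≤ e := norm_nonneg _
    have hδi : 0 ≤ δ i := abs_nonneg _
    have h6 : d ^ 2 ≤ ηs i * (d + (ls i * e + δ i * ‖w‖)) + δ i * (e * ‖w‖) := by
      have : 0 ≤ ls i * e ^ 2 := by positivity
      have : ηs i * (d + ‖b (xs i - x)‖) ≤ ηs i * (d + (ls i * e + δ i * ‖w‖)) := by gcongr
      linarith
    have h7 : (ηs i * ls i + δ i * ‖w‖) * e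
        ≤ (ηs i * ls i + δ i * ‖w‖) * (C * (d + ηs i) + ηs i) := by
      gcongr
    have h8 : d ^ 2 ≤ p i * d + q i := by
      simp only [hp, hq]
      linarith
    -- From d² ≤ p d + q and 2 p d ≤ p² + d² one gets d² ≤ p² + 2 q, a bound tending to zero.
    nlinarith [sq_nonneg (p i - d)]
  have ht1 : Tendsto (fun i => ‖a (xs i) - a x‖) 𝓕 (𝓝 0) := by
    have hs : Tendsto (fun i => √(p i ^ 2 + 2 * q i)) 𝓕 (𝓝 0) := by
      have := ((hp0.pow 2).add (hq0.const_mul 2)).sqrt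
      simpa using this
    refine squeeze_zero' (Eventually.of_forall fun i => norm_nonneg _) ?_ hs
    filter_upwards [key] with i hi
    exact Real.le_sqrt_of_sq_le hi.1
  have ht2 : Tendsto (fun i => ‖ws i - w‖) 𝓕 (𝓝 0) := by
    have hs : Tendsto (fun i => C * (‖a (xs i) - a x‖ + ηs i) + ηs i) 𝓕 (𝓝 0) := by
      simpa using ((ht1.add hηs).const_mul C).add hηs
    refine squeeze_zero' (Eventually.of_forall fun i => norm_nonneg _) ?_ hs
    filter_upwards [key] with i hi
    exact hi.2
  exact ⟨tendsto_iff_norm_sub_tendsto_zero.2 ht1, tendsto_iff_norm_sub_tendsto_zero.2 ht2⟩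

end Extremal

end Abstract

/-! ### Integral estimates on the interval. -/

theorem integral_muI (f : ℝ → ℝ) : ∫ x, f x ∂muI = ∫ x in (-1)..1, f x := by
  rw [intervalIntegral.integral_of_le (by norm_num), integral_Icc_eq_integral_Ioc]

theorem inner_toLp {f g : ℝ → ℝ} (hf : MemLp f 2 muI) (hg : MemLp g 2 muI) :
    ⟪hf.toLp f, hg.toLp g⟫ = ∫ x in (-1)..1, f x * g x := by
  rw [L2.inner_def, ← integral_muI]
  refine integral_congr_ae ?_
  filter_upwards [hf.coeFn_toLp, hg.coeFn_toLp] with x h1 h2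
  rw [h1, h2]
  simp [mul_comm]

theorem sq_norm_toLp {f : ℝ → ℝ} (hf : MemLp f 2 muI) :
    ‖hf.toLp f‖ ^ 2 = ∫ x in (-1)..1, f x ^ 2 := by
  rw [← real_inner_self_eq_norm_sq, inner_toLp]
  simp only [sq]

theorem memLp_of_continuousOn {f : ℝ → ℝ} (hf : ContinuousOn f (Icc (-1) 1)) {p : ℝ≥0∞} :
    MemLp f p muI := by
  obtain ⟨C, hC⟩ := isCompact_Icc.exists_bound_of_continuousOn hf
  exact MemLp.of_bound (hf.aestronglyMeasurable measurableSet_Icc) C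
    (ae_restrict_of_forall_mem measurableSet_Icc hC)

theorem intervalIntegrable_of_memLp {f : ℝ → ℝ} (hf : MemLp f 2 muI) :
    IntervalIntegrable f volume (-1) 1 := by
  rw [intervalIntegrable_iff_integrableOn_Icc_of_le (by norm_num)]
  exact hf.integrable (by norm_num)

theorem intervalIntegrable_sq_of_memLp {f : ℝ → ℝ} (hf : MemLp f 2 muI) :
    IntervalIntegrable (fun x => f x ^ 2) volume (-1) 1 := by
  rw [intervalIntegrable_iff_integrableOn_Icc_of_le (by norm_num)]
  exact hf.integrable_sq

theorem norm_toLp_le {f : ℝ → ℝ} (hf : MemLp f 2 muI) {K : ℝ} (hK : 0 ≤ K)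
    (h : ∀ x ∈ Icc (-1 : ℝ) 1, |f x| ≤ K) : ‖hf.toLp f‖ ≤ √2 * K := by
  refine le_of_sq_le_sq ?_ (by positivity)
  rw [sq_norm_toLp, mul_pow, Real.sq_sqrt (by norm_num)]
  have h1 : ∫ x in (-1 : ℝ)..1, f x ^ 2 ≤ ∫ x in (-1 : ℝ)..1, K ^ 2 := by
    refine intervalIntegral.integral_mono_on (by norm_num) (intervalIntegrable_sq_of_memLp hf)
      (by simp) fun x hx => ?_
    rw [← sq_abs]
    exact pow_le_pow_left₀ (abs_nonneg _) (h x hx) 2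
  refine h1.trans (le_of_eq ?_)
  rw [intervalIntegral.integral_const]
  norm_num

/-- Cauchy–Schwarz on [c, d], obtained from the nonnegativity of the integral of (f - m)², where m
is the mean value of f. -/
theorem abs_integral_le {f : ℝ → ℝ} (hf : MemLp f 2 muI) {c d : ℝ} (hc : c ∈ Icc (-1 : ℝ) 1)
    (hd : d ∈ Icc (-1 : ℝ) 1) : |∫ x in c..d, f x| ≤ √|d - c| * ‖hf.toLp f‖ := by
  wlog hcd : c ≤ d generalizing c d
  · rw [intervalIntegral.integral_symm, abs_neg, abs_sub_comm]
    exact this hd hc (le_of_not_ge hcd)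
  rw [abs_of_nonneg (sub_nonneg.2 hcd)]
  have hsub : uIcc c d ⊆ uIcc (-1) 1 := by
    rw [uIcc_of_le hcd, uIcc_of_le (by norm_num)]
    exact Icc_subset_Icc hc.1 hd.2
  have hi := (intervalIntegrable_of_memLp hf).mono_set hsub
  have hi2 := (intervalIntegrable_sq_of_memLp hf).mono_set hsub
  rcases hcd.eq_or_lt with rfl | hlt
  · simp
  set I := ∫ x in c..d, f x with hI
  set m := I / (d - c) with hm
  have h0 : 0 ≤ ∫ x in c..d, (f x - m) ^ 2 :=
    intervalIntegral.integral_nonneg hcd fun x _ => sq_nonneg _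
  have e : ∫ x in c..d, (f x - m) ^ 2 = (∫ x in c..d, f x ^ 2) - 2 * m * I + (d - c) * m ^ 2 := by
    have : ∀ x, (f x - m) ^ 2 = f x ^ 2 - 2 * m * f x + m ^ 2 := fun x => by ring
    simp only [this]
    rw [intervalIntegral.integral_add (hi2.sub (hi.const_mul _)) (by simp),
      intervalIntegral.integral_sub hi2 (hi.const_mul _), intervalIntegral.integral_const_mul,
      intervalIntegral.integral_const, smul_eq_mul]
  have h1 : ∫ x in c..d, f x ^ 2 ≤ ‖hf.toLp f‖ ^ 2 := by
    rw [sq_norm_toLp]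
    exact intervalIntegral.integral_mono_interval hc.1 hcd hd.2
      (Eventually.of_forall fun x => sq_nonneg _) (intervalIntegrable_sq_of_memLp hf)
  rw [e] at h0
  have hpos := sub_pos.2 hlt
  have h2 : I = m * (d - c) := by rw [hm]; field_simp
  refine abs_le_of_sq_le_sq ?_ (by positivity)
  rw [mul_pow, Real.sq_sqrt hpos.le]
  have h3 : I ^ 2 = (d - c) * ((d - c) * m ^ 2) := by rw [h2]; ring
  rw [h3]
  refine mul_le_mul_of_nonneg_left ?_ hpos.le
  rw [h2] at h0
  nlinarith

/-! ### The Sobolev space and its linear maps. -/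

/-- Chains of length `r` on `[-1, 1]` whose last member is square integrable. -/
noncomputable def Sob (r : ℕ) : Submodule ℝ (ℕ → ℝ → ℝ) where
  carrier := {F | IsChain r (-1) 1 F ∧ MemLp (F 0) 2 muI ∧ MemLp (F r) 2 muI}
  add_mem' {F G} hF hG := ⟨fun j hj => (hF.1 j hj).add (hG.1 j hj), hF.2.1.add hG.2.1,
    hF.2.2.add hG.2.2⟩
  zero_mem' := by
    refine ⟨fun j _ => ⟨?_, fun x _ => ?_⟩, MemLp.zero, MemLp.zero⟩
    · exact intervalIntegrable_const (c := (0 : ℝ))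
    · simp
  smul_mem' c F hF := ⟨fun j hj => (hF.1 j hj).const_mul c, hF.2.1.const_mul c,
    hF.2.2.const_mul c⟩

/-- The function itself, as an element of `L_2`. -/
noncomputable def fnMap (r : ℕ) : Sob r →ₗ[ℝ] L2 where
  toFun F := F.2.2.1.toLp (F.1 0)
  map_add' _ _ := rfl
  map_smul' _ _ := rfl

/-- The derivative of order `r`, as an element of `L_2`. -/
noncomputable def derMap (r : ℕ) : Sob r →ₗ[ℝ] L2 where
  toFun F := F.2.2.2.toLp (F.1 r)
  map_add' _ _ := rfl
  map_smul' _ _ := rfl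

/-- The value at `t` of the derivative of order `k`. -/
def evalMap (r k : ℕ) (t : ℝ) : Sob r →ₗ[ℝ] ℝ where
  toFun F := F.1 k t
  map_add' _ _ := rfl
  map_smul' _ _ := rfl

theorem mem_sob {r : ℕ} (hr : 1 ≤ r) {F : ℕ → ℝ → ℝ} (h : IsChain r (-1) 1 F)
    (h2 : MemLp (F r) 2 muI) : F ∈ Sob r :=
  ⟨h, memLp_of_continuousOn (h.continuousOn (by norm_num) hr), h2⟩

theorem derMap_eq_zero {r : ℕ} (hr : 1 ≤ r) (F : Sob r) (h : fnMap r F = 0) : derMap r F = 0 := by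
  have h1 : F.1 0 =ᵐ[muI] 0 := by
    rw [← MemLp.toLp_eq_toLp_iff F.2.2.1 MemLp.zero]; exact h
  have hc : ContinuousOn (F.1 0) (Icc (-1) 1) := F.2.1.continuousOn (by norm_num) hr
  have h2 : EqOn (F.1 0) 0 (Icc (-1) 1) :=
    Measure.eqOn_Icc_of_ae_eq volume (by norm_num) h1 hc continuousOn_const
  have h3 : F.1 r =ᵐ[muI] 0 := by
    refine (F.2.1.iteratedDerivWithin_ae_eq (by norm_num) hr).symm.trans ?_
    filter_upwards [ae_restrict_mem measurableSet_Icc] with x hx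
    rw [iteratedDerivWithin_congr h2 hx]
    simp
  exact (MemLp.toLp_eq_toLp_iff F.2.2.2 MemLp.zero).2 h3

/-- The primitive vanishing at `-1`. -/
noncomputable def prim (f : ℝ → ℝ) (x : ℝ) : ℝ := ∫ y in (-1)..x, f y

theorem isPrim_prim {f : ℝ → ℝ} (hf : MemLp f 2 muI) : IsPrim (-1) 1 f (prim f) :=
  ⟨intervalIntegrable_of_memLp hf, fun x _ => by simp [prim]⟩

theorem memLp_prim {f : ℝ → ℝ} (hf : MemLp f 2 muI) : MemLp (prim f) 2 muI :=
  memLp_of_continuousOn ((isPrim_prim hf).continuousOn (by norm_num))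

theorem norm_prim_le {f : ℝ → ℝ} (hf : MemLp f 2 muI) :
    ‖(memLp_prim hf).toLp (prim f)‖ ≤ 2 * ‖hf.toLp f‖ := by
  have h := norm_toLp_le (memLp_prim hf) (K := √2 * ‖hf.toLp f‖) (by positivity) fun x hx => by
    refine (abs_integral_le hf (c := -1) (by norm_num) hx).trans ?_
    gcongr
    rw [abs_of_nonneg (by linarith [hx.1])]
    linarith [hx.2]
  rwa [← mul_assoc, Real.mul_self_sqrt (by norm_num)] at h

/-- The r-fold primitive from -1; each integration costs a factor 2. This is the hypothesis `hC` of
the abstract lemmas. -/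
theorem exists_derMap_eq (r : ℕ) (v : L2) :
    ∃ F : Sob r, derMap r F = v ∧ ‖fnMap r F‖ ≤ 2 ^ r * ‖v‖ := by
  have hv : MemLp v 2 muI := Lp.memLp v
  have hm : ∀ n, MemLp (prim^[n] v) 2 muI := by
    intro n
    induction n with
    | zero => exact hv
    | succ n ih => rw [Function.iterate_succ_apply']; exact memLp_prim ih
  have hn : ∀ n, ‖(hm n).toLp (prim^[n] v)‖ ≤ 2 ^ n * ‖v‖ := by
    intro n
    induction n with
    | zero => simp
    | succ n ih =>
      have h1 := norm_prim_le (hm n)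
      have h2 : (hm (n + 1)).toLp (prim^[n + 1] v)
          = (memLp_prim (hm n)).toLp (prim (prim^[n] v)) :=
        (MemLp.toLp_eq_toLp_iff _ _).2 (by rw [Function.iterate_succ_apply'])
      rw [h2, pow_succ']
      linarith
  have hF : (fun j => prim^[r - j] v) ∈ Sob r := by
    refine ⟨fun j hj => ?_, hm _, hm _⟩
    have : r - j = (r - (j + 1)) + 1 := by omega
    simp only [this, Function.iterate_succ_apply']
    exact isPrim_prim (hm _)
  refine ⟨⟨_, hF⟩, ?_, hn r⟩
  have hr : MemLp (prim^[r - r] v) 2 muI := hm _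
  exact Eq.trans ((MemLp.toLp_eq_toLp_iff hr hv).2 (by simp)) (Lp.toLp_coeFn v hv)

theorem abs_evalMap_sub_le {r k : ℕ} (hk : k + 1 = r) {t t' : ℝ} (ht : t ∈ Icc (-1 : ℝ) 1)
    (ht' : t' ∈ Icc (-1 : ℝ) 1) (F : Sob r) :
    |evalMap r k t F - evalMap r k t' F| ≤ √|t - t'| * ‖derMap r F‖ := by
  have h := (F.2.1 k (by omega)).integral_eq ht' ht
  have h1 := abs_integral_le F.2.2.2 ht' ht
  rw [hk] at h
  change |F.1 k t - F.1 k t'| ≤ _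
  rw [← h]
  exact h1

/-! ### The problem with prescribed jumps and its Green formula. -/

/-- The function equal to `f` on `(-∞, t]` and to `g` on `(t, ∞)`. -/
noncomputable def glue (t : ℝ) (f g : ℝ → ℝ) (x : ℝ) : ℝ := if x ≤ t then f x else g x

/-- The derivatives `V s` on `[-1, t]` and `W s` on `[t, 1]` of the solution of the boundary value
problem with prescribed jumps at `t`. The end points `t = -1` and `t = 1` are allowed. -/
structure JumpSol (r k : ℕ) (l t : ℝ) (V W : ℕ → ℝ → ℝ) : Prop where
  left : IsChain (2 * r) (-1) t V
  right : IsChain (2 * r) t 1 W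
  left_zero : ∀ s < r, V s (-1) = 0
  right_zero : ∀ s < r, W s 1 = 0
  jump : ∀ s < 2 * r, W s t - V s t = datum r k s
  left_eqn : ∀ x ∈ Ioo (-1) t, (-1) ^ r * V (2 * r) x + l * V 0 x = 0
  right_eqn : ∀ x ∈ Ioo t 1, (-1) ^ r * W (2 * r) x + l * W 0 x = 0

theorem neg_one_pow_mul_self (r : ℕ) : ((-1 : ℝ) ^ r) * (-1) ^ r = 1 := by
  rw [← mul_pow]; norm_num

theorem ae_muI_of_forall {t : ℝ} {p : ℝ → Prop} (h1 : ∀ x ∈ Ioo (-1) t, p x)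
    (h2 : ∀ x ∈ Ioo t 1, p x) : ∀ᵐ x ∂muI, p x := by
  rw [muI, ← restrict_Ioo_eq_restrict_Icc]
  have h3 : ∀ᵐ x ∂(volume.restrict (Ioo (-1 : ℝ) 1)), x ≠ t :=
    ae_restrict_of_ae (by simp [ae_iff])
  filter_upwards [ae_restrict_mem measurableSet_Ioo, h3] with x hx hxt
  rcases lt_or_gt_of_ne hxt with h | h
  · exact h1 x ⟨hx.1, h⟩
  · exact h2 x ⟨h, hx.2⟩

theorem memLp_glue {t : ℝ} {f g : ℝ → ℝ}
    (hf : ContinuousOn f (Icc (-1) t)) (hg : ContinuousOn g (Icc t 1)) :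
    MemLp (glue t f g) 2 muI := by
  have h : ∀ {a b : ℝ} {f : ℝ → ℝ}, ContinuousOn f (Icc a b) →
      MemLp f 2 (volume.restrict (Icc a b)) := fun {a b f} hf => by
    obtain ⟨C, hC⟩ := isCompact_Icc.exists_bound_of_continuousOn hf
    exact MemLp.of_bound (hf.aestronglyMeasurable measurableSet_Icc) C
      (ae_restrict_of_forall_mem measurableSet_Icc hC)
  have := MemLp.piecewise (s := Iic t) (μ := muI) (p := 2) (f := f) (g := g) measurableSet_Iic
    ((h hf).mono_measure ?_) ((h hg).mono_measure ?_)
  · convert this using 1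
    ext x
    simp [glue, Set.piecewise]
  · rw [Measure.restrict_restrict measurableSet_Iic]
    exact Measure.restrict_mono
      (show Iic t ∩ Icc (-1) 1 ⊆ Icc (-1) t from fun x hx => ⟨hx.2.1, hx.1⟩) le_rfl
  · rw [Measure.restrict_restrict measurableSet_Iic.compl]
    exact Measure.restrict_mono
      (show (Iic t)ᶜ ∩ Icc (-1) 1 ⊆ Icc t 1 from fun x hx => ⟨(not_le.1 (mt mem_Iic.2 hx.1)).le, hx.2.2⟩) le_rfl

namespace JumpSol

variable {r k : ℕ} {l t : ℝ} {V W : ℕ → ℝ → ℝ}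

theorem memLp (h : JumpSol r k l t V W) (ht : t ∈ Icc (-1 : ℝ) 1) {j : ℕ}
    (hj : j < 2 * r) : MemLp (glue t (V j) (W j)) 2 muI :=
  memLp_glue (h.left.continuousOn ht.1 hj) (h.right.continuousOn ht.2 hj)

theorem ae_eqn (h : JumpSol r k l t V W) :
    glue t (V (2 * r)) (W (2 * r)) =ᵐ[muI] fun x => l * (-(-1) ^ r * glue t (V 0) (W 0) x) := by
  have e := neg_one_pow_mul_self r
  refine ae_muI_of_forall (t := t) (fun x hx => ?_) fun x hx => ?_
  · simp only [glue, hx.2.le, if_true]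
    linear_combination (-1) ^ r * h.left_eqn x hx - V (2 * r) x * e
  · simp only [glue, not_le.2 hx.1, if_false]
    linear_combination (-1) ^ r * h.right_eqn x hx - W (2 * r) x * e

/-- The only nonzero jump has order r - k - 1 < r, so the derivatives of order r and higher match at
t and u^(r) is a Sobolev function. -/
theorem mem_sob (h : JumpSol r k l t V W) (hr : 1 ≤ r) (ht : t ∈ Icc (-1 : ℝ) 1) :
    (fun j => glue t (V (r + j)) (W (r + j))) ∈ Sob r := by
  refine Stechkin.mem_sob hr ?_ ?_
  · refine IsChain.glue ht (IsChain.shift (m := r) (by rw [← two_mul]; exact h.left))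
      (IsChain.shift (m := r) (by rw [← two_mul]; exact h.right)) fun j hj => ?_
    have := h.jump (r + j) (by omega)
    rw [datum, if_neg (by omega)] at this
    linarith
  · rw [← two_mul]
    exact (((h.memLp ht (j := 0) (by omega)).const_mul _).const_mul _).ae_eq h.ae_eqn.symm

/-- Integration by parts on each side of t: the boundary terms at ±1 vanish, and of the jumps at t
only that of order r - k - 1 survives; it multiplies the derivative of order k. The differential
equation is the second condition. -/
theorem extremal (h : JumpSol r k l t V W) (hr : 1 ≤ r) (hk : k < r)
    (ht : t ∈ Icc (-1 : ℝ) 1) :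
    Extremal (fnMap r) (derMap r) (evalMap r k t) l
      ⟨fun j => glue t (V (r + j)) (W (r + j)), h.mem_sob hr ht⟩
      ((-(-1) ^ r : ℝ) • (h.memLp ht (j := 0) (by omega)).toLp _) := by
  refine ⟨fun F => ?_, ?_⟩
  · have hi : ∀ {f g : ℝ → ℝ}, MemLp f 2 muI → MemLp g 2 muI →
        ∫ x in (-1)..1, f x * g x = (∫ x in (-1)..t, f x * g x) + ∫ x in t..1, f x * g x := by
      intro f g hf hg
      have : IntervalIntegrable (fun x => f x * g x) volume (-1) 1 := by
        rw [intervalIntegrable_iff_integrableOn_Icc_of_le (by norm_num)]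
        exact hf.integrable_mul hg
      refine (intervalIntegral.integral_add_adjacent_intervals (this.mono_set ?_)
        (this.mono_set ?_)).symm
      · rw [uIcc_of_le ht.1, uIcc_of_le (by norm_num)]; exact Icc_subset_Icc_right ht.2
      · rw [uIcc_of_le ht.2, uIcc_of_le (by norm_num)]; exact Icc_subset_Icc_left ht.1
    have hl : ∀ (f g φ : ℝ → ℝ), ∫ x in (-1)..t, glue t f g x * φ x = ∫ x in (-1)..t, f x * φ x := by
      intro f g φ
      refine intervalIntegral.integral_congr fun x hx => ?_
      rw [uIcc_of_le ht.1] at hx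
      simp [glue, hx.2]
    have hr' : ∀ (f g φ : ℝ → ℝ), ∫ x in t..1, glue t f g x * φ x = ∫ x in t..1, g x * φ x := by
      intro f g φ
      refine intervalIntegral.integral_congr_ae (Eventually.of_forall fun x hx => ?_)
      rw [uIoc_of_le ht.2] at hx
      simp [glue, hx.1]
    have e1 : ⟪fnMap r ⟨_, h.mem_sob hr ht⟩, fnMap r F⟫
        = ∫ x in (-1)..1, glue t (V r) (W r) x * F.1 0 x :=
      inner_toLp (h.memLp ht (by omega)) F.2.2.1
    have e2 : ⟪(h.memLp ht (j := 0) (by omega)).toLp _, derMap r F⟫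
        = ∫ x in (-1)..1, glue t (V 0) (W 0) x * F.1 r x :=
      inner_toLp (h.memLp ht (by omega)) F.2.2.2
    rw [e1, real_inner_smul_left, e2, hi (h.memLp ht (by omega)) F.2.2.1,
      hi (h.memLp ht (by omega)) F.2.2.2, hl, hl, hr', hr']
    have hl1 : (-1 : ℝ) ∈ Icc (-1 : ℝ) 1 := by norm_num
    have hr1 : (1 : ℝ) ∈ Icc (-1 : ℝ) 1 := by norm_num
    rw [(h.left.of_le (by omega : r ≤ 2 * r)).integral_mul_eq ht.1 (F.2.1.mono hl1 ht) le_rfl,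
      (h.right.of_le (by omega : r ≤ 2 * r)).integral_mul_eq ht.2 (F.2.1.mono ht hr1) le_rfl,
      Nat.sub_self]
    have hs : ∑ j ∈ Finset.range r,
          (-1) ^ j * (V (r - 1 - j) t * F.1 j t - V (r - 1 - j) (-1) * F.1 j (-1))
        + ∑ j ∈ Finset.range r,
          (-1) ^ j * (W (r - 1 - j) 1 * F.1 j 1 - W (r - 1 - j) t * F.1 j t) = F.1 k t := by
      rw [← Finset.sum_add_distrib, Finset.sum_eq_single k]
      · have h3 := h.jump (r - 1 - k) (by omega)
        rw [datum, if_pos (by omega)] at h3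
        rw [h.left_zero _ (by omega), h.right_zero _ (by omega)]
        have e := neg_one_pow_mul_self k
        linear_combination (-(-1) ^ k * F.1 k t) * h3 + F.1 k t * e
      · intro j hj hjk
        have hj := Finset.mem_range.1 hj
        have h3 := h.jump (r - 1 - j) (by omega)
        rw [datum, if_neg (by omega)] at h3
        rw [h.left_zero _ (by omega), h.right_zero _ (by omega)]
        linear_combination (-(-1) ^ j * F.1 j t) * h3
      · intro hk'
        exact absurd (Finset.mem_range.2 hk) hk'
    change F.1 k t = _
    rw [← hs]
    ring
  · have := h.ae_eqn
    have h0 := h.memLp ht (j := 0) (by omega)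
    refine ((MemLp.toLp_eq_toLp_iff (h.mem_sob hr ht).2.2 ((h0.const_mul _).const_mul _)).2 ?_).trans rfl
    change glue t (V (r + r)) (W (r + r)) =ᵐ[muI] _
    rw [← two_mul]
    exact this

end JumpSol

/-! ### Passage between the boundary value problems and jump solutions. -/

theorem IsChain.iteratedDerivWithin_eqOn_last {n : ℕ} {a b : ℝ} {F : ℕ → ℝ → ℝ}
    (h : IsChain n a b F) (hab : a < b) (hc : ContinuousOn (F n) (Icc a b)) :
    EqOn (iteratedDerivWithin n (F 0) (Icc a b)) (F n) (Icc a b) := by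
  intro x hx
  cases n with
  | zero => simp
  | succ m =>
    have h1 := h.iteratedDerivWithin_eqOn hab m (by omega)
    rw [iteratedDerivWithin_succ, derivWithin_congr h1 (h1 hx)]
    exact ((h m (by omega)).hasDerivWithinAt hc hx).derivWithin (uniqueDiffOn_Icc hab x hx)

theorem iteratedDeriv_eq_of_eqOn {n : ℕ} {a b x : ℝ} {u v : ℝ → ℝ} (hx : x ∈ Ioo a b)
    (h : EqOn u v (Ioo a b)) : iteratedDeriv n u x = iteratedDerivWithin n v (Icc a b) x := by
  have h1 : iteratedDerivWithin n v (Ioo a b) x = iteratedDerivWithin n v (Icc a b) x := by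
    unfold iteratedDerivWithin
    rw [iteratedFDerivWithin_congr_set]
    filter_upwards [Ioo_mem_nhds hx.1 hx.2] with y hy
    simp only [eq_iff_iff]
    exact ⟨fun _ => Ioo_subset_Icc_self hy, fun _ => hy⟩
  rw [← h1, ← iteratedDerivWithin_congr h hx]
  exact (iteratedDerivWithin_of_isOpen isOpen_Ioo hx).symm

theorem isChain_degenerate (n : ℕ) (a : ℝ) (F : ℕ → ℝ → ℝ) : IsChain n a a F := by
  intro j _
  refine ⟨IntervalIntegrable.refl, fun x hx => ?_⟩
  obtain rfl : x = a := le_antisymm hx.2 hx.1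
  simp

theorem SolvesODE.isChain {r : ℕ} {l a b : ℝ} {u : ℝ → ℝ} (h : SolvesODE r l a b u) (hr : 1 ≤ r)
    (hab : a < b) : IsChain (2 * r) a b (fun s => iteratedDerivWithin s u (Icc a b)) :=
  h.inL2n.isChain hab (by omega)

theorem solvesODE_of_isChain {r : ℕ} {l a b : ℝ} {F : ℕ → ℝ → ℝ} (hr : 1 ≤ r) (hab : a < b)
    (h : IsChain (2 * r) a b F) (hc : ContinuousOn (F (2 * r)) (Icc a b))
    (he : ∀ x ∈ Ioo a b, (-1) ^ r * F (2 * r) x + l * F 0 x = 0) : SolvesODE r l a b (F 0) := by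
  refine ⟨h.inL2n hab (by omega) ?_, fun x hx => ?_⟩
  · obtain ⟨C, hC⟩ := isCompact_Icc.exists_bound_of_continuousOn hc
    exact MemLp.of_bound (hc.aestronglyMeasurable measurableSet_Icc) C
      (ae_restrict_of_forall_mem measurableSet_Icc hC)
  · rw [h.iteratedDerivWithin_eqOn_last hab hc (Ioo_subset_Icc_self hx)]
    exact he x hx

theorem neg_one_pow_mul_datum {r k : ℕ} (hk : k < r) (s : ℕ) :
    (-1 : ℝ) ^ (r - k) * (-1) ^ s * datum r k s = -datum r k s := by
  unfold datum
  split_ifs with h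
  · have : r - k = s + 1 := by omega
    rw [this, pow_succ]
    linear_combination (-(-1) ^ (k + 1)) * neg_one_pow_mul_self s
  · simp

theorem IsSol.exists_jumpSol {r k : ℕ} {l t : ℝ} {u : ℝ → ℝ} (h : IsSol r k l t u)
    (hr : 1 ≤ r) (hk : k < r) : ∃ V W, JumpSol r k l t V W ∧ u =ᵐ[muI] glue t (V 0) (W 0) ∧
      iteratedDeriv r u =ᵐ[muI] glue t (V r) (W r) := by
  rcases h with ⟨rfl, h⟩ | ⟨rfl, v, h, rfl⟩ | ⟨ht, v, w, huv, huw, hv, hw, hv0, hw0, hj⟩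
  -- The left piece lives on the single point -1, where constants form a chain. Subtracting the
  -- datum turns the boundary condition into a jump from zero.
  · refine ⟨fun s _ => dI s u (-1) - datum r k s, fun s => dI s u,
      ⟨isChain_degenerate _ _ _, h.ode.isChain hr (by norm_num), fun s hs => ?_, h.right,
        fun s _ => ?_, fun x hx => ?_, fun x hx => ?_⟩, ?_, ?_⟩
    · simp only [h.left s hs, sub_self]
    · simp
    · exact absurd (hx.1.trans hx.2) (lt_irrefl _)
    · simpa using h.ode.eqn x hx
    · refine ae_muI_of_forall (t := -1) (fun x hx => absurd (hx.1.trans hx.2) (lt_irrefl _))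
        fun x hx => ?_
      simp [glue, not_le.2 hx.1]
    · refine ae_muI_of_forall (t := -1) (fun x hx => absurd (hx.1.trans hx.2) (lt_irrefl _))
        fun x hx => ?_
      simp only [glue, not_le.2 hx.1, if_false]
      exact iteratedDeriv_eq_of_eqOn hx fun _ _ => rfl
  · have hc : IsChain (2 * r) (-1) 1
        (fun s x => (-1) ^ (r - k) * ((-1) ^ s * dI s v (-1 * x + 0))) := fun s hs =>
      ((h.ode.isChain hr (by norm_num)).comp_affine (c := -1) (d := 0) (α := -1) (β := 1)
        (by norm_num) (by norm_num) (by norm_num) s hs).const_mul _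
    refine ⟨_, fun s _ => (-1) ^ (r - k) * ((-1) ^ s * dI s v (-1 * 1 + 0)) + datum r k s,
      ⟨hc, isChain_degenerate _ _ _, fun s hs => ?_, fun s hs => ?_,
        fun s _ => ?_, fun x hx => ?_, fun x hx => ?_⟩, ?_, ?_⟩
    · have := h.right s hs
      norm_num [this]
    · have h1 := h.left s hs
      have h2 := neg_one_pow_mul_datum hk s
      simp only [mul_one, add_zero, h1]
      linarith
    · ring
    · have h1 := h.ode.eqn (-x) ⟨by linarith [hx.2], by linarith [hx.1]⟩
      have e : ((-1 : ℝ)) ^ (2 * r) = 1 := by rw [pow_mul]; norm_num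
      simp only [e, one_mul, neg_mul, add_zero, pow_zero]
      simp only [dI, iteratedDerivWithin_zero] at h1 ⊢
      linear_combination (-1) ^ (r - k) * h1
    · exact absurd (hx.1.trans hx.2) (lt_irrefl _)
    · refine ae_muI_of_forall (t := 1) (fun x hx => ?_)
        fun x hx => absurd (hx.1.trans hx.2) (lt_irrefl _)
      simp [glue, hx.2.le, dI]
    · refine ae_muI_of_forall (t := 1) (fun x hx => ?_)
        fun x hx => absurd (hx.1.trans hx.2) (lt_irrefl _)
      have h1 := hc.iteratedDerivWithin_eqOn (by norm_num) r (by omega) (Ioo_subset_Icc_self hx)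
      simp only [glue, hx.2.le, if_true]
      refine Eq.trans ?_ h1
      exact iteratedDeriv_eq_of_eqOn hx fun y _ => by simp [dI]
  · refine ⟨fun s => iteratedDerivWithin s v (Icc (-1) t), fun s => iteratedDerivWithin s w (Icc t 1),
      ⟨hv.isChain hr ht.1, hw.isChain hr ht.2, hv0, hw0, hj, fun x hx => ?_, fun x hx => ?_⟩, ?_, ?_⟩
    · simpa using hv.eqn x hx
    · simpa using hw.eqn x hx
    · refine ae_muI_of_forall (t := t) (fun x hx => ?_) fun x hx => ?_
      · simpa [glue, hx.2.le] using huv hx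
      · simpa [glue, not_le.2 hx.1] using huw hx
    · refine ae_muI_of_forall (t := t) (fun x hx => ?_) fun x hx => ?_
      · simpa only [glue, hx.2.le, if_true] using iteratedDeriv_eq_of_eqOn hx huv
      · simpa only [glue, not_le.2 hx.1, if_false] using iteratedDeriv_eq_of_eqOn hx huw

theorem JumpSol.exists_isSol {r k : ℕ} {l t : ℝ} {V W : ℕ → ℝ → ℝ} (h : JumpSol r k l t V W)
    (hr : 1 ≤ r) (hk : k < r) (ht : t ∈ Icc (-1 : ℝ) 1)
    (hV : ContinuousOn (V (2 * r)) (Icc (-1) t)) (hW : ContinuousOn (W (2 * r)) (Icc t 1)) :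
    ∃ u, IsSol r k l t u := by
  rcases ht.1.eq_or_lt with rfl | h1
  · have hs := h.right.iteratedDerivWithin_eqOn (by norm_num)
    refine ⟨W 0, Or.inl ⟨rfl, solvesODE_of_isChain hr (by norm_num) h.right hW h.right_eqn,
      fun s hs' => ?_, fun s hs' => ?_⟩⟩
    · rw [dI, hs s (by omega) (by norm_num)]
      have h1 := h.jump s (by omega)
      rwa [h.left_zero s hs', sub_zero] at h1
    · rw [dI, hs s (by omega) (by norm_num), h.right_zero s hs']
  rcases ht.2.eq_or_lt with rfl | h2
  · have hc : IsChain (2 * r) (-1) 1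
        (fun s x => (-1) ^ (r - k) * ((-1) ^ s * V s (-1 * x + 0))) := fun s hs =>
      (h.left.comp_affine (c := -1) (d := 0) (α := -1) (β := 1)
        (by norm_num) (by norm_num) (by norm_num) s hs).const_mul _
    have hs := hc.iteratedDerivWithin_eqOn (by norm_num)
    have e : ((-1 : ℝ)) ^ (2 * r) = 1 := by rw [pow_mul]; norm_num
    have hv : SolvesODE r l (-1) 1 (fun x => (-1) ^ (r - k) * ((-1) ^ 0 * V 0 (-1 * x + 0))) := by
      refine solvesODE_of_isChain hr (by norm_num) hc ?_ fun x hx => ?_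
      · refine continuousOn_const.mul (continuousOn_const.mul (hV.comp (by fun_prop) fun x hx => ?_))
        exact ⟨by linarith [hx.2], by linarith [hx.1]⟩
      · have h1 := h.left_eqn (-x) ⟨by linarith [hx.2], by linarith [hx.1]⟩
        simp only [e, one_mul, neg_mul, add_zero, pow_zero]
        linear_combination (-1) ^ (r - k) * h1
    refine ⟨_, Or.inr (Or.inl ⟨rfl, _, ⟨hv, fun s hs' => ?_, fun s hs' => ?_⟩, rfl⟩)⟩
    · rw [dI, hs s (by omega) (by norm_num)]
      have h1 := h.jump s (by omega)
      have h2 := neg_one_pow_mul_datum hk s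
      rw [h.right_zero s hs', zero_sub] at h1
      norm_num
      linear_combination (-(-1) ^ (r - k) * (-1) ^ s) * h1 - h2
    · rw [dI, hs s (by omega) (by norm_num)]
      norm_num [h.left_zero s hs']
  · refine ⟨glue t (V 0) (W 0), Or.inr (Or.inr ⟨⟨h1, h2⟩, V 0, W 0, fun x hx => ?_, fun x hx => ?_,
      solvesODE_of_isChain hr h1 h.left hV h.left_eqn,
      solvesODE_of_isChain hr h2 h.right hW h.right_eqn, fun s hs => ?_, fun s hs => ?_,
      fun s hs => ?_⟩)⟩
    · simp [glue, hx.2.le]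
    · simp [glue, not_le.2 hx.1]
    · rw [h.left.iteratedDerivWithin_eqOn h1 s (by omega) (left_mem_Icc.2 h1.le), h.left_zero s hs]
    · rw [h.right.iteratedDerivWithin_eqOn h2 s (by omega) (right_mem_Icc.2 h2.le),
        h.right_zero s hs]
    · rw [h.left.iteratedDerivWithin_eqOn h1 s hs (right_mem_Icc.2 h1.le),
        h.right.iteratedDerivWithin_eqOn h2 s hs (left_mem_Icc.2 h2.le), h.jump s hs]

/-! ### Existence for the boundary value problem. -/

/-- The companion matrix of `u^(n+1) = ρ u`, acting on jets. -/
noncomputable def companion (n : ℕ) (ρ : ℝ) : (Fin (n + 1) → ℝ) →L[ℝ] (Fin (n + 1) → ℝ) :=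
  LinearMap.toContinuousLinearMap
    { toFun := fun c i => if h : i.1 + 1 < n + 1 then c ⟨i.1 + 1, h⟩ else ρ * c 0
      map_add' := fun c d => by ext i; simp only [Pi.add_apply]; split_ifs <;> ring
      map_smul' := fun c d => by
        ext i; simp only [Pi.smul_apply, smul_eq_mul, RingHom.id_apply]; split_ifs <;> ring }

theorem companion_apply (n : ℕ) (ρ : ℝ) (c : Fin (n + 1) → ℝ) (i : Fin (n + 1)) :
    companion n ρ c i = if h : i.1 + 1 < n + 1 then c ⟨i.1 + 1, h⟩ else ρ * c 0 := rfl

/-- The solution of `u^(n+1) = ρ u` with jet `c` at `x₀`, together with its derivatives. -/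
noncomputable def jetSol (n : ℕ) (ρ x₀ : ℝ) : (Fin (n + 1) → ℝ) →ₗ[ℝ] (ℕ → ℝ → ℝ) where
  toFun c j x := if h : j < n + 1 then NormedSpace.exp ((x - x₀) • companion n ρ) c ⟨j, h⟩
    else ρ * NormedSpace.exp ((x - x₀) • companion n ρ) c 0
  map_add' c d := by
    ext j x; simp only [map_add, Pi.add_apply]; split_ifs <;> ring
  map_smul' c d := by
    ext j x
    simp only [map_smul, Pi.smul_apply, smul_eq_mul, RingHom.id_apply]; split_ifs <;> ring

variable {n : ℕ} {ρ x₀ : ℝ}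

theorem jetSol_base (c : Fin (n + 1) → ℝ) (j : Fin (n + 1)) : jetSol n ρ x₀ c j x₀ = c j := by
  have := j.2
  simp [jetSol, NormedSpace.exp_zero]
  omega

theorem jetSol_last (c : Fin (n + 1) → ℝ) (x : ℝ) :
    jetSol n ρ x₀ c (n + 1) x = ρ * jetSol n ρ x₀ c 0 x := by
  simp [jetSol]

theorem hasDerivAt_jetSol (c : Fin (n + 1) → ℝ) {j : ℕ} (hj : j < n + 1) (x : ℝ) :
    HasDerivAt (jetSol n ρ x₀ c j) (jetSol n ρ x₀ c (j + 1) x) x := by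
  have h1 : HasDerivAt (fun x : ℝ => NormedSpace.exp ((x - x₀) • companion n ρ))
      (companion n ρ * NormedSpace.exp ((x - x₀) • companion n ρ)) x :=
    (hasDerivAt_exp_smul_const' (companion n ρ) (x - x₀)).comp_sub_const x x₀
  have h2 := h1.clm_apply (hasDerivAt_const x c)
  have h3 := (hasDerivAt_pi.1 h2) ⟨j, hj⟩
  simp only [map_zero, add_zero, mul_apply_eq_comp, companion_apply] at h3
  simp only [jetSol, LinearMap.coe_mk, AddHom.coe_mk, hj, dif_pos]
  exact h3

theorem continuous_jetSol_last (c : Fin (n + 1) → ℝ) : Continuous (jetSol n ρ x₀ c (n + 1)) := by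
  have : jetSol n ρ x₀ c (n + 1) = fun x => ρ * jetSol n ρ x₀ c 0 x := funext fun x => jetSol_last c x
  rw [this]
  exact continuous_const.mul (continuous_iff_continuousAt.2 fun x =>
    (hasDerivAt_jetSol c (by omega) x).continuousAt)

theorem isChain_jetSol (c : Fin (n + 1) → ℝ) {a b : ℝ} (hab : a ≤ b) :
    IsChain (n + 1) a b (jetSol n ρ x₀ c) :=
  IsChain.of_hasDerivAt hab (fun _ hj x => hasDerivAt_jetSol c hj x) (continuous_jetSol_last c)

/-- A solution of the homogeneous boundary value problem vanishes. -/
theorem IsChain.eq_zero_of_boundary {r : ℕ} {l : ℝ} {F : ℕ → ℝ → ℝ} (hr : 1 ≤ r) (hl : 0 ≤ l)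
    (h : IsChain (2 * r) (-1) 1 F) (he : ∀ x, F (2 * r) x = -(-1) ^ r * l * F 0 x)
    (h0 : ∀ s < r, F s (-1) = 0) (h1 : ∀ s < r, F s 1 = 0) :
    ∀ s < 2 * r, EqOn (F s) 0 (Icc (-1) 1) := by
  have hc : ∀ s < 2 * r, ContinuousOn (F s) (Icc (-1) 1) := fun s hs =>
    h.continuousOn (by norm_num) hs
  -- The boundary terms vanish, and the equation turns this into ∫ F_r² = -l ∫ F_0² ≤ 0. Hence F_r =
  -- 0; higher orders follow by differentiation, lower ones by integration from -1.
  have key := (h.of_le (by omega : r ≤ 2 * r)).integral_mul_eq (by norm_num)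
    (IsChain.shift (m := r) (by rw [← two_mul]; exact h)) le_rfl
  rw [Finset.sum_eq_zero, zero_add, Nat.sub_self, ← two_mul] at key
  · have hr0 : EqOn (F r) 0 (Icc (-1) 1) := by
      have e : (-1) ^ r * ∫ x in (-1)..1, F 0 x * F (2 * r) x
          = -l * ∫ x in (-1)..1, F 0 x ^ 2 := by
        rw [← intervalIntegral.integral_const_mul, ← intervalIntegral.integral_const_mul]
        congr 1
        ext x
        rw [he]
        linear_combination (-l * F 0 x ^ 2) * neg_one_pow_mul_self r
      rw [e] at key
      have h2 : 0 ≤ ∫ x in (-1 : ℝ)..1, F 0 x ^ 2 :=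
        intervalIntegral.integral_nonneg (by norm_num) fun x _ => sq_nonneg _
      have h3 : ∫ x in (-1 : ℝ)..1, F r x ^ 2 ≤ 0 := by
        simp only [sq]
        refine le_of_eq_of_le key ?_
        nlinarith
      have hm := memLp_of_continuousOn (hc r (by omega)) (p := 2)
      have h4 : hm.toLp (F r) = 0 := by
        have := sq_norm_toLp hm
        rw [← norm_eq_zero]
        nlinarith [norm_nonneg (hm.toLp (F r))]
      have h5 : F r =ᵐ[muI] 0 := by
        rw [← MemLp.toLp_eq_toLp_iff hm MemLp.zero]; exact h4
      exact Measure.eqOn_Icc_of_ae_eq volume (by norm_num) h5 (hc r (by omega)) continuousOn_const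
    have hup : ∀ j < r, EqOn (F (r + j)) 0 (Icc (-1) 1) := by
      intro j
      induction j with
      | zero => intro _; exact hr0
      | succ j ih =>
        intro hj x hx
        have hd := (h (r + j) (by omega)).hasDerivWithinAt (hc _ (by omega)) hx
        have hd' : HasDerivWithinAt (F (r + j)) 0 (Icc (-1) 1) x :=
          (hasDerivWithinAt_const x (Icc (-1) 1) (0 : ℝ)).congr (ih (by omega)) (ih (by omega) hx)
        exact (uniqueDiffOn_Icc (by norm_num) x hx).eq_deriv _ hd hd'
    have hdown : ∀ j ≤ r, EqOn (F (r - j)) 0 (Icc (-1) 1) := by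
      intro j
      induction j with
      | zero => intro _; exact hr0
      | succ j ih =>
        intro hj x hx
        have h2 := (h (r - (j + 1)) (by omega)).2 x hx
        rw [h0 _ (by omega), show r - (j + 1) + 1 = r - j by omega, zero_add] at h2
        rw [h2]
        refine (intervalIntegral.integral_congr (g := fun _ => 0) fun y hy => ?_).trans (by simp)
        rw [uIcc_of_le hx.1] at hy
        exact ih (by omega) ⟨hy.1, hy.2.trans hx.2⟩
    intro s hs
    rcases le_or_gt r s with hrs | hrs
    · have := hup (s - r) (by omega)
      rwa [Nat.add_sub_cancel' hrs] at this
    · have := hdown (r - s) (by omega)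
      rwa [Nat.sub_sub_self hrs.le] at this
  · intro j hj
    have hj := Finset.mem_range.1 hj
    rw [h0 _ (by omega), h1 _ (by omega)]
    ring

theorem exists_jumpSol {r k : ℕ} {l t : ℝ} (hr : 1 ≤ r) (hl : 0 ≤ l)
    (ht : t ∈ Icc (-1 : ℝ) 1) : ∃ V W, JumpSol r k l t V W ∧ Continuous (V (2 * r)) ∧
      Continuous (W (2 * r)) := by
  obtain ⟨n, hn⟩ : ∃ n, 2 * r = n + 1 := ⟨2 * r - 1, by omega⟩
  set ρ : ℝ := -(-1) ^ r * l with hρ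
  let Φ := jetSol n ρ t
  let T : (Fin (n + 1) → ℝ) →ₗ[ℝ] (Fin r → ℝ) × (Fin r → ℝ) :=
    { toFun := fun c => (fun s => Φ c s (-1), fun s => Φ c s 1)
      map_add' := fun c d => by simp only [map_add]; rfl
      map_smul' := fun c d => by simp only [map_smul]; rfl }
  have hinj : Function.Injective T := by
    rw [← LinearMap.ker_eq_bot, LinearMap.ker_eq_bot']
    intro c hc
    have h1 : ∀ s : Fin r, Φ c s (-1) = 0 := fun s => congrFun (congrArg Prod.fst hc) s
    have h2 : ∀ s : Fin r, Φ c s 1 = 0 := fun s => congrFun (congrArg Prod.snd hc) s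
    have hch : IsChain (2 * r) (-1) 1 (Φ c) := by
      rw [hn]; exact isChain_jetSol c (by norm_num)
    have := hch.eq_zero_of_boundary hr hl (fun x => by rw [hn]; exact jetSol_last c x)
      (fun s hs => h1 ⟨s, hs⟩) (fun s hs => h2 ⟨s, hs⟩)
    ext j
    rw [← jetSol_base (ρ := ρ) (x₀ := t) c j]
    exact this j (by omega) ht
  -- Jets have 2r coordinates and there are r conditions at each end point, so uniqueness gives
  -- existence.
  have hsurj : Function.Surjective T := by
    refine (LinearMap.injective_iff_surjective_of_finrank_eq_finrank ?_).1 hinj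
    simp
    omega
  set d : Fin (n + 1) → ℝ := fun s => datum r k s with hd
  -- The left piece has jet c at t and the right piece jet c + d, d being the jump; the right piece
  -- must vanish at 1 to order r.
  obtain ⟨c, hc⟩ := hsurj (0, fun s => -Φ d s 1)
  have h1 : ∀ s : Fin r, Φ c s (-1) = 0 := fun s => congrFun (congrArg Prod.fst hc) s
  have h2 : ∀ s : Fin r, Φ c s 1 = -Φ d s 1 := fun s => congrFun (congrArg Prod.snd hc) s
  have heq : ∀ (c : Fin (n + 1) → ℝ) (x : ℝ), (-1) ^ r * Φ c (2 * r) x + l * Φ c 0 x = 0 := by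
    intro c x
    rw [hn]
    simp only [Φ, jetSol_last, hρ]
    linear_combination (-l * jetSol n ρ t c 0 x) * neg_one_pow_mul_self r
  refine ⟨Φ c, Φ (c + d), ⟨by rw [hn]; exact isChain_jetSol c ht.1,
    by rw [hn]; exact isChain_jetSol _ ht.2,
    fun s hs => h1 ⟨s, hs⟩, fun s hs => ?_, fun s hs => ?_, fun x _ => heq _ x,
    fun x _ => heq _ x⟩, by rw [hn]; exact continuous_jetSol_last c,
    by rw [hn]; exact continuous_jetSol_last _⟩
  · have := h2 ⟨s, hs⟩
    simp only [map_add, Pi.add_apply]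
    simp only at this
    linarith
  · have := jetSol_base (ρ := ρ) (x₀ := t) d ⟨s, by omega⟩
    simp only [map_add, Pi.add_apply]
    simp only [hd] at this
    simp only [Φ]
    linarith

theorem exists_isSol {r k : ℕ} {l t : ℝ} (hr : 1 ≤ r) (hk : k < r) (hl : 0 ≤ l)
    (ht : t ∈ Icc (-1 : ℝ) 1) : ∃ u, IsSol r k l t u := by
  obtain ⟨V, W, h, hV, hW⟩ := exists_jumpSol (k := k) hr hl ht
  exact h.exists_isSol hr hk ht hV.continuousOn hW.continuousOn

/-! ### Stretching, interpolation and unboundedness of point evaluations. -/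

theorem sq_norm_fnMap {r : ℕ} (F : Sob r) : ‖fnMap r F‖ ^ 2 = ∫ x in (-1)..1, F.1 0 x ^ 2 :=
  sq_norm_toLp F.2.2.1

theorem sq_norm_derMap {r : ℕ} (F : Sob r) : ‖derMap r F‖ ^ 2 = ∫ x in (-1)..1, F.1 r x ^ 2 :=
  sq_norm_toLp F.2.2.2

/-- Stretching the part of a function between `t` and `t + 2 * c` to `[-1, 1]`. -/
theorem exists_stretch {r : ℕ} (hr : 1 ≤ r) (F : Sob r) {t c : ℝ} (hc : c ≠ 0)
    (ht : t ∈ Icc (-1 : ℝ) 1) (htc : t + 2 * c ∈ Icc (-1 : ℝ) 1) :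
    ∃ G : Sob r, (∀ k, evalMap r k (-1) G = c ^ k * evalMap r k t F) ∧
      c * ‖fnMap r G‖ ^ 2 = ∫ x in t..(t + 2 * c), F.1 0 x ^ 2 ∧
      c * ‖derMap r G‖ ^ 2 = c ^ (2 * r) * ∫ x in t..(t + 2 * c), F.1 r x ^ 2 := by
  -- The substitution x ↦ c x + (t + c) sends -1 to t and 1 to t + 2c. A negative c is allowed and
  -- reverses orientation.
  have e1 : c * (-1) + (t + c) = t := by ring
  have e2 : c * 1 + (t + c) = t + 2 * c := by ring
  have hch : IsChain r (-1) 1 (fun j x => c ^ j * F.1 j (c * x + (t + c))) :=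
    F.2.1.comp_affine hc (by rwa [e1]) (by rwa [e2])
  have hm : MemLp (fun x => c ^ r * F.1 r (c * x + (t + c))) 2 muI := by
    have h1 := (hch (r - 1) (by omega)).1
    rw [Nat.sub_add_cancel hr] at h1
    rw [intervalIntegrable_iff_integrableOn_Icc_of_le (by norm_num)] at h1
    rw [memLp_two_iff_integrable_sq h1.aestronglyMeasurable]
    have h2 : IsPrim (-1) 1 (fun x => F.1 r x ^ 2) (prim fun x => F.1 r x ^ 2) :=
      ⟨intervalIntegrable_sq_of_memLp F.2.2.2, fun x _ => by simp [prim]⟩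
    have h3 := ((h2.comp_affine hc (α := -1) (β := 1) (d := t + c) (by rwa [e1])
      (by rwa [e2])).1.const_mul (c ^ (2 * r) / c))
    rw [intervalIntegrable_iff_integrableOn_Icc_of_le (by norm_num)] at h3
    refine h3.congr (Eventually.of_forall fun x => ?_)
    simp only
    field_simp
    ring
  have hi : ∀ j, c * ∫ x in (-1)..1, (c ^ j * F.1 j (c * x + (t + c))) ^ 2
      = c ^ (2 * j) * ∫ x in t..(t + 2 * c), F.1 j x ^ 2 := by
    intro j
    simp only [mul_pow]
    rw [intervalIntegral.integral_const_mul,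
      intervalIntegral.integral_comp_mul_add (fun x => F.1 j x ^ 2) hc, e1, e2, smul_eq_mul]
    field_simp
    ring
  refine ⟨⟨_, mem_sob hr hch hm⟩, fun k => ?_, ?_, ?_⟩
  · change c ^ k * F.1 k (c * (-1) + (t + c)) = _
    rw [e1]; rfl
  · rw [sq_norm_fnMap]
    exact (hi 0).trans (by simp)
  · rw [sq_norm_derMap]
    exact hi r

theorem abs_integral_sq_le {f : ℝ → ℝ} (hf : MemLp f 2 muI) {t s : ℝ} (ht : t ∈ Icc (-1 : ℝ) 1)
    (hs : s ∈ Icc (-1 : ℝ) 1) : |∫ x in t..s, f x ^ 2| ≤ ‖hf.toLp f‖ ^ 2 := by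
  rw [sq_norm_toLp]
  wlog hts : t ≤ s generalizing t s
  · rw [intervalIntegral.integral_symm, abs_neg]
    exact this hs ht (le_of_not_ge hts)
  rw [abs_of_nonneg (intervalIntegral.integral_nonneg hts fun x _ => sq_nonneg _)]
  exact intervalIntegral.integral_mono_interval ht.1 hts hs.2
    (Eventually.of_forall fun x => sq_nonneg _) (intervalIntegrable_sq_of_memLp hf)

/-- The representation at -1 is carried to an interval of length 2s² with end point t. Scaling gives
the derivative the coefficient ‖w‖ s^(2r-2k-1) ≤ ‖w‖ s, which is small with s. -/
theorem exists_interpolation {r k : ℕ} (hr : 1 ≤ r) (hk : k < r) {g w : L2}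
    (h : Represents (fnMap r) (derMap r) (evalMap r k (-1)) g w) {t : ℝ}
    (ht : t ∈ Icc (-1 : ℝ) 1) {η : ℝ} (hη : 0 < η) :
    ∃ K, ∀ F, |evalMap r k t F| ≤ η * ‖derMap r F‖ + K * ‖fnMap r F‖ := by
  obtain ⟨s, hs0, hs1, hsη⟩ : ∃ s : ℝ, 0 < s ∧ s ≤ 1 / 2 ∧ ‖w‖ * s ≤ η := by
    refine ⟨min (1 / 2) (η / (‖w‖ + 1)), by positivity, min_le_left _ _, ?_⟩
    calc ‖w‖ * min (1 / 2) (η / (‖w‖ + 1)) ≤ (‖w‖ + 1) * (η / (‖w‖ + 1)) :=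
          mul_le_mul (by linarith) (min_le_right _ _) (by positivity) (by positivity)
      _ = η := by field_simp
  -- The short interval runs from t towards the middle. Taking |c| to be a square avoids roots in
  -- the norm scalings.
  obtain ⟨c, hc, hct⟩ : ∃ c : ℝ, |c| = s ^ 2 ∧ t + 2 * c ∈ Icc (-1 : ℝ) 1 := by
    rcases le_total t 0 with h0 | h0
    · exact ⟨s ^ 2, abs_of_pos (by positivity), by nlinarith [ht.1], by nlinarith [ht.1]⟩
    · exact ⟨-s ^ 2, by rw [abs_neg, abs_of_pos (by positivity)], by nlinarith [ht.2],
        by nlinarith [ht.2]⟩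
  have hc0 : c ≠ 0 := by rw [← abs_pos, hc]; positivity
  refine ⟨‖g‖ / s ^ (2 * k + 1), fun F => ?_⟩
  obtain ⟨G, h1, h2, h3⟩ := exists_stretch hr F hc0 ht hct
  have h2' : s * ‖fnMap r G‖ ≤ ‖fnMap r F‖ := by
    refine le_of_sq_le_sq ?_ (norm_nonneg _)
    have h4 := abs_integral_sq_le F.2.2.1 ht hct
    rw [← h2, abs_mul, hc, abs_of_nonneg (sq_nonneg _)] at h4
    rw [mul_pow]
    exact h4
  have h3' : s * ‖derMap r G‖ ≤ s ^ (2 * r) * ‖derMap r F‖ := by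
    refine le_of_sq_le_sq ?_ (by positivity)
    have h4 := mul_le_mul_of_nonneg_left (abs_integral_sq_le F.2.2.2 ht hct)
      (pow_nonneg (abs_nonneg c) (2 * r))
    rw [← abs_pow, ← abs_mul, ← h3, abs_mul, hc, abs_of_nonneg (sq_nonneg _), abs_pow, hc] at h4
    rw [mul_pow, mul_pow]
    refine h4.trans (le_of_eq ?_)
    change (s ^ 2) ^ (2 * r) * ‖derMap r F‖ ^ 2 = _
    ring
  have h5 := h.abs_le G
  rw [h1, abs_mul, abs_pow, hc] at h5
  have h6 : s ^ (2 * k + 1) * |evalMap r k t F|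
      ≤ ‖g‖ * ‖fnMap r F‖ + ‖w‖ * (s ^ (2 * r) * ‖derMap r F‖) := by
    calc s ^ (2 * k + 1) * |evalMap r k t F| = s * ((s ^ 2) ^ k * |evalMap r k t F|) := by ring
      _ ≤ s * (‖g‖ * ‖fnMap r G‖ + ‖w‖ * ‖derMap r G‖) := by gcongr
      _ = ‖g‖ * (s * ‖fnMap r G‖) + ‖w‖ * (s * ‖derMap r G‖) := by ring
      _ ≤ _ := by gcongr
  have h7 : s ^ (2 * r) ≤ s ^ (2 * k + 1) * s := by
    rw [← pow_succ]
    exact pow_le_pow_of_le_one hs0.le (by linarith) (by omega)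
  have hs' : 0 < s ^ (2 * k + 1) := by positivity
  have h8 : s ^ (2 * k + 1) * |evalMap r k t F| ≤ s ^ (2 * k + 1) *
      (η * ‖derMap r F‖ + ‖g‖ / s ^ (2 * k + 1) * ‖fnMap r F‖) := by
    calc _ ≤ ‖g‖ * ‖fnMap r F‖ + ‖w‖ * (s ^ (2 * k + 1) * s * ‖derMap r F‖) := by
          refine h6.trans ?_; gcongr
      _ = ‖g‖ * ‖fnMap r F‖ + s ^ (2 * k + 1) * (‖w‖ * s) * ‖derMap r F‖ := by ring
      _ ≤ ‖g‖ * ‖fnMap r F‖ + s ^ (2 * k + 1) * η * ‖derMap r F‖ := by gcongr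
      _ = _ := by field_simp; ring
  exact le_of_mul_le_mul_left h8 hs'

theorem contDiff_mem_sob (r : ℕ) {f : ℝ → ℝ} (hf : ContDiff ℝ ((r + 1 : ℕ) : WithTop ℕ∞) f) :
    (fun j => iteratedDeriv j f) ∈ Sob r := by
  have hc : ∀ j ≤ r, Continuous (iteratedDeriv j f) := fun j hj =>
    hf.continuous_iteratedDeriv j (by exact_mod_cast (by omega : j ≤ r + 1))
  refine ⟨IsChain.of_hasDerivAt (by norm_num) (fun j hj x => ?_) (hc r le_rfl),
    memLp_of_continuousOn (hc 0 (by omega)).continuousOn,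
    memLp_of_continuousOn (hc r le_rfl).continuousOn⟩
  rw [iteratedDeriv_succ]
  exact (hf.differentiable_iteratedDeriv j
    (by exact_mod_cast (by omega : j < r + 1)) x).hasDerivAt

theorem exists_evalMap_eq_one (r : ℕ) {k : ℕ} (hk : k = 0 ∨ k = 1) (t B : ℝ) :
    ∃ F : Sob r, evalMap r k t F = 1 ∧ B * ‖fnMap r F‖ ≤ 1 / 2 := by
  rcases hk with rfl | rfl
  -- A narrow Gaussian bump at t: its squared norm is at most √(π / (2m)), and B²√(π / (2m)) ≤ 1/4
  -- amounts to m ≥ 8πB⁴.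
  · set m : ℝ := 8 * Real.pi * B ^ 4 + 1 with hm
    have hm0 : 0 < m := by positivity
    set f : ℝ → ℝ := fun x => Real.exp (-m * (x - t) ^ 2) with hf
    have hmem := contDiff_mem_sob r (f := f) (by rw [hf]; fun_prop)
    refine ⟨⟨_, hmem⟩, ?_, ?_⟩
    · change iteratedDeriv 0 f t = 1
      simp [hf]
    have h1 : ‖fnMap r ⟨_, hmem⟩‖ ^ 2 ≤ √(Real.pi / (2 * m)) := by
      rw [sq_norm_fnMap, intervalIntegral.integral_of_le (by norm_num)]
      have e : ∀ x, iteratedDeriv 0 f x ^ 2 = Real.exp (-(2 * m) * (x - t) ^ 2) := fun x => by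
        rw [iteratedDeriv_zero, hf, ← Real.exp_nat_mul]
        congr 1
        push_cast
        ring
      simp only [e]
      rw [← integral_gaussian, ← integral_sub_right_eq_self (μ := volume) (fun x => Real.exp (-(2 * m) * x ^ 2)) t]
      exact setIntegral_le_integral
        ((integrable_exp_neg_mul_sq (by positivity : 0 < 2 * m)).comp_sub_right t)
        (Eventually.of_forall fun x => (Real.exp_pos _).le)
    have h2 : B ^ 2 * √(Real.pi / (2 * m)) ≤ 1 / 4 := by
      refine le_of_sq_le_sq ?_ (by norm_num)
      rw [mul_pow, Real.sq_sqrt (by positivity), mul_div_assoc', div_le_iff₀ (by positivity)]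
      rw [hm]
      nlinarith [Real.pi_pos]
    refine le_of_sq_le_sq ?_ (by norm_num)
    rw [mul_pow]
    have := mul_le_mul_of_nonneg_left h1 (sq_nonneg B)
    linarith
  -- A fast oscillation sin(m(x - t)) / m: slope 1 at t, norm at most 2 / m.
  · set m : ℝ := 4 * |B| + 1 with hm
    have hm0 : 0 < m := by positivity
    set f : ℝ → ℝ := fun x => Real.sin (m * (x - t)) / m with hf
    have hmem := contDiff_mem_sob r (f := f) (by rw [hf]; fun_prop)
    refine ⟨⟨_, hmem⟩, ?_, ?_⟩
    · change iteratedDeriv 1 f t = 1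
      rw [iteratedDeriv_one]
      have h1 : HasDerivAt f (Real.cos (m * (t - t)) * (m * 1) / m) t :=
        ((((hasDerivAt_id t).sub_const t).const_mul m).sin).div_const m
      rw [h1.deriv]
      simp [hm0.ne']
    have h1 := norm_toLp_le hmem.2.1 (K := 1 / m) (by positivity) fun x _ => by
      change |iteratedDeriv 0 f x| ≤ 1 / m
      rw [iteratedDeriv_zero, hf, abs_div, abs_of_pos hm0]
      gcongr
      exact Real.abs_sin_le_one _
    have h2 : √2 ≤ 2 := by rw [Real.sqrt_le_left (by norm_num)]; norm_num
    calc B * ‖fnMap r ⟨_, hmem⟩‖ ≤ |B| * (2 * (1 / m)) := by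
          refine mul_le_mul (le_abs_self B) (h1.trans ?_) (norm_nonneg _) (abs_nonneg _)
          gcongr
      _ ≤ 1 / 2 := by
          rw [mul_one_div, mul_div_assoc', div_le_iff₀ hm0, hm]
          linarith

/-! ### Transfer of the energy bound from -1 by reflection and stretching. -/

theorem sq_evalMap_one_le {r k : ℕ} (hr : 1 ≤ r) {g w : L2} {l : ℝ} (hl : 0 < l)
    (h : Represents (fnMap r) (derMap r) (evalMap r k (-1)) g w) (F : Sob r) :
    l * evalMap r k 1 F ^ 2
      ≤ (‖g‖ ^ 2 + l * ‖w‖ ^ 2) * (‖derMap r F‖ ^ 2 + l * ‖fnMap r F‖ ^ 2) := by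
  obtain ⟨G, h1, h2, h3⟩ := exists_stretch hr F (t := 1) (c := -1) (by norm_num) (by norm_num)
    (by norm_num)
  have h4 := h.sq_le hl G
  have e : (1 : ℝ) + 2 * (-1) = -1 := by norm_num
  rw [e, intervalIntegral.integral_symm, ← sq_norm_fnMap] at h2
  rw [e, intervalIntegral.integral_symm, ← sq_norm_derMap, pow_mul, neg_one_sq, one_pow] at h3
  rw [h1, mul_pow, ← pow_mul, mul_comm k, pow_mul, neg_one_sq, one_pow, one_mul] at h4
  rw [show ‖fnMap r F‖ ^ 2 = ‖fnMap r G‖ ^ 2 by linarith,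
    show ‖derMap r F‖ ^ 2 = ‖derMap r G‖ ^ 2 by linarith]
  exact h4

/-- The bound at -1 is applied to F restricted to each side of t and stretched to the whole
interval. Stretching preserves values, and the scale factor of the derivative is at most 1. The two
ratios |c| add up to 1, so the weighted bounds sum to the claim. For k ≥ 1 the evaluation itself
would pick up a factor c^k. -/
theorem sq_evalMap_zero_le {r : ℕ} (hr : 1 ≤ r) {g w : L2} {l : ℝ} (hl : 0 < l)
    (h : Represents (fnMap r) (derMap r) (evalMap r 0 (-1)) g w) {t : ℝ}
    (ht : t ∈ Icc (-1 : ℝ) 1) (F : Sob r) :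
    l * evalMap r 0 t F ^ 2
      ≤ (‖g‖ ^ 2 + l * ‖w‖ ^ 2) * (‖derMap r F‖ ^ 2 + l * ‖fnMap r F‖ ^ 2) := by
  set m := ‖g‖ ^ 2 + l * ‖w‖ ^ 2 with hm
  have hm0 : 0 ≤ m := by positivity
  have part : ∀ c : ℝ, |c| ≤ 1 → t + 2 * c ∈ Icc (-1 : ℝ) 1 → |c| * (l * evalMap r 0 t F ^ 2)
      ≤ m * (|∫ x in t..(t + 2 * c), F.1 r x ^ 2| + l * |∫ x in t..(t + 2 * c), F.1 0 x ^ 2|) := by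
    intro c hc1 hct
    rcases eq_or_ne c 0 with rfl | hc
    · simp
    obtain ⟨G, h1, h2, h3⟩ := exists_stretch hr F hc ht hct
    have h4 := mul_le_mul_of_nonneg_left (h.sq_le hl G) (abs_nonneg c)
    rw [h1, pow_zero, one_mul] at h4
    refine h4.trans ?_
    rw [← h2, abs_mul, abs_of_nonneg (sq_nonneg ‖fnMap r G‖)]
    have h5 : |c| * ‖derMap r G‖ ^ 2 ≤ |∫ x in t..(t + 2 * c), F.1 r x ^ 2| := by
      have := congrArg abs h3
      rw [abs_mul, abs_mul, abs_of_nonneg (sq_nonneg ‖derMap r G‖), abs_pow] at this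
      rw [this]
      exact mul_le_of_le_one_left (abs_nonneg _) (pow_le_one₀ (abs_nonneg _) hc1)
    calc |c| * (m * (‖derMap r G‖ ^ 2 + l * ‖fnMap r G‖ ^ 2))
        = m * (|c| * ‖derMap r G‖ ^ 2 + l * (|c| * ‖fnMap r G‖ ^ 2)) := by ring
      _ ≤ _ := by gcongr
  have p1 := part ((1 - t) / 2) (by rw [abs_le]; constructor <;> linarith [ht.1, ht.2])
    (by ring_nf; norm_num)
  have p2 := part (-(1 + t) / 2) (by rw [abs_le]; constructor <;> linarith [ht.1, ht.2])
    (by ring_nf; norm_num)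
  rw [show t + 2 * ((1 - t) / 2) = 1 by ring, abs_of_nonneg (by linarith [ht.2])] at p1
  rw [show t + 2 * (-(1 + t) / 2) = -1 by ring, abs_of_nonpos (by linarith [ht.1])] at p2
  have split : ∀ f : ℝ → ℝ, MemLp f 2 muI → |∫ x in t..1, f x ^ 2| + |∫ x in t..(-1), f x ^ 2|
      = ∫ x in (-1)..1, f x ^ 2 := by
    intro f hf
    have hi := intervalIntegrable_sq_of_memLp hf
    rw [intervalIntegral.integral_symm (-1) t, abs_neg,
      abs_of_nonneg (intervalIntegral.integral_nonneg ht.2 fun x _ => sq_nonneg _),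
      abs_of_nonneg (intervalIntegral.integral_nonneg ht.1 fun x _ => sq_nonneg _), add_comm]
    refine intervalIntegral.integral_add_adjacent_intervals (hi.mono_set ?_) (hi.mono_set ?_)
    · rw [uIcc_of_le ht.1, uIcc_of_le (by norm_num)]; exact Icc_subset_Icc_right ht.2
    · rw [uIcc_of_le ht.2, uIcc_of_le (by norm_num)]; exact Icc_subset_Icc_left ht.1
  rw [sq_norm_derMap, sq_norm_fnMap, ← split _ F.2.2.1, ← split _ F.2.2.2]
  linarith

/-! ### The trigonometric-hyperbolic inequality. -/

theorem nonneg_of_hasDerivAt {f f' : ℝ → ℝ} (h0 : 0 ≤ f 0) (hd : ∀ x, HasDerivAt f (f' x) x)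
    (h' : ∀ x, 0 ≤ x → 0 ≤ f' x) {x : ℝ} (hx : 0 ≤ x) : 0 ≤ f x := by
  have hm : MonotoneOn f (Ici 0) := by
    refine monotoneOn_of_deriv_nonneg (convex_Ici 0)
      (fun y _ => (hd y).continuousAt.continuousWithinAt)
      (fun y _ => (hd y).differentiableAt.differentiableWithinAt) fun y hy => ?_
    rw [interior_Ici] at hy
    rw [(hd y).deriv]
    exact h' y (le_of_lt hy)
  exact h0.trans (hm self_mem_Ici hx hx)

theorem abs_sin_le_sinh {x : ℝ} (hx : 0 ≤ x) : |Real.sin x| ≤ Real.sinh x := by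
  have h1 := Real.abs_sin_le_abs (x := x)
  rw [abs_of_nonneg hx] at h1
  exact h1.trans (Real.self_le_sinh_iff.2 hx)

/-- For x ≤ 2 the quadratic lower bounds of both functions leave 4 - x²; for x ≥ 2 already cosh x ≥
3. -/
theorem cosh_add_three_mul_cos_nonneg {x : ℝ} (hx : 0 ≤ x) :
    0 ≤ Real.cosh x + 3 * Real.cos x := by
  have h1 : 1 + x ^ 2 / 2 ≤ Real.cosh x := by
    have h2 : Real.cosh x = 1 + 2 * Real.sinh (x / 2) ^ 2 := by
      have := Real.cosh_two_mul (x / 2)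
      rw [mul_div_cancel₀ x two_ne_zero, Real.cosh_sq] at this
      linarith
    have h3 : x / 2 ≤ Real.sinh (x / 2) := Real.self_le_sinh_iff.2 (by linarith)
    nlinarith
  rcases le_total x 2 with h | h
  · have := Real.one_sub_sq_div_two_le_cos (x := x)
    nlinarith
  · have := Real.neg_one_le_cos x
    nlinarith

/-- The mixed fourth order derivative of the left-hand side of `add_hyperbolic_nonneg`. -/
theorem hyperbolic_aux {x y : ℝ} (hx : 0 ≤ x) (hy : 0 ≤ y) :
    0 ≤ 3 * (Real.cosh (x + y) + Real.cos (x + y)) + Real.sinh x * Real.sin y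
      - Real.cosh x * Real.cos y - Real.sinh y * Real.sin x - Real.cosh y * Real.cos x := by
  -- This absorbs 3 cos(x + y) at the cost of one cosh(x + y). The remaining 2 cosh(x + y),
  -- expanded, dominates the four mixed products through `m1` to `m4`.
  have h1 := cosh_add_three_mul_cos_nonneg (add_nonneg hx hy)
  have e := Real.cosh_add x y
  have a1 := abs_le.1 (abs_sin_le_sinh hx)
  have a2 := abs_le.1 (abs_sin_le_sinh hy)
  have s1 := Real.sinh_nonneg_iff.2 hx
  have s2 := Real.sinh_nonneg_iff.2 hy
  have c1 := Real.one_le_cosh x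
  have c2 := Real.one_le_cosh y
  have b1 := Real.cos_le_one x
  have b2 := Real.cos_le_one y
  have m1 : 0 ≤ Real.sinh x * (Real.sinh y + Real.sin y) := mul_nonneg s1 (by linarith)
  have m2 : 0 ≤ Real.sinh y * (Real.sinh x - Real.sin x) := mul_nonneg s2 (by linarith)
  have m3 : 0 ≤ Real.cosh x * (Real.cosh y - Real.cos y) := mul_nonneg (by linarith) (by linarith)
  have m4 : 0 ≤ Real.cosh y * (Real.cosh x - Real.cos x) := mul_nonneg (by linarith) (by linarith)
  nlinarith

/-- The expression vanishes at y = 0, and its derivative in y is `d4`. Differentiating in x leads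
from `d4` to `d3`, `d2`, `d1` and `hyperbolic_aux`. Each is nonnegative at x = 0, so nonnegativity
climbs back up. -/
theorem add_hyperbolic_nonneg {x y : ℝ} (hx : 0 ≤ x) (hy : 0 ≤ y) :
    0 ≤ 3 * (Real.sinh (x + y) + Real.sin (x + y)) - 2 * (Real.sinh x + Real.sin x)
      - 2 * (Real.sinh y + Real.sin y) - (Real.sinh x * Real.cos y + Real.cosh x * Real.sin y
        + Real.cosh y * Real.sin x + Real.sinh y * Real.cos x) := by
  have dsinh : ∀ y x : ℝ, HasDerivAt (fun x => Real.sinh (x + y)) (Real.cosh (x + y)) x :=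
    fun y x => (Real.hasDerivAt_sinh _).comp_add_const x y
  have dcosh : ∀ y x : ℝ, HasDerivAt (fun x => Real.cosh (x + y)) (Real.sinh (x + y)) x :=
    fun y x => (Real.hasDerivAt_cosh _).comp_add_const x y
  have dsin : ∀ y x : ℝ, HasDerivAt (fun x => Real.sin (x + y)) (Real.cos (x + y)) x :=
    fun y x => (Real.hasDerivAt_sin _).comp_add_const x y
  have dcos : ∀ y x : ℝ, HasDerivAt (fun x => Real.cos (x + y)) (-Real.sin (x + y)) x :=
    fun y x => (Real.hasDerivAt_cos _).comp_add_const x y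
  have d1 : ∀ y, 0 ≤ y → ∀ x, 0 ≤ x → 0 ≤ 3 * (Real.sinh (x + y) + Real.sin (x + y))
      + Real.cosh x * Real.sin y - Real.sinh x * Real.cos y + Real.sinh y * Real.cos x
      - Real.cosh y * Real.sin x := by
    intro y hy x hx
    refine nonneg_of_hasDerivAt (f := fun x => 3 * (Real.sinh (x + y) + Real.sin (x + y))
      + Real.cosh x * Real.sin y - Real.sinh x * Real.cos y + Real.sinh y * Real.cos x
      - Real.cosh y * Real.sin x) ?_ (fun x => (((((dsinh y x).add (dsin y x)).const_mul 3).add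
      ((Real.hasDerivAt_cosh x).mul_const _)).sub ((Real.hasDerivAt_sinh x).mul_const _)).add
      ((Real.hasDerivAt_cos x).const_mul _) |>.sub ((Real.hasDerivAt_sin x).const_mul _))
      (fun x hx => ?_) hx
    · have := abs_le.1 (abs_sin_le_sinh hy)
      simp
      linarith
    · have := hyperbolic_aux hx hy
      linarith
  have d2 : ∀ y, 0 ≤ y → ∀ x, 0 ≤ x → 0 ≤ 3 * (Real.cosh (x + y) - Real.cos (x + y))
      + Real.sinh x * Real.sin y - Real.cosh x * Real.cos y + Real.sinh y * Real.sin x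
      + Real.cosh y * Real.cos x := by
    intro y hy x hx
    refine nonneg_of_hasDerivAt (f := fun x => 3 * (Real.cosh (x + y) - Real.cos (x + y))
      + Real.sinh x * Real.sin y - Real.cosh x * Real.cos y + Real.sinh y * Real.sin x
      + Real.cosh y * Real.cos x) ?_ (fun x => (((((dcosh y x).sub (dcos y x)).const_mul 3).add
      ((Real.hasDerivAt_sinh x).mul_const _)).sub ((Real.hasDerivAt_cosh x).mul_const _)).add
      ((Real.hasDerivAt_sin x).const_mul _) |>.add ((Real.hasDerivAt_cos x).const_mul _))
      (fun x hx => ?_) hx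
    · have h1 := Real.one_le_cosh y
      have h2 := Real.cos_le_one y
      simp
      linarith
    · have := d1 y hy x hx
      linarith
  have d3 : ∀ y, 0 ≤ y → ∀ x, 0 ≤ x → 0 ≤ 3 * (Real.sinh (x + y) - Real.sin (x + y))
      + Real.cosh x * Real.sin y - Real.sinh x * Real.cos y - Real.sinh y * Real.cos x
      + Real.cosh y * Real.sin x := by
    intro y hy x hx
    refine nonneg_of_hasDerivAt (f := fun x => 3 * (Real.sinh (x + y) - Real.sin (x + y))
      + Real.cosh x * Real.sin y - Real.sinh x * Real.cos y - Real.sinh y * Real.cos x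
      + Real.cosh y * Real.sin x) ?_ (fun x => (((((dsinh y x).sub (dsin y x)).const_mul 3).add
      ((Real.hasDerivAt_cosh x).mul_const _)).sub ((Real.hasDerivAt_sinh x).mul_const _)).sub
      ((Real.hasDerivAt_cos x).const_mul _) |>.add ((Real.hasDerivAt_sin x).const_mul _))
      (fun x hx => ?_) hx
    · have := abs_le.1 (abs_sin_le_sinh hy)
      simp
      linarith
    · have := d2 y hy x hx
      linarith
  have d4 : ∀ y, 0 ≤ y → ∀ x, 0 ≤ x → 0 ≤ 3 * (Real.cosh (x + y) + Real.cos (x + y))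
      - 2 * (Real.cosh y + Real.cos y) + Real.sinh x * Real.sin y - Real.cosh x * Real.cos y
      - Real.sinh y * Real.sin x - Real.cosh y * Real.cos x := by
    intro y hy x hx
    refine nonneg_of_hasDerivAt (f := fun x => 3 * (Real.cosh (x + y) + Real.cos (x + y))
      - 2 * (Real.cosh y + Real.cos y) + Real.sinh x * Real.sin y - Real.cosh x * Real.cos y
      - Real.sinh y * Real.sin x - Real.cosh y * Real.cos x) ?_
      (fun x => ((((((dcosh y x).add (dcos y x)).const_mul 3).sub_const _).add
      ((Real.hasDerivAt_sinh x).mul_const _)).sub ((Real.hasDerivAt_cosh x).mul_const _)).sub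
      ((Real.hasDerivAt_sin x).const_mul _) |>.sub ((Real.hasDerivAt_cos x).const_mul _))
      (fun x hx => ?_) hx
    · simp
      linarith
    · have := d3 y hy x hx
      linarith
  have h5 := nonneg_of_hasDerivAt (f := fun y => 3 * (Real.sinh (y + x) + Real.sin (y + x))
      - 2 * (Real.sinh x + Real.sin x) - 2 * (Real.sinh y + Real.sin y)
      - (Real.sinh x * Real.cos y + Real.cosh x * Real.sin y
        + Real.cosh y * Real.sin x + Real.sinh y * Real.cos x)) ?_
      (fun y => (((((dsinh x y).add (dsin x y)).const_mul 3).sub_const _).sub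
      (((Real.hasDerivAt_sinh y).add (Real.hasDerivAt_sin y)).const_mul 2)).sub
      (((((Real.hasDerivAt_cos y).const_mul _).add ((Real.hasDerivAt_sin y).const_mul _)).add
      ((Real.hasDerivAt_cosh y).mul_const _)).add ((Real.hasDerivAt_sinh y).mul_const _)))
      (fun y hy => ?_) hy
  · rw [add_comm x y]
    exact h5
  · simp
    linarith
  · have := d4 y hy x hx
    rw [add_comm x y] at this
    linarith

/-- This is `add_hyperbolic_nonneg` at 2x, 2y after the double angle formulas. -/
theorem end_point_inequality {x y : ℝ} (hx : 0 ≤ x) (hy : 0 ≤ y) :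
    (Real.cosh x ^ 2 + Real.cos x ^ 2) / 2 * (Real.sinh y * Real.cosh y + Real.sin y * Real.cos y)
      + (Real.cosh y ^ 2 + Real.cos y ^ 2) / 2
        * (Real.sinh x * Real.cosh x + Real.sin x * Real.cos x)
      ≤ Real.sinh (x + y) * Real.cosh (x + y) + Real.sin (x + y) * Real.cos (x + y) := by
  have h := add_hyperbolic_nonneg (x := 2 * x) (y := 2 * y) (by linarith) (by linarith)
  have c1 : ∀ z, Real.cosh z ^ 2 = (Real.cosh (2 * z) + 1) / 2 := fun z => by
    have h1 := Real.cosh_two_mul z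
    have h2 := Real.cosh_sq z
    linarith
  have c2 : ∀ z, Real.cos z ^ 2 = (Real.cos (2 * z) + 1) / 2 := fun z => by
    have h1 := Real.cos_two_mul z
    linarith
  have s1 : ∀ z, Real.sinh z * Real.cosh z = Real.sinh (2 * z) / 2 := fun z => by
    have h1 := Real.sinh_two_mul z
    linarith
  have s2 : ∀ z, Real.sin z * Real.cos z = Real.sin (2 * z) / 2 := fun z => by
    have h1 := Real.sin_two_mul z
    linarith
  rw [c1, c1, c2, c2, s1, s1, s2, s2, s1, s2, mul_add 2 x y]
  rw [Real.sinh_add (2 * x) (2 * y), Real.sin_add (2 * x) (2 * y)] at h ⊢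
  linarith

/-! ### Explicit solutions for r = 2, k = 1. -/

/-- The solution `a (cosh x sin x - sinh x cos x) + b sinh x sin x` of `z'''' = -4 z` and its
derivatives of order up to `4`. -/
noncomputable def beam (a b : ℝ) : ℕ → ℝ → ℝ
  | 0, x => a * (Real.cosh x * Real.sin x - Real.sinh x * Real.cos x)
      + b * (Real.sinh x * Real.sin x)
  | 1, x => 2 * a * (Real.sinh x * Real.sin x)
      + b * (Real.cosh x * Real.sin x + Real.sinh x * Real.cos x)
  | 2, x => 2 * a * (Real.cosh x * Real.sin x + Real.sinh x * Real.cos x)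
      + 2 * b * (Real.cosh x * Real.cos x)
  | 3, x => 4 * a * (Real.cosh x * Real.cos x)
      - 2 * b * (Real.cosh x * Real.sin x - Real.sinh x * Real.cos x)
  | _, x => -4 * (a * (Real.cosh x * Real.sin x - Real.sinh x * Real.cos x)
      + b * (Real.sinh x * Real.sin x))

theorem isChain_beam (a b : ℝ) {c d : ℝ} (h : c ≤ d) : IsChain 4 c d (beam a b) := by
  have hs := Real.hasDerivAt_sin
  have hc := Real.hasDerivAt_cos
  have hsh := Real.hasDerivAt_sinh
  have hch := Real.hasDerivAt_cosh
  refine IsChain.of_hasDerivAt h (fun j hj x => ?_) ?_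
  · have dA := ((hch x).mul (hs x)).sub ((hsh x).mul (hc x))
    have dP := ((hch x).mul (hs x)).add ((hsh x).mul (hc x))
    have dS := (hsh x).mul (hs x)
    have dC := (hch x).mul (hc x)
    interval_cases j
    · refine ((dA.const_mul a).add (dS.const_mul b)).congr_deriv ?_
      simp only [beam]; ring
    · refine ((dS.const_mul (2 * a)).add (dP.const_mul b)).congr_deriv ?_
      simp only [beam]; ring
    · refine ((dP.const_mul (2 * a)).add (dC.const_mul (2 * b))).congr_deriv ?_
      simp only [beam]; ring
    · refine ((dC.const_mul (4 * a)).sub (dA.const_mul (2 * b))).congr_deriv ?_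
      simp only [beam]; ring
  · change Continuous fun x => -4 * (a * (Real.cosh x * Real.sin x - Real.sinh x * Real.cos x)
      + b * (Real.sinh x * Real.sin x))
    fun_prop

theorem beam_zero_zero (a b : ℝ) : beam a b 0 0 = 0 := by simp [beam]

theorem beam_one_zero (a b : ℝ) : beam a b 1 0 = 0 := by simp [beam]

/-- `sinh x cosh x + sin x cos x`. -/
noncomputable def beamE (x : ℝ) : ℝ := Real.sinh x * Real.cosh x + Real.sin x * Real.cos x

/-- `(sinh² x + sin² x) / 2`. -/
noncomputable def beamJ (x : ℝ) : ℝ := (Real.sinh x ^ 2 + Real.sin x ^ 2) / 2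

/-- `(sinh² x - sin² x) / 2`. -/
noncomputable def beamN (x : ℝ) : ℝ := (Real.sinh x ^ 2 - Real.sin x ^ 2) / 2

/-- `(cosh² x + cos² x) / 2`. -/
noncomputable def beamQ (x : ℝ) : ℝ := (Real.cosh x ^ 2 + Real.cos x ^ 2) / 2

theorem beamE_pos {x : ℝ} (hx : 0 < x) : 0 < beamE x := by
  have h1 : beamE x = (Real.sinh (2 * x) + Real.sin (2 * x)) / 2 := by
    rw [beamE, Real.sinh_two_mul, Real.sin_two_mul]; ring
  have h2 : 2 * x < Real.sinh (2 * x) := Real.self_lt_sinh_iff.2 (by linarith)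
  have h3 := abs_le.1 (Real.abs_sin_le_abs (x := 2 * x))
  rw [abs_of_pos (by linarith : 0 < 2 * x)] at h3
  rw [h1]
  linarith

theorem beamN_pos {x : ℝ} (hx : 0 < x) : 0 < beamN x := by
  have h2 : x < Real.sinh x := Real.self_lt_sinh_iff.2 hx
  have h3 := Real.abs_sin_le_abs (x := x)
  rw [abs_of_pos hx] at h3
  have h4 : |Real.sin x| ^ 2 < Real.sinh x ^ 2 :=
    pow_lt_pow_left₀ (h3.trans_lt h2) (abs_nonneg _) two_ne_zero
  rw [sq_abs] at h4
  rw [beamN]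
  linarith

/-- The solution with prescribed values `m` and `2 * κ` of the first and third derivative. -/
theorem exists_beam {x : ℝ} (hx : 0 < x) (m κ : ℝ) : ∃ a b, beam a b 1 x = m ∧
    beam a b 3 x = 2 * κ ∧ beamE x * beam a b 0 x = beamJ x * m - beamN x * κ ∧
    beamE x * beam a b 2 x = 2 * (beamQ x * m + beamJ x * κ) := by
  have he := beamE_pos hx
  have h1 := Real.cosh_sq x
  have h2 := Real.cos_sq' x
  set s := Real.sin x
  set c := Real.cos x
  set p := Real.sinh x
  set q := Real.cosh x
  have e : beamE x = p * q + s * c := rfl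
  have ee : p * s * (q * s - p * c) + (q * s + p * c) * (q * c) = p * q + s * c := by
    linear_combination p * q * h2 + s * c * h1
  refine ⟨((q * s - p * c) * m + (q * s + p * c) * κ) / (2 * beamE x),
    (q * c * m - p * s * κ) / beamE x, ?_, ?_, ?_, ?_⟩
  · simp only [beam]
    field_simp
    rw [e]
    linear_combination m * ee
  · simp only [beam]
    field_simp
    rw [e]
    linear_combination 4 * κ * ee
  · simp only [beam, beamJ, beamN]
    field_simp
    linear_combination (m * s ^ 2 + κ * s ^ 2) * h1 + (m * p ^ 2 - κ * p ^ 2) * h2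
  · simp only [beam, beamJ, beamQ]
    field_simp
    linear_combination (m * c ^ 2 + κ * s ^ 2) * h1 + (m * q ^ 2 + κ * p ^ 2) * h2

/-- This evaluates the determinant of the 2 × 2 system for the common first and third derivatives of
the two pieces at the jump. -/
theorem beam_identity (x y : ℝ) :
    (beamJ x * beamE y + beamJ y * beamE x) ^ 2
      + (beamN x * beamE y + beamN y * beamE x) * (beamQ x * beamE y + beamQ y * beamE x)
      = beamE x * beamE y * beamN (x + y) := by
  have key : ∀ z, beamJ z ^ 2 + beamN z * beamQ z
      = beamE z * (Real.sinh z * Real.cosh z - Real.sin z * Real.cos z) / 2 := by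
    intro z
    have h1 := Real.cosh_sq z
    have h2 := Real.cos_sq' z
    simp only [beamJ, beamN, beamQ, beamE]
    linear_combination ((Real.sinh z ^ 2 - Real.sin z ^ 2) / 4 - Real.sinh z ^ 2 / 2) * h1
      + ((Real.sinh z ^ 2 - Real.sin z ^ 2) / 4 + Real.sin z ^ 2 / 2) * h2
  have cross : beamE y * (Real.sinh x * Real.cosh x - Real.sin x * Real.cos x) / 2
      + beamE x * (Real.sinh y * Real.cosh y - Real.sin y * Real.cos y) / 2
      + (beamN x * beamQ y + beamN y * beamQ x + 2 * (beamJ x * beamJ y)) = beamN (x + y) := by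
    have h1 := Real.cosh_sq x
    have h2 := Real.cos_sq' x
    have k1 := Real.cosh_sq y
    have k2 := Real.cos_sq' y
    simp only [beamJ, beamN, beamQ, beamE, Real.sinh_add, Real.sin_add]
    linear_combination
      ((Real.sinh x ^ 2 - Real.sin x ^ 2) / 4 - Real.sinh x ^ 2 / 2) * k1
      + ((Real.sinh x ^ 2 - Real.sin x ^ 2) / 4 + Real.sin x ^ 2 / 2) * k2
      + ((Real.sinh y ^ 2 - Real.sin y ^ 2) / 4 - Real.sinh y ^ 2 / 2) * h1
      + ((Real.sinh y ^ 2 - Real.sin y ^ 2) / 4 + Real.sin y ^ 2 / 2) * h2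
  linear_combination beamE y ^ 2 * key x + beamE x ^ 2 * key y + beamE x * beamE y * cross

theorem jumpSol_inner {ω t : ℝ} (hω : 0 < ω) (ht : t ∈ Ioo (-1 : ℝ) 1) :
    ∃ V W, JumpSol 2 1 (4 * ω ^ 4) t V W ∧ V 3 t = ω ^ 3 * (2 *
      ((beamQ (ω * (1 + t)) * beamE (ω * (1 - t)) + beamQ (ω * (1 - t)) * beamE (ω * (1 + t)))
        / beamN (2 * ω))) := by
  set α := ω * (1 + t) with hα
  set β := ω * (1 - t) with hβ
  have hα0 : 0 < α := mul_pos hω (by linarith [ht.1])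
  have hβ0 : 0 < β := mul_pos hω (by linarith [ht.2])
  have hαβ : α + β = 2 * ω := by rw [hα, hβ]; ring
  have eα := beamE_pos hα0
  have eβ := beamE_pos hβ0
  have hN := beamN_pos (by linarith : 0 < 2 * ω)
  have hid := beam_identity α β
  rw [hαβ] at hid
  -- κ and m solve, by Cramer's rule, the two conditions at t: value jump 1 (`j0`) and no jump of
  -- the second derivative (`j2`).
  set κ := (beamQ α * beamE β + beamQ β * beamE α) / beamN (2 * ω) with hκ
  set m := -(beamJ α * beamE β + beamJ β * beamE α) / beamN (2 * ω) with hm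
  obtain ⟨a, b, a1, a3, a0, a2⟩ := exists_beam hα0 m κ
  obtain ⟨c, d, c1, c3, c0, c2⟩ := exists_beam hβ0 m κ
  have j0 : beam a b 0 α + beam c d 0 β = -1 := by
    have : beamE α * beamE β * (beam a b 0 α + beam c d 0 β) = beamE α * beamE β * (-1) := by
      have e : beamE α * beamE β * (beam a b 0 α + beam c d 0 β)
          = (beamJ α * m - beamN α * κ) * beamE β + (beamJ β * m - beamN β * κ) * beamE α := by
        linear_combination beamE β * a0 + beamE α * c0
      rw [e, hm, hκ]
      field_simp
      linear_combination -hid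
    exact mul_left_cancel₀ (mul_pos eα eβ).ne' this
  have j2 : beam a b 2 α + beam c d 2 β = 0 := by
    have : beamE α * beamE β * (beam a b 2 α + beam c d 2 β) = beamE α * beamE β * 0 := by
      have e : beamE α * beamE β * (beam a b 2 α + beam c d 2 β)
          = 2 * (beamQ α * m + beamJ α * κ) * beamE β
            + 2 * (beamQ β * m + beamJ β * κ) * beamE α := by
        linear_combination beamE β * a2 + beamE α * c2
      rw [e, hm, hκ]
      field_simp
      ring
    exact mul_left_cancel₀ (mul_pos eα eβ).ne' this
  -- The right piece is a reflected beam with the opposite sign, so odd derivatives match at t as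
  -- soon as the data m, κ coincide.
  refine ⟨fun s x => ω ^ s * beam a b s (ω * x + ω),
    fun s x => -1 * ((-ω) ^ s * beam c d s (-ω * x + ω)), ⟨?_, ?_, ?_, ?_, ?_, ?_, ?_⟩, ?_⟩
  · exact (isChain_beam a b (c := 0) (d := α) hα0.le).comp_affine hω.ne' (by
      rw [show ω * -1 + ω = 0 by ring]; exact left_mem_Icc.2 hα0.le) (by
      rw [show ω * t + ω = α by rw [hα]; ring]; exact right_mem_Icc.2 hα0.le)
  · intro s hs
    exact ((isChain_beam c d (c := 0) (d := β) hβ0.le).comp_affine (neg_ne_zero.2 hω.ne') (by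
      rw [show -ω * t + ω = β by rw [hβ]; ring]; exact right_mem_Icc.2 hβ0.le) (by
      rw [show -ω * 1 + ω = 0 by ring]; exact left_mem_Icc.2 hβ0.le) s hs).const_mul (-1)
  · intro s hs
    have e : ω * -1 + ω = 0 := by ring
    interval_cases s
    · simp only [e, beam_zero_zero, mul_zero]
    · simp only [e, beam_one_zero, mul_zero]
  · intro s hs
    have e : -ω * 1 + ω = 0 := by ring
    interval_cases s
    · simp only [e, beam_zero_zero, mul_zero]
    · simp only [e, beam_one_zero, mul_zero]
  · intro s hs
    have e1 : ω * t + ω = α := by rw [hα]; ring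
    have e2 : -ω * t + ω = β := by rw [hβ]; ring
    simp only [e1, e2]
    have hs : s < 4 := hs
    interval_cases s
    · simp [datum]; linarith
    · simp [datum, a1, c1]
    · simp [datum]; linear_combination (-ω ^ 2) * j2
    · simp only [a3, c3]; norm_num [datum]; ring
  · intro x _
    simp only [beam]; ring
  · intro x _
    simp only [beam]; ring
  · change ω ^ 3 * beam a b 3 (ω * t + ω) = _
    rw [show ω * t + ω = α by rw [hα]; ring, a3]

theorem jumpSol_left {ω : ℝ} (hω : 0 < ω) :
    ∃ V W, JumpSol 2 1 (4 * ω ^ 4) (-1) V W ∧ V 3 (-1) = ω ^ 3 * (2 *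
      (beamE (2 * ω) / beamN (2 * ω))) := by
  have hβ0 : 0 < 2 * ω := by linarith
  have eβ := beamE_pos hβ0
  have hN := beamN_pos hβ0
  set κ := beamE (2 * ω) / beamN (2 * ω) with hκ
  -- First derivative 0 at -1 is the boundary condition; κ is chosen so that u(-1) = 1.
  obtain ⟨c, d, c1, c3, c0, c2⟩ := exists_beam hβ0 0 κ
  have c0' : beam c d 0 (2 * ω) = -1 := by
    refine mul_left_cancel₀ eβ.ne' ?_
    rw [c0, hκ]
    field_simp
    ring
  have e1 : -ω * (-1) + ω = 2 * ω := by ring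
  have e2 : -ω * 1 + ω = 0 := by ring
  refine ⟨fun s _ => -1 * ((-ω) ^ s * beam c d s (-ω * (-1) + ω)) - datum 2 1 s,
    fun s x => -1 * ((-ω) ^ s * beam c d s (-ω * x + ω)),
    ⟨isChain_degenerate _ _ _, ?_, ?_, ?_, ?_, ?_, ?_⟩, ?_⟩
  · intro s hs
    exact ((isChain_beam c d (c := 0) (d := 2 * ω) hβ0.le).comp_affine (neg_ne_zero.2 hω.ne') (by
      rw [e1]; exact right_mem_Icc.2 hβ0.le) (by
      rw [e2]; exact left_mem_Icc.2 hβ0.le) s hs).const_mul (-1)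
  · intro s hs
    simp only [e1]
    interval_cases s
    · simp [datum, c0']
    · simp [datum, c1]
  · intro s hs
    interval_cases s
    · simp only [e2, beam_zero_zero, mul_zero]
    · simp only [e2, beam_one_zero, mul_zero]
  · intro s _
    ring
  · intro x hx
    exact absurd (hx.1.trans hx.2) (lt_irrefl _)
  · intro x _
    simp only [beam]; ring
  · simp only [e1, c3]
    norm_num [datum]
    ring

/-! ### Comparison of energies with the end point. -/

theorem JumpSol.apply_self {r k : ℕ} {l t : ℝ} {V W : ℕ → ℝ → ℝ} (h : JumpSol r k l t V W)
    (hr : 1 ≤ r) (hk : k < r) (ht : t ∈ Icc (-1 : ℝ) 1) (hl : 0 ≤ l) {x : Sob r} {w : L2}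
    (hx : Extremal (fnMap r) (derMap r) (evalMap r k t) l x w) :
    ‖fnMap r x‖ ^ 2 + l * ‖w‖ ^ 2 = V (r + k) t := by
  have he := h.extremal hr hk ht
  obtain ⟨h1, h2⟩ := hx.unique (by positivity) (exists_derMap_eq r) he hl
  rw [h1, h2, ← he.apply_self]
  change glue t (V (r + k)) (W (r + k)) t = _
  simp [glue]

/-- Both energies are third derivatives of explicit solutions with the same denominator `beamN (2 *
ω)`; the numerators are compared by `end_point_inequality`. Writing l = 4ω⁴ reduces the equation to
z'''' = -4z. -/
theorem energy_le_one_inner {l t : ℝ} (hl : 0 < l) (ht : t ∈ Ioo (-1 : ℝ) 1) {x x' : Sob 2}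
    {w w' : L2} (hx : Extremal (fnMap 2) (derMap 2) (evalMap 2 1 t) l x w)
    (hx' : Extremal (fnMap 2) (derMap 2) (evalMap 2 1 (-1)) l x' w') :
    ‖fnMap 2 x‖ ^ 2 + l * ‖w‖ ^ 2 ≤ ‖fnMap 2 x'‖ ^ 2 + l * ‖w'‖ ^ 2 := by
  obtain ⟨ω, hω, rfl⟩ : ∃ ω : ℝ, 0 < ω ∧ l = 4 * ω ^ 4 := by
    refine ⟨√(√(l / 4)), by positivity, ?_⟩
    have h1 := Real.sq_sqrt (by positivity : 0 ≤ √(l / 4))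
    have h2 := Real.sq_sqrt (by positivity : 0 ≤ l / 4)
    rw [show √√(l / 4) ^ 4 = (√√(l / 4) ^ 2) ^ 2 by ring, h1, h2]
    ring
  obtain ⟨V, W, h, hV⟩ := jumpSol_inner hω ht
  obtain ⟨V', W', h', hV'⟩ := jumpSol_left hω
  rw [h.apply_self (by norm_num) (by norm_num) (Ioo_subset_Icc_self ht) hl.le hx,
    h'.apply_self (by norm_num) (by norm_num) (by norm_num) hl.le hx', hV, hV']
  have hN := beamN_pos (by linarith : 0 < 2 * ω)
  have := end_point_inequality (x := ω * (1 + t)) (y := ω * (1 - t))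
    (mul_nonneg hω.le (by linarith [ht.1])) (mul_nonneg hω.le (by linarith [ht.2]))
  rw [show ω * (1 + t) + ω * (1 - t) = 2 * ω by ring] at this
  gcongr
  exact this

/-- For every parameter the energy of the extremal pair is largest at the end point `-1`. -/
theorem energy_le {r k : ℕ} (hrk : (r = 1 ∧ k = 0) ∨ (r = 2 ∧ (k = 0 ∨ k = 1))) {l t : ℝ}
    (hl : 0 < l) (ht : t ∈ Icc (-1 : ℝ) 1) {x x' : Sob r} {w w' : L2}
    (hx : Extremal (fnMap r) (derMap r) (evalMap r k t) l x w)
    (hx' : Extremal (fnMap r) (derMap r) (evalMap r k (-1)) l x' w') :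
    ‖fnMap r x‖ ^ 2 + l * ‖w‖ ^ 2 ≤ ‖fnMap r x'‖ ^ 2 + l * ‖w'‖ ^ 2 := by
  have hr : 1 ≤ r := by omega
  rcases (by omega : k = 0 ∨ (r = 2 ∧ k = 1)) with rfl | ⟨rfl, rfl⟩
  · exact hx.le_of_sq_le hl (by positivity) (sq_evalMap_zero_le hr hl hx'.rep ht x)
  rcases ht.1.eq_or_lt with rfl | h1
  · obtain ⟨h1, h2⟩ := hx.unique (by positivity) (exists_derMap_eq 2) hx' hl.le
    rw [h1, h2]
  rcases ht.2.eq_or_lt with rfl | h2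
  · exact hx.le_of_sq_le hl (by positivity) (sq_evalMap_one_le hr hl hx'.rep x)
  · exact energy_le_one_inner hl ⟨h1, h2⟩ hx hx'

/-! ### Dependence on the parameter and on the point. -/

theorem exists_extremal {r k : ℕ} (hr : 1 ≤ r) (hk : k < r) {l t : ℝ} (hl : 0 ≤ l)
    (ht : t ∈ Icc (-1 : ℝ) 1) :
    ∃ x w, Extremal (fnMap r) (derMap r) (evalMap r k t) l x w := by
  obtain ⟨V, W, h, -, -⟩ := exists_jumpSol (k := k) hr hl ht
  exact ⟨_, _, h.extremal hr hk ht⟩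

/-- Point evaluation is Hölder continuous of order 1/2 in the graph norm. For k + 1 = r this is
Cauchy–Schwarz; for r = 2, k = 0 the first derivative is bounded uniformly by means of a
representation of f'(-1). -/
theorem exists_closeBy {r k : ℕ} (hrk : (r = 1 ∧ k = 0) ∨ (r = 2 ∧ (k = 0 ∨ k = 1))) :
    ∃ C : ℝ, 0 ≤ C ∧ ∀ t ∈ Icc (-1 : ℝ) 1, ∀ t' ∈ Icc (-1 : ℝ) 1,
      CloseBy (fnMap r) (derMap r) (evalMap r k t) (evalMap r k t') (C * √|t - t'|) := by
  rcases (by omega : k + 1 = r ∨ (r = 2 ∧ k = 0)) with hk | ⟨rfl, rfl⟩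
  · refine ⟨1, zero_le_one, fun t ht t' ht' F => (abs_evalMap_sub_le hk ht ht' F).trans ?_⟩
    rw [one_mul]
    gcongr
    linarith [norm_nonneg (fnMap r F)]
  · obtain ⟨x, w, h⟩ := exists_extremal (r := 2) (k := 1) (by norm_num) (by norm_num) le_rfl
      (t := -1) (by norm_num)
    set D := ‖fnMap 2 x‖ + ‖w‖ + √2 with hD
    refine ⟨D * √2, by positivity, fun t ht t' ht' F => ?_⟩
    have hb : ∀ y ∈ Icc (-1 : ℝ) 1, ‖F.1 1 y‖ ≤ D * (‖fnMap 2 F‖ + ‖derMap 2 F‖) := by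
      intro y hy
      have h1 := abs_evalMap_sub_le (k := 1) rfl hy (left_mem_Icc.2 (by norm_num)) F
      have h2 := h.rep.abs_le F
      have h3 : √|y - -1| ≤ √2 := by
        gcongr
        rw [abs_le]
        constructor <;> linarith [hy.1, hy.2]
      have h4 : √|y - -1| * ‖derMap 2 F‖ ≤ √2 * ‖derMap 2 F‖ := by gcongr
      have h5 : |F.1 1 y| ≤ |F.1 1 (-1)| + |F.1 1 y - F.1 1 (-1)| := by
        have := abs_add_le (F.1 1 (-1)) (F.1 1 y - F.1 1 (-1))
        rwa [add_sub_cancel] at this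
      change |F.1 1 y - F.1 1 (-1)| ≤ _ at h1
      change |F.1 1 (-1)| ≤ _ at h2
      rw [Real.norm_eq_abs, hD]
      have := norm_nonneg (fnMap 2 F)
      have := norm_nonneg (derMap 2 F)
      have := norm_nonneg (fnMap 2 x)
      have := norm_nonneg w
      have := Real.sqrt_nonneg 2
      nlinarith [mul_nonneg (norm_nonneg (fnMap 2 x)) (norm_nonneg (derMap 2 F)),
        mul_nonneg (norm_nonneg w) (norm_nonneg (fnMap 2 F)),
        mul_nonneg (Real.sqrt_nonneg 2) (norm_nonneg (fnMap 2 F))]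
    have h1 := (F.2.1 0 (by norm_num)).integral_eq ht' ht
    change |F.1 0 t - F.1 0 t'| ≤ _
    rw [← h1, ← Real.norm_eq_abs]
    refine (intervalIntegral.norm_integral_le_of_norm_le_const (fun y hy => hb y ?_)).trans ?_
    · exact uIcc_subset_Icc ht' ht (uIoc_subset_uIcc hy)
    · have h2 : |t - t'| ≤ √2 * √|t - t'| := by
        have h3 : √|t - t'| ≤ √2 := by
          gcongr
          rw [abs_le]
          constructor <;> linarith [ht.1, ht.2, ht'.1, ht'.2]
        calc |t - t'| = √|t - t'| * √|t - t'| := (Real.mul_self_sqrt (abs_nonneg _)).symm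
          _ ≤ _ := by gcongr
      calc D * (‖fnMap 2 F‖ + ‖derMap 2 F‖) * |t - t'|
          ≤ D * (‖fnMap 2 F‖ + ‖derMap 2 F‖) * (√2 * √|t - t'|) := by gcongr
        _ = _ := by ring

variable {r k : ℕ}

/-- Joint continuity of the extremal pairs. -/
theorem tendsto_extremal (hrk : (r = 1 ∧ k = 0) ∨ (r = 2 ∧ (k = 0 ∨ k = 1)))
    {ι : Type*} {𝓕 : Filter ι} {ls ts : ι → ℝ} {xs : ι → Sob r} {ws : ι → L2} {l t : ℝ}
    {x : Sob r} {w : L2} (ht : t ∈ Icc (-1 : ℝ) 1)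
    (h : Extremal (fnMap r) (derMap r) (evalMap r k t) l x w)
    (hs : ∀ᶠ i in 𝓕, 0 ≤ ls i ∧ ts i ∈ Icc (-1 : ℝ) 1 ∧
      Extremal (fnMap r) (derMap r) (evalMap r k (ts i)) (ls i) (xs i) (ws i))
    (hl : Tendsto ls 𝓕 (𝓝 l)) (htt : Tendsto ts 𝓕 (𝓝 t)) :
    Tendsto (fun i => fnMap r (xs i)) 𝓕 (𝓝 (fnMap r x)) ∧ Tendsto ws 𝓕 (𝓝 w) := by
  obtain ⟨C, hC, hc⟩ := exists_closeBy hrk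
  refine Extremal.tendsto (ηs := fun i => C * √|ts i - t|) (by positivity) (exists_derMap_eq r)
    (hs.mono fun i hi => hi.2.2) (hs.mono fun i hi => hi.1) h hl ?_
    (hs.mono fun i hi => ⟨by positivity, hc _ hi.2.1 _ ht⟩)
  have := ((htt.sub_const t).abs.sqrt).const_mul C
  simpa using this

/-- Strict monotonicity in the parameter. -/
theorem norm_fnMap_lt (hrk : (r = 1 ∧ k = 0) ∨ (r = 2 ∧ (k = 0 ∨ k = 1))) {l l' t : ℝ}
    {x x' : Sob r} {w w' : L2}
    (h : Extremal (fnMap r) (derMap r) (evalMap r k t) l x w)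
    (h' : Extremal (fnMap r) (derMap r) (evalMap r k t) l' x' w') (hl : 0 ≤ l) (hll : l < l') :
    ‖fnMap r x‖ < ‖fnMap r x'‖ :=
  Extremal.norm_lt_norm (by positivity) (exists_derMap_eq r)
    (derMap_eq_zero (by omega)) (exists_evalMap_eq_one r (by omega) t) h h' hl hll

theorem param_unique (hrk : (r = 1 ∧ k = 0) ∨ (r = 2 ∧ (k = 0 ∨ k = 1))) {l l' t : ℝ}
    {x x' : Sob r} {w w' : L2}
    (h : Extremal (fnMap r) (derMap r) (evalMap r k t) l x w)
    (h' : Extremal (fnMap r) (derMap r) (evalMap r k t) l' x' w') (hl : 0 ≤ l) (hl' : 0 ≤ l')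
    (hn : ‖fnMap r x‖ = ‖fnMap r x'‖) : l = l' := by
  rcases lt_trichotomy l l' with h1 | h1 | h1
  · exact absurd hn (norm_fnMap_lt hrk h h' hl h1).ne
  · exact h1
  · exact absurd hn (norm_fnMap_lt hrk h' h hl' h1).ne'

/-- Intermediate value theorem in l: the norm starts at or below N by `hN`, depends continuously on
l, and eventually exceeds N by `Extremal.exists_lt_norm`. -/
theorem exists_param (hrk : (r = 1 ∧ k = 0) ∨ (r = 2 ∧ (k = 0 ∨ k = 1))) {t N : ℝ}
    (ht : t ∈ Icc (-1 : ℝ) 1)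
    (hN : ∀ x w, Extremal (fnMap r) (derMap r) (evalMap r k t) 0 x w → ‖fnMap r x‖ ≤ N) :
    ∃ l ≥ 0, ∃ x w, Extremal (fnMap r) (derMap r) (evalMap r k t) l x w ∧ ‖fnMap r x‖ = N := by
  have hE : ∀ l : ℝ, ∃ x w, 0 ≤ l → Extremal (fnMap r) (derMap r) (evalMap r k t) l x w := by
    intro l
    by_cases hl : 0 ≤ l
    · obtain ⟨x, w, h⟩ := exists_extremal (r := r) (k := k) (by omega) (by omega) hl ht
      exact ⟨x, w, fun _ => h⟩
    · exact ⟨0, 0, fun h => absurd h hl⟩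
  choose x w hE using hE
  obtain ⟨x₀, w₀, h₀⟩ := exists_extremal (r := r) (k := k) (by omega) (by omega) le_rfl
    (t := -1) (by norm_num)
  obtain ⟨L, hL, hL'⟩ := Extremal.exists_lt_norm (ℓ := evalMap r k t)
    (exists_evalMap_eq_one r (by omega) t)
    (fun η hη => exists_interpolation (by omega) (by omega) h₀.rep ht hη) N
  have hc : ContinuousOn (fun l => ‖fnMap r (x l)‖) (Icc 0 L) := by
    intro l hl
    refine (tendsto_extremal hrk ht (hE l hl.1) (ts := fun _ => t) (ls := id) (ws := w) ?_
      (tendsto_id.mono_left nhdsWithin_le_nhds) tendsto_const_nhds).1.norm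
    filter_upwards [self_mem_nhdsWithin] with m hm
    exact ⟨hm.1, ht, hE m hm.1⟩
  obtain ⟨l, hl, hlN⟩ := intermediate_value_Icc hL hc
    ⟨hN _ _ (hE 0 le_rfl), (hL' _ _ (hE L hL)).le⟩
  exact ⟨l, hl.1, x l, w l, hE l hl.1, hlN⟩

/-- The parameter and the extremal function of a given norm depend continuously on the point. -/
theorem continuousOn_fnMap (hrk : (r = 1 ∧ k = 0) ∨ (r = 2 ∧ (k = 0 ∨ k = 1))) {N : ℝ}
    {l : ℝ → ℝ} {x : ℝ → Sob r} {w : ℝ → L2} (hl : ∀ t ∈ Icc (-1 : ℝ) 1, 0 ≤ l t)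
    (h : ∀ t ∈ Icc (-1 : ℝ) 1, Extremal (fnMap r) (derMap r) (evalMap r k t) (l t) (x t) (w t))
    (hN : ∀ t ∈ Icc (-1 : ℝ) 1, ‖fnMap r (x t)‖ = N) :
    ContinuousOn (fun t => fnMap r (x t)) (Icc (-1) 1) := by
  have hcont : ∀ c : ℝ, 0 ≤ c → ∀ t ∈ Icc (-1 : ℝ) 1, ∃ (z : ℝ → Sob r) (v : ℝ → L2),
      (∀ s ∈ Icc (-1 : ℝ) 1, Extremal (fnMap r) (derMap r) (evalMap r k s) c (z s) (v s)) ∧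
      Tendsto (fun s => ‖fnMap r (z s)‖) (𝓝[Icc (-1) 1] t) (𝓝 ‖fnMap r (z t)‖) := by
    intro c hc t ht
    have hE : ∀ s : ℝ, ∃ z v, s ∈ Icc (-1 : ℝ) 1 →
        Extremal (fnMap r) (derMap r) (evalMap r k s) c z v := by
      intro s
      by_cases hs : s ∈ Icc (-1 : ℝ) 1
      · obtain ⟨z, v, h⟩ := exists_extremal (r := r) (k := k) (by omega) (by omega) hc hs
        exact ⟨z, v, fun _ => h⟩
      · exact ⟨0, 0, fun h => absurd h hs⟩
    choose z v hE using hE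
    refine ⟨z, v, hE, (tendsto_extremal hrk ht (hE t ht) (ts := id) (ls := fun _ => c) (ws := v) ?_
      tendsto_const_nhds (tendsto_id.mono_left nhdsWithin_le_nhds)).1.norm⟩
    filter_upwards [self_mem_nhdsWithin] with s hs
    exact ⟨hc, hs, hE s hs⟩
  intro t ht
  -- The parameter is compared with constants: for c < l t the norm belonging to c is below N at t,
  -- hence at nearby s, and monotonicity in the parameter gives c < l s. The other side is
  -- symmetric.
  have hlt : Tendsto l (𝓝[Icc (-1) 1] t) (𝓝 (l t)) := by
    rw [tendsto_order]
    constructor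
    · intro c hc
      rcases lt_or_ge c 0 with h0 | h0
      · filter_upwards [self_mem_nhdsWithin] with s hs
        exact h0.trans_le (hl s hs)
      · obtain ⟨z, v, hz, hzt⟩ := hcont c h0 t ht
        have h1 := norm_fnMap_lt hrk (hz t ht) (h t ht) h0 hc
        rw [hN t ht] at h1
        filter_upwards [hzt.eventually_lt_const h1, self_mem_nhdsWithin] with s hs1 hs
        by_contra! hcon
        rw [← hN s hs] at hs1
        rcases hcon.eq_or_lt with h2 | h2
        · have h3 := h s hs
          rw [h2] at h3
          rw [(h3.unique (by positivity) (exists_derMap_eq r) (hz s hs) h0).1] at hs1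
          exact lt_irrefl _ hs1
        · exact lt_asymm hs1 (norm_fnMap_lt hrk (h s hs) (hz s hs) (hl s hs) h2)
    · intro c hc
      have h0 : 0 ≤ c := (hl t ht).trans hc.le
      obtain ⟨z, v, hz, hzt⟩ := hcont c h0 t ht
      have h1 := norm_fnMap_lt hrk (h t ht) (hz t ht) (hl t ht) hc
      rw [hN t ht] at h1
      filter_upwards [hzt.eventually_const_lt h1, self_mem_nhdsWithin] with s hs1 hs
      by_contra! hcon
      rw [← hN s hs] at hs1
      rcases hcon.eq_or_lt with h2 | h2
      · have h3 := h s hs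
        rw [← h2] at h3
        rw [(h3.unique (by positivity) (exists_derMap_eq r) (hz s hs) h0).1] at hs1
        exact lt_irrefl _ hs1
      · exact lt_asymm hs1 (norm_fnMap_lt hrk (hz s hs) (h s hs) h0 h2)
  refine (tendsto_extremal hrk ht (h t ht) (ts := id) (ws := w) ?_ hlt
    (tendsto_id.mono_left nhdsWithin_le_nhds)).1
  filter_upwards [self_mem_nhdsWithin] with s hs
  exact ⟨hl s hs, hs, h s hs⟩

/-- The extremal error at `t` does not exceed that at `-1`. -/
theorem norm_le_norm_left (hrk : (r = 1 ∧ k = 0) ∨ (r = 2 ∧ (k = 0 ∨ k = 1))) {l l' t : ℝ}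
    (ht : t ∈ Icc (-1 : ℝ) 1) {x x' : Sob r} {w w' : L2} (hl : 0 ≤ l)
    (h : Extremal (fnMap r) (derMap r) (evalMap r k t) l x w)
    (h' : Extremal (fnMap r) (derMap r) (evalMap r k (-1)) l' x' w')
    (hn : ‖fnMap r x‖ = ‖fnMap r x'‖) : ‖w‖ ≤ ‖w'‖ := by
  -- At -1 the given pair, although it belongs to l', competes in the minimum for ν. So the energy
  -- at t is at most N² + ν‖w'‖², N being the common norm.
  have key : ∀ ν : ℝ, 0 < ν → ∀ z v, Extremal (fnMap r) (derMap r) (evalMap r k t) ν z v →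
      ‖fnMap r z‖ ^ 2 + ν * ‖v‖ ^ 2 ≤ ‖fnMap r x‖ ^ 2 + ν * ‖w'‖ ^ 2 := by
    intro ν hν z v hz
    obtain ⟨z', v', hz'⟩ := exists_extremal (r := r) (k := k) (by omega) (by omega) hν.le
      (t := -1) (by norm_num)
    rw [hn]
    exact (energy_le hrk hν ht hz hz').trans (hz'.le_of_represents hν.le h'.rep)
  have hdone : ∀ ν : ℝ, 0 < ν → ∀ z v, Extremal (fnMap r) (derMap r) (evalMap r k t) ν z v →
      ‖fnMap r x‖ ≤ ‖fnMap r z‖ → ‖v‖ ≤ ‖w'‖ := by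
    intro ν hν z v hz hxz
    have h1 := key ν hν z v hz
    have h2 := pow_le_pow_left₀ (norm_nonneg _) hxz 2
    have h3 : ν * ‖v‖ ^ 2 ≤ ν * ‖w'‖ ^ 2 := by linarith
    exact le_of_sq_le_sq (le_of_mul_le_mul_left h3 hν) (norm_nonneg _)
  -- At l = 0 the energy does not see w, so the bound is obtained for ν > 0, where the norm is at
  -- least N by monotonicity, and passed to the limit ν → 0.
  rcases hl.eq_or_lt with rfl | hl0
  · have hE : ∀ ν : ℝ, ∃ z v, 0 < ν → Extremal (fnMap r) (derMap r) (evalMap r k t) ν z v := by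
      intro ν
      by_cases hν : 0 < ν
      · obtain ⟨z, v, h⟩ := exists_extremal (r := r) (k := k) (by omega) (by omega) hν.le ht
        exact ⟨z, v, fun _ => h⟩
      · exact ⟨0, 0, fun h => absurd h hν⟩
    choose z v hE using hE
    have htend := (tendsto_extremal (𝓕 := 𝓝[>] (0 : ℝ)) (ls := id) (ts := fun _ => t) (xs := z)
      (ws := v) hrk ht h (by
        filter_upwards [self_mem_nhdsWithin] with ν hν
        exact ⟨le_of_lt hν, ht, hE ν hν⟩) (tendsto_id.mono_left nhdsWithin_le_nhds)
      tendsto_const_nhds).2.norm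
    refine le_of_tendsto htend ?_
    filter_upwards [self_mem_nhdsWithin] with ν hν
    exact hdone ν hν _ _ (hE ν hν) (h.norm_le_norm (hE ν hν) le_rfl hν)
  · exact hdone l hl0 _ _ h le_rfl

/-! ### Polynomials and the constants M and M_t. -/

theorem forall_le_of_ae_le {Y : Type*} [LinearOrder Y] [TopologicalSpace Y]
    [OrderClosedTopology Y] {f : ℝ → Y} {c : Y} (hf : ContinuousOn f (Icc (-1) 1))
    (h : ∀ᵐ x ∂muI, f x ≤ c) : ∀ x ∈ Icc (-1 : ℝ) 1, f x ≤ c := by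
  have h1 : (fun x => max (f x) c) =ᵐ[muI] fun _ => c := by
    filter_upwards [h] with x hx
    exact max_eq_right hx
  intro x hx
  exact max_eq_right_iff.1 (Measure.eqOn_Icc_of_ae_eq volume (by norm_num) h1
    (hf.sup continuousOn_const) continuousOn_const hx)

theorem enorm_le_eLpNorm_top {f : ℝ → ℝ} (hf : ContinuousOn f (Icc (-1) 1)) {x : ℝ}
    (hx : x ∈ Icc (-1 : ℝ) 1) : ‖f x‖ₑ ≤ eLpNorm f ∞ muI := by
  refine forall_le_of_ae_le (f := fun x => ‖f x‖ₑ) hf.enorm ?_ x hx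
  rw [eLpNorm_exponent_top]
  exact enorm_ae_le_eLpNormEssSup f muI

theorem eLpNorm_eq_ofReal {f : ℝ → ℝ} (hf : MemLp f 2 muI) :
    eLpNorm f 2 muI = ENNReal.ofReal ‖hf.toLp f‖ := by
  rw [Lp.norm_toLp, ENNReal.ofReal_toReal hf.eLpNorm_ne_top]

theorem eLpNorm_fnMap {r : ℕ} (F : Sob r) :
    eLpNorm (F.1 0) 2 muI = ENNReal.ofReal ‖fnMap r F‖ :=
  eLpNorm_eq_ofReal F.2.2.1

/-- The derivatives of a polynomial. -/
noncomputable def polySob (r : ℕ) (Q : Polynomial ℝ) : Sob r :=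
  ⟨fun j x => (Polynomial.derivative^[j] Q).eval x,
    IsChain.of_hasDerivAt (by norm_num) (fun j _ x => by
      rw [Function.iterate_succ_apply']
      exact Polynomial.hasDerivAt _ x) (Polynomial.continuous _),
    memLp_of_continuousOn (Polynomial.continuous _).continuousOn,
    memLp_of_continuousOn (Polynomial.continuous _).continuousOn⟩

theorem eLpNorm_eval (r : ℕ) (Q : Polynomial ℝ) :
    eLpNorm (fun x => Q.eval x) 2 muI = ENNReal.ofReal ‖fnMap r (polySob r Q)‖ :=
  eLpNorm_fnMap (polySob r Q)

theorem derMap_polySob {r : ℕ} {Q : Polynomial ℝ} (hQ : Q ∈ Polynomial.degreeLT ℝ r) :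
    derMap r (polySob r Q) = 0 := by
  refine (MemLp.toLp_eq_toLp_iff (polySob r Q).2.2.2 MemLp.zero).2 (Eventually.of_forall fun x => ?_)
  change (Polynomial.derivative^[r] Q).eval x = 0
  rw [Polynomial.iterate_derivative_eq_zero_of_degree_lt (Polynomial.mem_degreeLT.1 hQ),
    Polynomial.eval_zero]

theorem eqOn_const_of_derMap_eq_zero {m : ℕ} (F : Sob (m + 1)) (h : derMap (m + 1) F = 0) :
    ∀ x ∈ Icc (-1 : ℝ) 1, F.1 m x = F.1 m (-1) := by
  intro x hx
  have h1 := abs_evalMap_sub_le (k := m) rfl hx (left_mem_Icc.2 (by norm_num)) F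
  rw [h, norm_zero, mul_zero] at h1
  exact sub_eq_zero.1 (abs_nonpos_iff.1 h1)

/-- A function whose derivative of order `r` vanishes is a polynomial. -/
theorem exists_polynomial {r k : ℕ} (hrk : (r = 1 ∧ k = 0) ∨ (r = 2 ∧ (k = 0 ∨ k = 1)))
    (F : Sob r) (h : derMap r F = 0) :
    ∃ Q ∈ Polynomial.degreeLT ℝ r, ∀ j < r, ∀ x ∈ Icc (-1 : ℝ) 1,
      F.1 j x = (Polynomial.derivative^[j] Q).eval x := by
  rcases (by omega : r = 1 ∨ r = 2) with rfl | rfl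
  · have h1 := eqOn_const_of_derMap_eq_zero F h
    refine ⟨Polynomial.C (F.1 0 (-1)), ?_, fun j hj x hx => ?_⟩
    · rw [Polynomial.mem_degreeLT]
      exact lt_of_le_of_lt Polynomial.degree_C_le (by norm_num)
    · obtain rfl : j = 0 := by omega
      simpa using h1 x hx
  · have h1 := eqOn_const_of_derMap_eq_zero F h
    refine ⟨Polynomial.C (F.1 1 (-1)) * Polynomial.X
      + Polynomial.C (F.1 0 (-1) + F.1 1 (-1)), ?_, fun j hj x hx => ?_⟩
    · rw [Polynomial.mem_degreeLT]
      exact lt_of_le_of_lt Polynomial.degree_linear_le (by norm_num)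
    · rcases (by omega : j = 0 ∨ j = 1) with rfl | rfl
      · have h2 := (F.2.1 0 (by norm_num)).2 x hx
        have h3 : ∫ y in (-1)..x, F.1 (0 + 1) y = ∫ y in (-1)..x, F.1 1 (-1) := by
          refine intervalIntegral.integral_congr fun y hy => ?_
          rw [uIcc_of_le hx.1] at hy
          exact h1 y ⟨hy.1, hy.2.trans hx.2⟩
        rw [h3, intervalIntegral.integral_const, smul_eq_mul] at h2
        simp only [Function.iterate_zero, id, Polynomial.eval_add, Polynomial.eval_mul,
          Polynomial.eval_C, Polynomial.eval_X]
        linarith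
      · simpa using h1 x hx

/-- At parameter 0 the extremal element is a polynomial Q with Q^(k)(t) = ‖Q‖², so any admissible
constant is at least ‖Q‖. -/
theorem le_markovConst {r k : ℕ} (hrk : (r = 1 ∧ k = 0) ∨ (r = 2 ∧ (k = 0 ∨ k = 1))) {t : ℝ}
    (ht : t ∈ Icc (-1 : ℝ) 1) {x : Sob r} {w : L2}
    (h : Extremal (fnMap r) (derMap r) (evalMap r k t) 0 x w) :
    ENNReal.ofReal ‖fnMap r x‖ ≤ markovConst r k := by
  obtain ⟨Q, hQ, hxQ⟩ := exists_polynomial hrk x (by rw [h.eqn, zero_smul])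
  refine le_sInf fun C hC => ?_
  rcases (norm_nonneg (fnMap r x)).eq_or_lt with h0 | h0
  · rw [← h0]; simp
  have h1 : eLpNorm (fun y => Q.eval y) 2 muI = ENNReal.ofReal ‖fnMap r x‖ := by
    rw [← eLpNorm_fnMap]
    refine eLpNorm_congr_ae ?_
    filter_upwards [ae_restrict_mem measurableSet_Icc] with y hy
    exact (hxQ 0 (by omega) y hy).symm
  have h2 := (enorm_le_eLpNorm_top (Polynomial.continuous _).continuousOn ht).trans (hC Q hQ)
  have h3 : (Polynomial.derivative^[k] Q).eval t = ‖fnMap r x‖ * ‖fnMap r x‖ := by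
    rw [← hxQ k (by omega) t ht]
    refine Eq.trans h.apply_self ?_
    ring
  rw [h1, h3, Real.enorm_eq_ofReal (by positivity), ENNReal.ofReal_mul h0.le] at h2
  exact (ENNReal.mul_le_mul_iff_left (by simpa using h0) ENNReal.ofReal_ne_top).1 h2

/-- If k = r - 1 the derivative is constant. A linear function is largest in modulus at an end
point, and reflection moves 1 to -1 without changing the norm. -/
theorem exists_abs_le_left {r k : ℕ} (hrk : (r = 1 ∧ k = 0) ∨ (r = 2 ∧ (k = 0 ∨ k = 1)))
    {Q : Polynomial ℝ} (hQ : Q ∈ Polynomial.degreeLT ℝ r) {x : ℝ} (hx : x ∈ Icc (-1 : ℝ) 1) :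
    ∃ P ∈ Polynomial.degreeLT ℝ r,
      |(Polynomial.derivative^[k] Q).eval x| ≤ |(Polynomial.derivative^[k] P).eval (-1)| ∧
      eLpNorm (fun x => P.eval x) 2 muI = eLpNorm (fun x => Q.eval x) 2 muI := by
  rcases (by omega : k + 1 = r ∨ (r = 2 ∧ k = 0)) with rfl | ⟨rfl, rfl⟩
  · refine ⟨Q, hQ, ?_, rfl⟩
    have := eqOn_const_of_derMap_eq_zero (polySob (k + 1) Q) (derMap_polySob hQ) x hx
    exact (congrArg _ this).le
  · obtain ⟨b, a, rfl⟩ := Polynomial.exists_eq_X_add_C_of_natDegree_le_one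
      (p := Q) (Nat.lt_succ_iff.1 (by
        rcases eq_or_ne Q 0 with rfl | h0
        · simp
        · exact (Polynomial.natDegree_lt_iff_degree_lt h0).2 (Polynomial.mem_degreeLT.1 hQ)))
    have e : ∀ b y : ℝ, (Polynomial.C b * Polynomial.X + Polynomial.C a).eval y = b * y + a :=
      fun b y => by simp
    have hm : ∀ b : ℝ, Polynomial.C b * Polynomial.X + Polynomial.C a
        ∈ Polynomial.degreeLT ℝ 2 := fun b => by
      rw [Polynomial.mem_degreeLT]
      exact lt_of_le_of_lt Polynomial.degree_linear_le (by norm_num)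
    have h1 : |b * x + a| ≤ |b * (-1) + a| ∨ |b * x + a| ≤ |(-b) * (-1) + a| := by
      by_contra! hcon
      have h2 := sq_lt_sq.2 hcon.1
      have h3 := sq_lt_sq.2 hcon.2
      nlinarith [mul_nonneg (sub_nonneg.2 hx.2) (by linarith [hx.1] : 0 ≤ x + 1), sq_nonneg b,
        mul_nonneg (mul_nonneg (sub_nonneg.2 hx.2) (by linarith [hx.1] : 0 ≤ x + 1)) (sq_nonneg b),
        mul_nonneg (sub_nonneg.2 hx.2) (sub_pos.2 h2).le,
        mul_nonneg (by linarith [hx.1] : 0 ≤ x + 1) (sub_pos.2 h3).le,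
        mul_nonneg (sub_nonneg.2 hx.2) (sub_pos.2 h3).le,
        mul_nonneg (by linarith [hx.1] : 0 ≤ x + 1) (sub_pos.2 h2).le]
    rcases h1 with h1 | h1
    · exact ⟨_, hm b, by simpa only [Function.iterate_zero, id, e] using h1, rfl⟩
    · refine ⟨_, hm (-b), by simpa only [Function.iterate_zero, id, e] using h1, ?_⟩
      rw [eLpNorm_eval 2, eLpNorm_eval 2]
      congr 1
      refine (sq_eq_sq₀ (norm_nonneg _) (norm_nonneg _)).1 ?_
      rw [sq_norm_fnMap, sq_norm_fnMap]
      change ∫ y in (-1)..1, (Polynomial.eval y _) ^ 2 = ∫ y in (-1)..1, (Polynomial.eval y _) ^ 2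
      simp only [Function.iterate_zero, id, e]
      have := intervalIntegral.integral_comp_neg (a := -1) (b := 1) (fun y => (b * y + a) ^ 2)
      rw [neg_neg] at this
      rw [← this]
      simp only [mul_neg, neg_mul]

theorem markovConst_eq {r k : ℕ} (hrk : (r = 1 ∧ k = 0) ∨ (r = 2 ∧ (k = 0 ∨ k = 1))) :
    markovConst r k = markovConstAt r k (-1) := by
  unfold markovConst markovConstAt
  congr 1
  ext C
  refine ⟨fun h Q hQ => (enorm_le_eLpNorm_top (Polynomial.continuous _).continuousOn
    (left_mem_Icc.2 (by norm_num))).trans (h Q hQ), fun h Q hQ => ?_⟩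
  rw [eLpNorm_exponent_top]
  refine eLpNormEssSup_le_of_ae_enorm_bound ?_
  filter_upwards [ae_restrict_mem measurableSet_Icc] with x hx
  obtain ⟨P, hP, h1, h2⟩ := exists_abs_le_left hrk hQ hx
  have h3 := h P hP
  rw [h2] at h3
  refine le_trans ?_ h3
  rw [Real.enorm_eq_ofReal_abs, Real.enorm_eq_ofReal_abs]
  exact ENNReal.ofReal_le_ofReal h1

/-! ### Upper and lower bounds for the error. -/

theorem InW.exists_sob (hr : 1 ≤ r) {f : ℝ → ℝ} (hf : InW r f) :
    ∃ F : Sob r, (∀ j, F.1 j = dI j f) ∧ ‖derMap r F‖ ≤ 1 ∧ fnMap r F = hf.toL2 := by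
  have hm : (fun j => dI j f) ∈ Sob r :=
    mem_sob hr (hf.inL2n.isChain (by norm_num) hr) hf.inL2n.memLp
  refine ⟨⟨_, hm⟩, fun _ => rfl, ?_, ?_⟩
  · have h1 := hf.norm_le
    rw [eLpNorm_eq_ofReal hf.inL2n.memLp, ENNReal.ofReal_le_one] at h1
    exact h1
  · refine (MemLp.toLp_eq_toLp_iff hm.2.1 hf.memLp_two).2 (Eventually.of_forall fun x => ?_)
    simp [dI]

theorem inW_of_sob (hr : 1 ≤ r) (F : Sob r) (h : ‖derMap r F‖ ≤ 1) : InW r (F.1 0) := by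
  refine ⟨F.2.1.inL2n (by norm_num) hr F.2.2.2, ?_⟩
  rw [eLpNorm_congr_ae (F.2.1.iteratedDerivWithin_ae_eq (by norm_num) hr),
    eLpNorm_eq_ofReal F.2.2.2, ENNReal.ofReal_le_one]
  exact h

theorem le_errUAt (hk : k < r) {t : ℝ} (ht : t ∈ Icc (-1 : ℝ) 1) {N : ℝ≥0}
    {S : L2 →L[ℝ] ℝ} (hS : ‖S‖ ≤ N) (F : Sob r) (h : ‖derMap r F‖ ≤ 1) :
    ENNReal.ofReal (evalMap r k t F - N * ‖fnMap r F‖) ≤ errUAt r k t S := by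
  have hF := inW_of_sob (by omega) F h
  refine le_trans ?_ (le_iSup₂ (f := fun f (hf : InW r f) => ‖dI k f t - S hf.toL2‖ₑ) _ hF)
  rw [Real.enorm_eq_ofReal_abs, dI, F.2.1.iteratedDerivWithin_eqOn (by norm_num) k hk ht]
  refine ENNReal.ofReal_le_ofReal ?_
  have h1 : ‖S hF.toL2‖ ≤ N * ‖fnMap r F‖ := S.le_of_opNorm_le hS _
  exact (sub_le_sub_left ((le_abs_self _).trans h1) _).trans (le_abs_self _)

theorem ae_norm_le_norm (f : Linf) : ∀ᵐ x ∂muI, ‖f x‖ ≤ ‖f‖ := by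
  filter_upwards [enorm_ae_le_eLpNormEssSup f muI] with x hx
  rw [← eLpNorm_exponent_top] at hx
  rw [Lp.norm_def, ← toReal_enorm]
  exact ENNReal.toReal_mono (Lp.eLpNorm_ne_top f) hx

theorem le_errU (hk : k < r) {t : ℝ} (ht : t ∈ Icc (-1 : ℝ) 1) {N : ℝ≥0}
    {S : L2 →L[ℝ] Linf} (hS : ‖S‖ ≤ N) (F : Sob r) (h : ‖derMap r F‖ ≤ 1) :
    ENNReal.ofReal (evalMap r k t F - N * ‖fnMap r F‖) ≤ errU r k S := by
  have hF := inW_of_sob (by omega) F h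
  refine le_trans ?_ (le_iSup₂ (f := fun f (hf : InW r f) =>
    eLpNorm (fun t => dI k f t - S hf.toL2 t) ∞ muI) _ hF)
  -- The image under S has no values at points, so the bound is proved almost everywhere and
  -- extended to t by continuity of the k-th derivative.
  refine forall_le_of_ae_le (f := fun t => ENNReal.ofReal (F.1 k t - N * ‖fnMap r F‖)) ?_ ?_ t ht
  · exact ENNReal.continuous_ofReal.comp_continuousOn
      ((F.2.1.continuousOn (by norm_num) hk).sub continuousOn_const)
  · have h1 : ‖S hF.toL2‖ ≤ N * ‖fnMap r F‖ := S.le_of_opNorm_le hS _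
    rw [eLpNorm_exponent_top]
    filter_upwards [enorm_ae_le_eLpNormEssSup (fun t => dI k (F.1 0) t - S hF.toL2 t) muI,
      ae_restrict_mem measurableSet_Icc, ae_norm_le_norm (S hF.toL2)] with x hx hxI hxS
    refine le_trans ?_ hx
    rw [Real.enorm_eq_ofReal_abs, dI, F.2.1.iteratedDerivWithin_eqOn (by norm_num) k hk hxI]
    refine ENNReal.ofReal_le_ofReal ?_
    exact (sub_le_sub_left ((le_abs_self _).trans (hxS.trans h1)) _).trans (le_abs_self _)

/-- Below the constant for polynomials the error is infinite. -/
theorem errE_eq_top (hrk : (r = 1 ∧ k = 0) ∨ (r = 2 ∧ (k = 0 ∨ k = 1))) {N : ℝ≥0}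
    (hN : (N : ℝ≥0∞) < markovConst r k) : errE r k N = ∞ := by
  rw [markovConst_eq hrk] at hN
  have h1 := notMem_of_lt_csInf hN (OrderBot.bddBelow _)
  simp only [mem_ofPred_eq, not_forall, not_le] at h1
  obtain ⟨Q, hQ, h1⟩ := h1
  rw [eLpNorm_eval r, ← ENNReal.ofReal_coe_nnreal, ← ENNReal.ofReal_mul N.coe_nonneg,
    Real.enorm_eq_ofReal_abs, ENNReal.ofReal_lt_ofReal_iff_of_nonneg (by positivity)] at h1
  refine iInf₂_eq_top.2 fun S hS => ?_
  -- All multiples of a G in the kernel belong to the class, so one positive gap is scaled without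
  -- limit.
  have h2 : ∀ G : Sob r, derMap r G = 0 → ∀ c : ℝ, 0 ≤ c →
      ENNReal.ofReal (c * (evalMap r k (-1) G - N * ‖fnMap r G‖)) ≤ errU r k S := by
    intro G hG c hc
    have h3 := le_errU (k := k) (by omega) (left_mem_Icc.2 (by norm_num : (-1 : ℝ) ≤ 1)) hS (c • G)
      (by rw [map_smul, hG, smul_zero, norm_zero]; exact zero_le_one)
    rw [map_smul, map_smul, norm_smul, Real.norm_of_nonneg hc, smul_eq_mul] at h3
    refine le_trans (le_of_eq ?_) h3
    congr 1
    ring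
  obtain ⟨G, hG, h3⟩ : ∃ G : Sob r, derMap r G = 0 ∧
      0 < evalMap r k (-1) G - N * ‖fnMap r G‖ := by
    rcases le_total 0 ((Polynomial.derivative^[k] Q).eval (-1)) with h0 | h0
    · rw [abs_of_nonneg h0] at h1
      exact ⟨polySob r Q, derMap_polySob hQ, sub_pos.2 h1⟩
    · rw [abs_of_nonpos h0] at h1
      refine ⟨-polySob r Q, by rw [map_neg, derMap_polySob hQ, neg_zero], ?_⟩
      rw [map_neg, map_neg, norm_neg]
      exact sub_pos.2 h1
  refine ENNReal.eq_top_of_forall_nnreal_le fun B => ?_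
  refine le_trans (le_of_eq ?_) (h2 G hG (B / (evalMap r k (-1) G - N * ‖fnMap r G‖))
    (by positivity))
  rw [div_mul_cancel₀ _ h3.ne', ENNReal.ofReal_coe_nnreal]

/-- The lower bound by means of the extremal functions of larger parameters. -/
theorem ofReal_norm_le (hrk : (r = 1 ∧ k = 0) ∨ (r = 2 ∧ (k = 0 ∨ k = 1))) {l : ℝ} {t : ℝ}
    (ht : t ∈ Icc (-1 : ℝ) 1) {x : Sob r} {w : L2} (hl : 0 ≤ l)
    (h : Extremal (fnMap r) (derMap r) (evalMap r k t) l x w) {B : ℝ≥0∞}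
    (hB : ∀ F : Sob r, ‖derMap r F‖ ≤ 1 →
      ENNReal.ofReal (evalMap r k t F - ‖fnMap r x‖ * ‖fnMap r F‖) ≤ B) :
    ENNReal.ofReal ‖w‖ ≤ B := by
  -- Parameters ν > l are used because at l = 0 the derivative of order r vanishes and cannot be
  -- normalised.
  have hE : ∀ ν : ℝ, ∃ z v, l < ν → Extremal (fnMap r) (derMap r) (evalMap r k t) ν z v := by
    intro ν
    by_cases hν : l < ν
    · obtain ⟨z, v, h⟩ := exists_extremal (r := r) (k := k) (by omega) (by omega)
        (hl.trans hν.le) ht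
      exact ⟨z, v, fun _ => h⟩
    · exact ⟨0, 0, fun h => absurd h hν⟩
  choose z v hE using hE
  have htend := (tendsto_extremal (𝓕 := 𝓝[>] l) (ls := id) (ts := fun _ => t) (xs := z)
    (ws := v) hrk ht h (by
      filter_upwards [self_mem_nhdsWithin] with ν hν
      exact ⟨hl.trans (le_of_lt hν), ht, hE ν hν⟩) (tendsto_id.mono_left nhdsWithin_le_nhds)
    tendsto_const_nhds).2.norm
  refine le_of_tendsto ((ENNReal.continuous_ofReal.tendsto _).comp htend) ?_
  filter_upwards [self_mem_nhdsWithin] with ν hν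
  have hν0 : 0 < ν := hl.trans_lt hν
  change ENNReal.ofReal ‖v ν‖ ≤ B
  rcases (norm_nonneg (v ν)).eq_or_lt with h0 | h0
  · rw [← h0]; simp
  -- This gives `c • z ν` an r-th derivative of norm 1. Its value is c(‖z‖² + ν‖v‖²), where c ν‖v‖²
  -- = ‖v‖, and c‖z‖² covers the penalty c‖x‖‖z‖ since ‖x‖ ≤ ‖z‖.
  set c := (ν * ‖v ν‖)⁻¹ with hc
  have hc0 : 0 < c := by positivity
  have h1 := hE ν hν
  refine le_trans (ENNReal.ofReal_le_ofReal ?_) (hB (c • z ν) ?_)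
  · rw [map_smul, map_smul, norm_smul, Real.norm_of_nonneg hc0.le, smul_eq_mul, h1.apply_self]
    have h2 := mul_le_mul_of_nonneg_right (h.norm_le_norm h1 hl hν) (norm_nonneg (fnMap r (z ν)))
    have h3 : c * (ν * ‖v ν‖ ^ 2) = ‖v ν‖ := by rw [hc]; field_simp
    have h4 := mul_le_mul_of_nonneg_left h2 hc0.le
    nlinarith
  · rw [map_smul, h1.eqn, norm_smul, norm_smul, Real.norm_of_nonneg hc0.le,
      Real.norm_of_nonneg hν0.le, hc, inv_mul_cancel₀ (by positivity)]

theorem Represents.abs_sub_le {t : ℝ} {g w : L2}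
    (h : Represents (fnMap r) (derMap r) (evalMap r k t) g w) (F : Sob r)
    (hF : ‖derMap r F‖ ≤ 1) : |evalMap r k t F - ⟪g, fnMap r F⟫| ≤ ‖w‖ := by
  rw [h F, add_sub_cancel_left]
  exact (abs_real_inner_le_norm _ _).trans (mul_le_of_le_one_right (norm_nonneg _) hF)

theorem errUAt_le (hr : 1 ≤ r) {t : ℝ} {g w : L2}
    (h : Represents (fnMap r) (derMap r) (evalMap r k t) g w) :
    errUAt r k t (innerSL ℝ g) ≤ ENNReal.ofReal ‖w‖ := by
  refine iSup₂_le fun f hf => ?_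
  obtain ⟨F, hF, hF1, hF2⟩ := hf.exists_sob hr
  rw [Real.enorm_eq_ofReal_abs, ← hF2, ← hF]
  exact ENNReal.ofReal_le_ofReal (h.abs_sub_le F hF1)

/-- The operator with values `⟪G t, f⟫`. -/
theorem exists_operator {G : ℝ → L2} (hG : ContinuousOn G (Icc (-1) 1)) {N : ℝ≥0}
    (hN : ∀ t ∈ Icc (-1 : ℝ) 1, ‖G t‖ ≤ N) :
    ∃ S : L2 →L[ℝ] Linf, ‖S‖ ≤ N ∧ ∀ f, S f =ᵐ[muI] fun t => ⟪G t, f⟫ := by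
  have hm : ∀ f : L2, MemLp (fun t => ⟪G t, f⟫) ∞ muI := fun f =>
    memLp_of_continuousOn (hG.inner continuousOn_const)
  let T : L2 →ₗ[ℝ] Linf :=
    { toFun := fun f => (hm f).toLp _
      map_add' := fun f g => by
        rw [← MemLp.toLp_add]
        refine (MemLp.toLp_eq_toLp_iff _ _).2 (Eventually.of_forall fun t => ?_)
        simp [inner_add_right]
      map_smul' := fun c f => by
        rw [RingHom.id_apply, ← MemLp.toLp_const_smul]
        refine (MemLp.toLp_eq_toLp_iff _ _).2 (Eventually.of_forall fun t => ?_)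
        simp [inner_smul_right] }
  refine ⟨T.mkContinuous N fun f => ?_, T.mkContinuous_norm_le N.coe_nonneg _,
    fun f => (hm f).coeFn_toLp⟩
  change ‖(hm f).toLp _‖ ≤ _
  rw [Lp.norm_toLp, eLpNorm_exponent_top]
  refine ENNReal.toReal_le_of_le_ofReal (by positivity) (eLpNormEssSup_le_of_ae_bound ?_)
  filter_upwards [ae_restrict_mem measurableSet_Icc] with t ht
  exact (norm_inner_le_norm _ _).trans (mul_le_mul_of_nonneg_right (hN t ht) (norm_nonneg _))

/-! ### The optimal parameters and the extremal operator. -/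

theorem IsSol.exists_extremal {l t : ℝ} {u : ℝ → ℝ} (h : IsSol r k l t u) (hr : 1 ≤ r)
    (hk : k < r) (ht : t ∈ Icc (-1 : ℝ) 1) :
    ∃ x w, Extremal (fnMap r) (derMap r) (evalMap r k t) l x w ∧
      iteratedDeriv r u =ᵐ[muI] x.1 0 ∧ eLpNorm u 2 muI = ENNReal.ofReal ‖w‖ := by
  obtain ⟨V, W, hj, h0, hr'⟩ := h.exists_jumpSol hr hk
  refine ⟨_, _, hj.extremal hr hk ht, hr', ?_⟩
  rw [eLpNorm_congr_ae h0, eLpNorm_eq_ofReal (hj.memLp ht (by omega)), norm_smul]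
  simp

theorem IsOptimal.exists_extremal {l t : ℝ} {u : ℝ → ℝ} {N : ℝ≥0} (h : IsOptimal r k N t l u)
    (hr : 1 ≤ r) (hk : k < r) (ht : t ∈ Icc (-1 : ℝ) 1) :
    ∃ x w, Extremal (fnMap r) (derMap r) (evalMap r k t) l x w ∧
      iteratedDeriv r u =ᵐ[muI] x.1 0 ∧ eLpNorm u 2 muI = ENNReal.ofReal ‖w‖ ∧
      ‖fnMap r x‖ = N := by
  obtain ⟨x, w, h1, h2, h3⟩ := h.sol.exists_extremal hr hk ht
  refine ⟨x, w, h1, h2, h3, ?_⟩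
  have h4 := h.norm_eq
  rw [eLpNorm_congr_ae h2, eLpNorm_fnMap, ← ENNReal.ofReal_coe_nnreal,
    ENNReal.ofReal_eq_ofReal_iff (norm_nonneg _) N.coe_nonneg] at h4
  exact h4

theorem existsUnique_isOptimal (hrk : (r = 1 ∧ k = 0) ∨ (r = 2 ∧ (k = 0 ∨ k = 1))) {N : ℝ≥0}
    (hN : markovConst r k ≤ N) {t : ℝ} (ht : t ∈ Icc (-1 : ℝ) 1) :
    ∃! l : ℝ, ∃ u : ℝ → ℝ, IsOptimal r k N t l u := by
  obtain ⟨l, hl, x, w, h, hx⟩ := exists_param (N := N) hrk ht fun x w h => by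
    have h1 := (le_markovConst hrk ht h).trans hN
    rwa [← ENNReal.ofReal_coe_nnreal, ENNReal.ofReal_le_ofReal_iff N.coe_nonneg] at h1
  refine ⟨l, ?_, ?_⟩
  · obtain ⟨u, hu⟩ := exists_isSol (r := r) (k := k) (by omega) (by omega) hl ht
    obtain ⟨y, v, h1, h2, -⟩ := hu.exists_extremal (by omega) (by omega) ht
    refine ⟨u, hl, hu, ?_⟩
    rw [eLpNorm_congr_ae h2, eLpNorm_fnMap,
      (h1.unique (by positivity) (exists_derMap_eq r) h hl).1, hx, ENNReal.ofReal_coe_nnreal]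
  · rintro m ⟨u, hu⟩
    obtain ⟨y, v, h1, -, -, h2⟩ := hu.exists_extremal (by omega) (by omega) ht
    exact param_unique hrk h1 h hu.nonneg hl (h2.trans hx.symm)

theorem inner_fnMap_eq_integral {x : Sob r} {g : ℝ → ℝ} (hg : g =ᵐ[muI] x.1 0) (f : L2) :
    ⟪fnMap r x, f⟫ = ∫ y, g y * f y ∂muI := by
  rw [L2.inner_def]
  refine integral_congr_ae ?_
  filter_upwards [hg, (x.2.2.1).coeFn_toLp] with y h1 h2
  change ⟪(x.2.2.1.toLp (x.1 0)) y, f y⟫ = _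
  rw [h1, h2]
  simp [mul_comm]

end Stechkin

theorem mainTheorem11 (r k : ℕ) (hrk : (r = 1 ∧ k = 0) ∨ (r = 2 ∧ (k = 0 ∨ k = 1))) :
    markovConst r k = markovConstAt r k (-1) ∧
    (∀ N : ℝ≥0, 0 < N → (N : ℝ≥0∞) < markovConst r k → errE r k N = ∞) ∧
    (∀ N : ℝ≥0, markovConst r k ≤ N →
      -- the parameters `λ_{N,t}` and the functions `u_{λ_{N,t},t}` exist, the former uniquely
      (∀ t ∈ Icc (-1 : ℝ) 1, ∃! l : ℝ, ∃ u : ℝ → ℝ, IsOptimal r k N t l u) ∧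
      -- and, whatever representatives are chosen, the operator `S_N` that they define is extremal
      ∀ (l : ℝ → ℝ) (u : ℝ → ℝ → ℝ), (∀ t ∈ Icc (-1 : ℝ) 1, IsOptimal r k N t (l t) (u t)) →
        (∃ S : L2 →L[ℝ] Linf,
          (∀ f : L2, S f =ᵐ[muI] fun t => ∫ x, iteratedDeriv r (u t) x * f x ∂muI) ∧
          ‖S‖ ≤ N ∧ errU r k S = eLpNorm (u (-1)) 2 muI) ∧
        errE r k N = eLpNorm (u (-1)) 2 muI ∧
        errEAt r k (-1) N = eLpNorm (u (-1)) 2 muI) := by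
  have hr : 1 ≤ r := by omega
  have hk : k < r := by omega
  have hleft : (-1 : ℝ) ∈ Icc (-1 : ℝ) 1 := by norm_num
  refine ⟨markovConst_eq hrk, fun N _ hN => errE_eq_top hrk hN, fun N hN =>
    ⟨fun t ht => existsUnique_isOptimal hrk hN ht, fun l u hu => ?_⟩⟩
  have hE : ∀ t : ℝ, ∃ (x : Sob r) (w : L2), t ∈ Icc (-1 : ℝ) 1 →
      Extremal (fnMap r) (derMap r) (evalMap r k t) (l t) x w ∧
      iteratedDeriv r (u t) =ᵐ[muI] x.1 0 ∧ eLpNorm (u t) 2 muI = ENNReal.ofReal ‖w‖ ∧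
      ‖fnMap r x‖ = N := by
    intro t
    by_cases ht : t ∈ Icc (-1 : ℝ) 1
    · obtain ⟨x, w, h⟩ := (hu t ht).exists_extremal hr hk ht
      exact ⟨x, w, fun _ => h⟩
    · exact ⟨0, 0, fun h => absurd h ht⟩
  choose x w hE using hE
  have hx : ∀ t ∈ Icc (-1 : ℝ) 1, ‖fnMap r (x t)‖ = N := fun t ht => (hE t ht).2.2.2
  rw [(hE _ hleft).2.2.1]
  have hlow : ∀ S : L2 →L[ℝ] Linf, ‖S‖ ≤ N → ENNReal.ofReal ‖w (-1)‖ ≤ errU r k S := fun S hS =>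
    ofReal_norm_le hrk hleft (hu _ hleft).nonneg (hE _ hleft).1 fun F hF => by
      rw [hx _ hleft]
      exact le_errU hk hleft hS F hF
  obtain ⟨S, hS, hSf⟩ := exists_operator
    (continuousOn_fnMap hrk (fun t ht => (hu t ht).nonneg) (fun t ht => (hE t ht).1) hx)
    fun t ht => (hx t ht).le
  -- At each t the error is at most the norm of the second component there, and that is largest at
  -- -1.
  have hup : errU r k S ≤ ENNReal.ofReal ‖w (-1)‖ := by
    refine iSup₂_le fun f hf => ?_
    obtain ⟨F, hF, hF1, hF2⟩ := hf.exists_sob hr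
    rw [eLpNorm_exponent_top]
    refine eLpNormEssSup_le_of_ae_enorm_bound ?_
    filter_upwards [hSf hf.toL2, ae_restrict_mem measurableSet_Icc] with t h1 ht
    rw [h1, Real.enorm_eq_ofReal_abs, ← hF2, ← hF]
    refine ENNReal.ofReal_le_ofReal (((hE t ht).1.rep.abs_sub_le F hF1).trans ?_)
    exact norm_le_norm_left hrk ht (hu t ht).nonneg (hE t ht).1 (hE _ hleft).1
      ((hx t ht).trans (hx _ hleft).symm)
  refine ⟨⟨S, fun f => ?_, hS, le_antisymm hup (hlow S hS)⟩,
    le_antisymm ((iInf₂_le S hS).trans hup) (le_iInf₂ hlow), le_antisymm ?_ ?_⟩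
  · filter_upwards [hSf f, ae_restrict_mem measurableSet_Icc] with t h1 ht
    rw [h1, inner_fnMap_eq_integral (hE t ht).2.1]
  · refine (iInf₂_le (innerSL ℝ (fnMap r (x (-1)))) ?_).trans (errUAt_le hr (hE _ hleft).1.rep)
    rw [innerSL_apply_norm]
    exact (hx _ hleft).le
  · refine le_iInf₂ fun T hT => ?_
    refine ofReal_norm_le hrk hleft (hu _ hleft).nonneg (hE _ hleft).1 fun F hF => ?_
    rw [hx _ hleft]
    exact le_errUAt hk hleft hT F hF
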